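/- Let $k$ be a field. All coalgebras over $k$ are coassociative and counital, all comodules are counital, and $\otimes=\otimes_k$. For a right comodule $V$ and a left comodule $W$ over a coalgebra $D$, with coactions $v\mapsto v_{(0)}\otimes v_{(1)}$ and $w\mapsto w_{(-1)}\otimes w_{(0)}$, the cotensor product is $$V\,\Box_D\,W=\ker\bigl(V\otimes W\to V\otimes D\otimes W,\ v\otimes w\mapsto v_{(0)}\otimes v_{(1)}\otimes w-v\otimes w_{(-1)}\otimes w_{(0)}\bigr).$$ If $M$ is a $D$-bicomodule, $M\,\Box_D\,W$ is a left $D$-comodule through the left coaction of $M$. A left (right) $D$-comodule $X$ is coflat if the functor $-\,\Box_D\,X$ (respectively $X\,\Box_D\,-$) is exact. Put $$\mathrm{Cotor}_D^j(V,W)=H^j(V\,\Box_D\,Y^\bullet\,\Box_D\,W),$$ where $Y^\bullet$ is any injective resolution of $D$ in the category of $D$-bicomodules. Up to isomorphism this is also the $j$-th cohomology of the cobar complex with terms $V\otimes D^{\otimes n}\otimes W$ and differential $$d(v\otimes c^1\otimes\cdots\otimes c^n\otimes w)=v_{(0)}\otimes v_{(1)}\otimes c^1\otimes\cdots\otimes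 w+\sum_{l=1}^n(-1)^l v\otimes c^1\otimes\cdots\otimes\Delta(c^l)\otimes\cdots\otimes w+(-1)^{n+1}v\otimes c^1\otimes\cdots\otimes c^n\otimes w_{(-1)}\otimes w_{(0)}.$$ For a bicomodule $V$ over a coalgebra $C$, the Hochschild cohomology $HH^n(C,V)$ is the cohomology of the complex with terms $V\otimes C^{\otimes n}$ and differential $$b(v\otimes c^1\otimes\cdots\otimes c^n)=v_{(0)}\otimes v_{(1)}\otimes c^1\otimes\cdots\otimes c^n+\sum_{l=1}^n(-1)^l v\otimes c^1\otimes\cdots\otimes\Delta(c^l)\otimes\cdots\otimes c^n+(-1)^{n+1}v_{(0)}\otimes c^1\otimes\cdots\otimes c^n\otimes v_{(-1)}.$$ **Theorem.** Let $\pi:C\to D$ be a surjective homomorphism of $k$-coalgebras, and regard $C$-comodules as $D$-comodules via $\pi$. Let $V'$ be a left $C$-comodule, $V''$ a right $C$-comodule, and let $V=V'\otimes V''$ be the $C$-bicomodule whose left coaction is that of $V'$ and whose right coaction is that of $V''$. Assume that $C$ is coflat both as a left and as a right $D$-comodule. Then there is a first quadrant cohomological spectral sequence $(E_r^{i,j},d_r)_{r\ge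 1}$ of $k$-vector spaces, with $d_r$ of bidegree $(r,1-r)$, such that for all $i,j\ge 0$ $$E_1^{i,j}\cong \mathrm{Cotor}_D^j\bigl(V'',\,C^{\Box_D i}\,\Box_D\,V'\bigr),$$ where $C^{\Box_D i}\,\Box_D\,V'=C\,\Box_D\,(C\,\Box_D\cdots(C\,\Box_D\,V'))$ with $i$ factors $C$ (and $=V'$ for $i=0$), and which converges to $HH^{i+j}(C,V)$: each $HH^n(C,V)$ has a decreasing filtration $HH^n(C,V)=F^0\supseteq F^1\supseteq\cdots\supseteq F^{n+1}=0$ with $F^i/F^{i+1}\cong E_\infty^{i,n-i}$ for $0\le i\le n$. -/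

import Mathlib

open TensorProduct CategoryTheory

universe u v

noncomputable section

namespace CoalgCoh

section Comodules

variable (k : Type u) (D : Type v) [Field k] [AddCommGroup D] [Module k D] [Coalgebra k D]

/-- A left comodule over the (coassociative, counital) `k`-coalgebra `D`. -/
structure LeftComod where
  carrier : Type v
  [addCommGroup : AddCommGroup carrier]
  [module : Module k carrier]
  coact : carrier →ₗ[k] D ⊗[k] carrier
  coassoc : (TensorProduct.assoc k D D carrier).toLinearMap ∘ₗ
      (Coalgebra.comul (R := k) (A := D)).rTensor carrier ∘ₗ coact = coact.lTensor D ∘ₗ coact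
  counit_coact : (TensorProduct.lid k carrier).toLinearMap ∘ₗ
      (Coalgebra.counit (R := k) (A := D)).rTensor carrier ∘ₗ coact = LinearMap.id

/-- A right comodule over the `k`-coalgebra `D`. -/
structure RightComod where
  carrier : Type v
  [addCommGroup : AddCommGroup carrier]
  [module : Module k carrier]
  coact : carrier →ₗ[k] carrier ⊗[k] D
  coassoc : (TensorProduct.assoc k carrier D D).toLinearMap ∘ₗ coact.rTensor D ∘ₗ coact =
      (Coalgebra.comul (R := k) (A := D)).lTensor carrier ∘ₗ coact
  counit_coact : (TensorProduct.rid k carrier).toLinearMap ∘ₗ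
      (Coalgebra.counit (R := k) (A := D)).lTensor carrier ∘ₗ coact = LinearMap.id

/-- A `D`-bicomodule: commuting left and right `D`-coactions on one vector space. -/
structure Bicomod where
  carrier : Type v
  [addCommGroup : AddCommGroup carrier]
  [module : Module k carrier]
  lcoact : carrier →ₗ[k] D ⊗[k] carrier
  rcoact : carrier →ₗ[k] carrier ⊗[k] D
  lcoassoc : (TensorProduct.assoc k D D carrier).toLinearMap ∘ₗ
      (Coalgebra.comul (R := k) (A := D)).rTensor carrier ∘ₗ lcoact = lcoact.lTensor D ∘ₗ lcoact
  counit_lcoact : (TensorProduct.lid k carrier).toLinearMap ∘ₗ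
      (Coalgebra.counit (R := k) (A := D)).rTensor carrier ∘ₗ lcoact = LinearMap.id
  rcoassoc : (TensorProduct.assoc k carrier D D).toLinearMap ∘ₗ rcoact.rTensor D ∘ₗ rcoact =
      (Coalgebra.comul (R := k) (A := D)).lTensor carrier ∘ₗ rcoact
  counit_rcoact : (TensorProduct.rid k carrier).toLinearMap ∘ₗ
      (Coalgebra.counit (R := k) (A := D)).lTensor carrier ∘ₗ rcoact = LinearMap.id
  coact_comm : (TensorProduct.assoc k D carrier D).toLinearMap ∘ₗ lcoact.rTensor D ∘ₗ rcoact =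
      rcoact.lTensor D ∘ₗ lcoact

instance : CoeSort (LeftComod k D) (Type v) := ⟨LeftComod.carrier⟩
instance : CoeSort (RightComod k D) (Type v) := ⟨RightComod.carrier⟩
instance : CoeSort (Bicomod k D) (Type v) := ⟨Bicomod.carrier⟩

attribute [instance] LeftComod.addCommGroup LeftComod.module RightComod.addCommGroup
  RightComod.module Bicomod.addCommGroup Bicomod.module

variable {k D}

/-- Morphisms of left comodules. -/
structure LeftComod.Hom (M N : LeftComod k D) where
  lin : M →ₗ[k] N
  comm : N.coact ∘ₗ lin = lin.lTensor D ∘ₗ M.coact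

/-- Morphisms of right comodules. -/
structure RightComod.Hom (M N : RightComod k D) where
  lin : M →ₗ[k] N
  comm : N.coact ∘ₗ lin = lin.rTensor D ∘ₗ M.coact

/-- Morphisms of bicomodules. -/
structure Bicomod.Hom (M N : Bicomod k D) where
  lin : M →ₗ[k] N
  lcomm : N.lcoact ∘ₗ lin = lin.lTensor D ∘ₗ M.lcoact
  rcomm : N.rcoact ∘ₗ lin = lin.rTensor D ∘ₗ M.rcoact

/-- The identity morphism of a left comodule. -/
def LeftComod.Hom.id (M : LeftComod k D) : M.Hom M where
  lin := LinearMap.id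
  comm := by ext; simp

/-- The identity morphism of a right comodule. -/
def RightComod.Hom.id (M : RightComod k D) : M.Hom M where
  lin := LinearMap.id
  comm := by ext; simp

/-- The underlying left comodule of a bicomodule. -/
abbrev Bicomod.left (M : Bicomod k D) : LeftComod k D where
  carrier := M
  coact := M.lcoact
  coassoc := M.lcoassoc
  counit_coact := M.counit_lcoact

/-- The underlying right comodule of a bicomodule. -/
abbrev Bicomod.right (M : Bicomod k D) : RightComod k D where
  carrier := M
  coact := M.rcoact
  coassoc := M.rcoassoc
  counit_coact := M.counit_rcoact

variable (k D) in
/-- The coalgebra `D` as a bicomodule over itself. -/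
abbrev Bicomod.regular : Bicomod k D where
  carrier := D
  lcoact := Coalgebra.comul
  rcoact := Coalgebra.comul
  lcoassoc := Coalgebra.coassoc
  counit_lcoact := by
    rw [Coalgebra.rTensor_counit_comp_comul]; ext; simp
  rcoassoc := Coalgebra.coassoc
  counit_rcoact := by
    rw [Coalgebra.lTensor_counit_comp_comul]; ext; simp
  coact_comm := Coalgebra.coassoc

/-! ### Coactions on a tensor product from a coaction on one factor -/

section TensorCoaction

variable {A B : Type v} [AddCommGroup A] [Module k A] [AddCommGroup B] [Module k B]

/-- For `l : A → D ⊗ A`, the map `a ⊗ b ↦ a₍₋₁₎ ⊗ (a₍₀₎ ⊗ b)`, where `l(a) = a₍₋₁₎ ⊗ a₍₀₎`. -/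
def leftStep (B : Type v) [AddCommGroup B] [Module k B] (l : A →ₗ[k] D ⊗[k] A) :
    A ⊗[k] B →ₗ[k] D ⊗[k] (A ⊗[k] B) :=
  (TensorProduct.assoc k D A B).toLinearMap ∘ₗ l.rTensor B

lemma leftStep_tmul (l : A →ₗ[k] D ⊗[k] A) (y : A) (c : B) :
    leftStep B l (y ⊗ₜ[k] c) = TensorProduct.assoc k D A B (l y ⊗ₜ[k] c) := rfl

lemma leftStep_coassoc (l : A →ₗ[k] D ⊗[k] A)
    (h : ∀ y, TensorProduct.assoc k D D A ((Coalgebra.comul (R := k) (A := D)).rTensor A (l y)) =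
      l.lTensor D (l y)) (y : A ⊗[k] B) :
    TensorProduct.assoc k D D (A ⊗[k] B)
      ((Coalgebra.comul (R := k) (A := D)).rTensor (A ⊗[k] B) (leftStep B l y)) =
      (leftStep B l).lTensor D (leftStep B l y) := by
  induction y with
  | zero => simp
  | add a b ha hb => simp only [map_add, ha, hb]
  | tmul y c =>
    have e1 : ∀ t : D ⊗[k] A, TensorProduct.assoc k D D (A ⊗[k] B)
        ((Coalgebra.comul (R := k) (A := D)).rTensor (A ⊗[k] B)
          (TensorProduct.assoc k D A B (t ⊗ₜ[k] c))) =
        (TensorProduct.assoc k D A B).toLinearMap.lTensor D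
          (TensorProduct.assoc k D (D ⊗[k] A) B
            (TensorProduct.assoc k D D A
              ((Coalgebra.comul (R := k) (A := D)).rTensor A t) ⊗ₜ[k] c)) := by
      intro t
      induction t with
      | zero => simp
      | add a b ha hb => simp only [TensorProduct.add_tmul, map_add, ha, hb]
      | tmul a b =>
        simp only [TensorProduct.assoc_tmul, LinearMap.rTensor_tmul]
        induction Coalgebra.comul (R := k) a with
        | zero => simp
        | add p q hp hq => simp only [TensorProduct.add_tmul, map_add, hp, hq]
        | tmul p q => simp
    have e2 : ∀ t : D ⊗[k] A, (leftStep B l).lTensor D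
        (TensorProduct.assoc k D A B (t ⊗ₜ[k] c)) =
        (TensorProduct.assoc k D A B).toLinearMap.lTensor D
          (TensorProduct.assoc k D (D ⊗[k] A) B (l.lTensor D t ⊗ₜ[k] c)) := by
      intro t
      induction t with
      | zero => simp
      | add a b ha hb => simp only [TensorProduct.add_tmul, map_add, ha, hb]
      | tmul a b =>
        simp only [TensorProduct.assoc_tmul, LinearMap.lTensor_tmul]
        rfl
    rw [leftStep_tmul, e1, h, e2]

lemma leftStep_counit (l : A →ₗ[k] D ⊗[k] A)
    (h : ∀ y, TensorProduct.lid k A ((Coalgebra.counit (R := k) (A := D)).rTensor A (l y)) = y)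
    (y : A ⊗[k] B) :
    TensorProduct.lid k (A ⊗[k] B)
      ((Coalgebra.counit (R := k) (A := D)).rTensor (A ⊗[k] B) (leftStep B l y)) = y := by
  induction y with
  | zero => simp
  | add a b ha hb => simp only [map_add, ha, hb]
  | tmul m w =>
    conv_rhs => rw [← h m]
    rw [leftStep_tmul]
    induction l m with
    | zero => simp
    | add a b ha hb => simp only [TensorProduct.add_tmul, map_add, ha, hb]
    | tmul a b => simp [TensorProduct.smul_tmul']

/-- For `r : B → B ⊗ D`, the map `a ⊗ b ↦ (a ⊗ b₍₀₎) ⊗ b₍₁₎`, where `r(b) = b₍₀₎ ⊗ b₍₁₎`. -/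
def rightStep (A : Type v) [AddCommGroup A] [Module k A] (r : B →ₗ[k] B ⊗[k] D) :
    A ⊗[k] B →ₗ[k] (A ⊗[k] B) ⊗[k] D :=
  (TensorProduct.assoc k A B D).symm.toLinearMap ∘ₗ r.lTensor A

lemma rightStep_tmul (r : B →ₗ[k] B ⊗[k] D) (y : A) (c : B) :
    rightStep A r (y ⊗ₜ[k] c) = (TensorProduct.assoc k A B D).symm (y ⊗ₜ[k] r c) := rfl

lemma rightStep_coassoc (r : B →ₗ[k] B ⊗[k] D)
    (h : ∀ y, TensorProduct.assoc k B D D (r.rTensor D (r y)) =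
      (Coalgebra.comul (R := k) (A := D)).lTensor B (r y)) (y : A ⊗[k] B) :
    TensorProduct.assoc k (A ⊗[k] B) D D ((rightStep A r).rTensor D (rightStep A r y)) =
      (Coalgebra.comul (R := k) (A := D)).lTensor (A ⊗[k] B) (rightStep A r y) := by
  induction y with
  | zero => simp
  | add a b ha hb => simp only [map_add, ha, hb]
  | tmul y c =>
    have e1 : ∀ t : B ⊗[k] D, (Coalgebra.comul (R := k) (A := D)).lTensor (A ⊗[k] B)
          ((TensorProduct.assoc k A B D).symm (y ⊗ₜ[k] t)) =
        (TensorProduct.assoc k A B (D ⊗[k] D)).symm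
          (y ⊗ₜ[k] (Coalgebra.comul (R := k) (A := D)).lTensor B t) := by
      intro t
      induction t with
      | zero => simp
      | add a b ha hb => simp only [TensorProduct.tmul_add, map_add, ha, hb]
      | tmul a b => simp
    have e2 : ∀ t : B ⊗[k] D, TensorProduct.assoc k (A ⊗[k] B) D D ((rightStep A r).rTensor D
          ((TensorProduct.assoc k A B D).symm (y ⊗ₜ[k] t))) =
        (TensorProduct.assoc k A B (D ⊗[k] D)).symm
          (y ⊗ₜ[k] TensorProduct.assoc k B D D (r.rTensor D t)) := by
      intro t
      induction t with
      | zero => simp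
      | add a b ha hb => simp only [TensorProduct.tmul_add, map_add, ha, hb]
      | tmul a b =>
        simp only [TensorProduct.assoc_symm_tmul, LinearMap.rTensor_tmul, rightStep_tmul]
        induction r a with
        | zero => simp
        | add p q hp hq => simp only [TensorProduct.tmul_add, TensorProduct.add_tmul, map_add, hp, hq]
        | tmul p q => simp
    rw [rightStep_tmul, e1, e2, h]

lemma rightStep_counit (r : B →ₗ[k] B ⊗[k] D)
    (h : ∀ y, TensorProduct.rid k B ((Coalgebra.counit (R := k) (A := D)).lTensor B (r y)) = y)
    (y : A ⊗[k] B) :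
    TensorProduct.rid k (A ⊗[k] B)
      ((Coalgebra.counit (R := k) (A := D)).lTensor (A ⊗[k] B) (rightStep A r y)) = y := by
  induction y with
  | zero => simp
  | add a b ha hb => simp only [map_add, ha, hb]
  | tmul m w =>
    conv_rhs => rw [← h w]
    rw [rightStep_tmul]
    induction r w with
    | zero => simp
    | add a b ha hb => simp only [TensorProduct.tmul_add, map_add, ha, hb]
    | tmul a b => simp

lemma leftStep_rightStep (l : A →ₗ[k] D ⊗[k] A) (r : B →ₗ[k] B ⊗[k] D) (y : A ⊗[k] B) :
    TensorProduct.assoc k D (A ⊗[k] B) D ((leftStep B l).rTensor D (rightStep A r y)) =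
      (rightStep A r).lTensor D (leftStep B l y) := by
  induction y with
  | zero => simp
  | add a b ha hb => simp only [map_add, ha, hb]
  | tmul y c =>
    rw [rightStep_tmul, leftStep_tmul]
    have e2 : ∀ t : D ⊗[k] A, (rightStep A r).lTensor D (TensorProduct.assoc k D A B (t ⊗ₜ c)) =
        (TensorProduct.assoc k A B D).symm.toLinearMap.lTensor D
          (TensorProduct.assoc k D A (B ⊗[k] D) (t ⊗ₜ r c)) := by
      intro t
      induction t with
      | zero => simp
      | add a b ha hb => simp only [TensorProduct.add_tmul, map_add, ha, hb]
      | tmul a b => simp [rightStep_tmul]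
    rw [e2]
    induction r c with
    | zero => simp
    | add p q hp hq => simp only [TensorProduct.tmul_add, map_add, hp, hq]
    | tmul p q =>
      rw [TensorProduct.assoc_symm_tmul, LinearMap.rTensor_tmul, leftStep_tmul]
      induction l y with
      | zero => simp
      | add p q hp hq => simp only [TensorProduct.add_tmul, map_add, hp, hq]
      | tmul p q => simp

end TensorCoaction

/-! ### Cotensor products -/

/-- The map `v ⊗ w ↦ v₍₀₎ ⊗ v₍₁₎ ⊗ w - v ⊗ w₍₋₁₎ ⊗ w₍₀₎`, whose kernel is the cotensor product. -/
def cotensorDiff (V : RightComod k D) (W : LeftComod k D) : V ⊗[k] W →ₗ[k] V ⊗[k] (D ⊗[k] W) :=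
  (TensorProduct.assoc k V D W).toLinearMap ∘ₗ V.coact.rTensor W - W.coact.lTensor V

/-- The cotensor product `V □_D W`, a subspace of `V ⊗ W`. -/
def cotensor (V : RightComod k D) (W : LeftComod k D) : Submodule k (V ⊗[k] W) :=
  LinearMap.ker (cotensorDiff V W)

lemma mem_cotensor {V : RightComod k D} {W : LeftComod k D} {x : V ⊗[k] W} :
    x ∈ cotensor V W ↔
      TensorProduct.assoc k V D W (V.coact.rTensor W x) = W.coact.lTensor V x := by
  simp [cotensor, cotensorDiff, LinearMap.mem_ker, sub_eq_zero]

lemma map_mem_cotensor {V V' : RightComod k D} {W W' : LeftComod k D}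
    (f : V.Hom V') (g : W.Hom W') (x : V ⊗[k] W) (hx : x ∈ cotensor V W) :
    TensorProduct.map f.lin g.lin x ∈ cotensor V' W' := by
  rw [mem_cotensor] at hx ⊢
  have h1 : ∀ y : V ⊗[k] W, TensorProduct.assoc k V' D W'
      (V'.coact.rTensor W' (TensorProduct.map f.lin g.lin y)) =
      TensorProduct.map f.lin (TensorProduct.map LinearMap.id g.lin)
        (TensorProduct.assoc k V D W (V.coact.rTensor W y)) := by
    intro y
    induction y with
    | zero => simp
    | add a b ha hb => simp only [map_add, ha, hb]
    | tmul a b =>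
      have := LinearMap.congr_fun f.comm a
      simp only [LinearMap.comp_apply] at this
      simp only [TensorProduct.map_tmul, LinearMap.rTensor_tmul, this]
      induction V.coact a with
      | zero => simp
      | add a b ha hb => simp only [map_add, TensorProduct.add_tmul, ha, hb]
      | tmul a b => simp
  have h2 : ∀ y : V ⊗[k] W, W'.coact.lTensor V' (TensorProduct.map f.lin g.lin y) =
      TensorProduct.map f.lin (TensorProduct.map LinearMap.id g.lin) (W.coact.lTensor V y) := by
    intro y
    induction y with
    | zero => simp
    | add a b ha hb => simp only [map_add, ha, hb]
    | tmul a b =>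
      have := LinearMap.congr_fun g.comm b
      simp only [LinearMap.comp_apply] at this
      simp only [TensorProduct.map_tmul, LinearMap.lTensor_tmul, this]
      rfl
  rw [h1, h2, hx]

/-- Functoriality of the cotensor product. -/
def cotensorMap {V V' : RightComod k D} {W W' : LeftComod k D} (f : V.Hom V') (g : W.Hom W') :
    cotensor V W →ₗ[k] cotensor V' W' :=
  (TensorProduct.map f.lin g.lin).restrict (map_mem_cotensor f g)

/-- A left `D`-comodule `W` is coflat if `- □_D W` is an exact functor on right comodules. -/
def LeftComod.Coflat (W : LeftComod k D) : Prop :=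
  ∀ (M N P : RightComod k D) (f : M.Hom N) (g : N.Hom P), Function.Exact f.lin g.lin →
    Function.Exact (cotensorMap f (LeftComod.Hom.id W)) (cotensorMap g (LeftComod.Hom.id W))

/-- A right `D`-comodule `V` is coflat if `V □_D -` is an exact functor on left comodules. -/
def RightComod.Coflat (V : RightComod k D) : Prop :=
  ∀ (M N P : LeftComod k D) (f : M.Hom N) (g : N.Hom P), Function.Exact f.lin g.lin →
    Function.Exact (cotensorMap (RightComod.Hom.id V) f) (cotensorMap (RightComod.Hom.id V) g)

/-! ### The cotensor product of a bicomodule and a left comodule is a left comodule -/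

/-- The coaction `m ⊗ w ↦ m₍₋₁₎ ⊗ m₍₀₎ ⊗ w` on `M ⊗ W`. -/
def tensorCoact (M : Bicomod k D) (W : LeftComod k D) : M ⊗[k] W →ₗ[k] D ⊗[k] (M ⊗[k] W) :=
  leftStep W M.lcoact

/-- The inclusion of `M □_D W` into `M ⊗ W`. -/
def cotensorIncl (M : Bicomod k D) (W : LeftComod k D) : cotensor M.right W →ₗ[k] M ⊗[k] W :=
  (cotensor M.right W).subtype

lemma lTensor_incl_injective (M : Bicomod k D) (W : LeftComod k D) (A : Type*) [AddCommGroup A]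
    [Module k A] : Function.Injective ((cotensorIncl M W).lTensor A) :=
  Module.Flat.lTensor_preserves_injective_linearMap _ (Submodule.subtype_injective _)

lemma tensorCoact_mem (M : Bicomod k D) (W : LeftComod k D) (x : cotensor M.right W) :
    tensorCoact M W (cotensorIncl M W x) ∈ LinearMap.range ((cotensorIncl M W).lTensor D) := by
  have hex : Function.Exact (cotensorIncl M W) (cotensorDiff M.right W) := by
    intro y
    constructor
    · intro hy; exact ⟨⟨y, hy⟩, rfl⟩
    · rintro ⟨z, rfl⟩; exact z.2
  have hex' := Module.Flat.lTensor_exact D hex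
  refine (hex' _).1 ?_
  have key : ∀ y : M ⊗[k] W, (cotensorDiff M.right W).lTensor D (tensorCoact M W y) =
      TensorProduct.assoc k D M (D ⊗[k] W)
        (M.lcoact.rTensor (D ⊗[k] W) (cotensorDiff M.right W y)) := by
    intro y
    induction y with
    | zero => simp
    | add a b ha hb => simp only [map_add, ha, hb]
    | tmul m w =>
      have hc := LinearMap.congr_fun M.coact_comm m
      simp only [LinearMap.comp_apply, LinearEquiv.coe_coe] at hc
      have e1 : ∀ t : D ⊗[k] M, (cotensorDiff M.right W).lTensor D
          (TensorProduct.assoc k D M W (t ⊗ₜ w)) =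
          (TensorProduct.assoc k M D W).toLinearMap.lTensor D
            (TensorProduct.assoc k D (M ⊗[k] D) W (M.rcoact.lTensor D t ⊗ₜ w)) -
          TensorProduct.assoc k D M (D ⊗[k] W) (t ⊗ₜ W.coact w) := by
        intro t
        induction t with
        | zero => simp
        | add a b ha hb =>
          simp only [TensorProduct.add_tmul, map_add, ha, hb]; abel
        | tmul a b =>
          simp only [cotensorDiff, TensorProduct.assoc_tmul, LinearMap.lTensor_tmul,
            LinearMap.sub_apply, TensorProduct.tmul_sub, LinearMap.comp_apply,
            LinearMap.rTensor_tmul]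
      have e2 : ∀ t : M ⊗[k] D, TensorProduct.assoc k D M (D ⊗[k] W)
          (M.lcoact.rTensor (D ⊗[k] W) (TensorProduct.assoc k M D W (t ⊗ₜ w))) =
          (TensorProduct.assoc k M D W).toLinearMap.lTensor D
            (TensorProduct.assoc k D (M ⊗[k] D) W
              (TensorProduct.assoc k D M D (M.lcoact.rTensor D t) ⊗ₜ w)) := by
        intro t
        induction t with
        | zero => simp
        | add a b ha hb => simp only [TensorProduct.add_tmul, map_add, ha, hb]
        | tmul a b =>
          simp only [TensorProduct.assoc_tmul, LinearMap.rTensor_tmul]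
          induction M.lcoact a with
          | zero => simp
          | add p q hp hq => simp only [TensorProduct.add_tmul, map_add, hp, hq]
          | tmul p q => simp
      have e3 : cotensorDiff M.right W (m ⊗ₜ w) =
          TensorProduct.assoc k M D W (M.rcoact m ⊗ₜ w) - m ⊗ₜ W.coact w := rfl
      rw [e3, map_sub, map_sub, e2, hc]
      exact e1 (M.lcoact m)
  rw [key]
  have : cotensorDiff M.right W (cotensorIncl M W x) = 0 := x.2
  rw [this, map_zero, map_zero]

/-- The left coaction on `M □_D W`: the restriction of `tensorCoact`. -/
def cotensorCoact (M : Bicomod k D) (W : LeftComod k D) :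
    cotensor M.right W →ₗ[k] D ⊗[k] cotensor M.right W :=
  (LinearEquiv.ofInjective _ (lTensor_incl_injective M W D)).symm.toLinearMap ∘ₗ
    (tensorCoact M W ∘ₗ cotensorIncl M W).codRestrict _ (tensorCoact_mem M W)

lemma lTensor_incl_cotensorCoact (M : Bicomod k D) (W : LeftComod k D)
    (x : cotensor M.right W) :
    (cotensorIncl M W).lTensor D (cotensorCoact M W x) =
      tensorCoact M W (cotensorIncl M W x) := by
  have := LinearEquiv.apply_symm_apply
    (LinearEquiv.ofInjective _ (lTensor_incl_injective M W D))
    ((tensorCoact M W ∘ₗ cotensorIncl M W).codRestrict _ (tensorCoact_mem M W) x)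
  exact congrArg Subtype.val this

lemma tensorCoact_coassoc (M : Bicomod k D) (W : LeftComod k D) (y : M ⊗[k] W) :
    TensorProduct.assoc k D D (M ⊗[k] W)
      ((Coalgebra.comul (R := k) (A := D)).rTensor (M ⊗[k] W) (tensorCoact M W y)) =
    (tensorCoact M W).lTensor D (tensorCoact M W y) :=
  leftStep_coassoc _ (fun x => LinearMap.congr_fun M.lcoassoc x) y

lemma tensorCoact_counit (M : Bicomod k D) (W : LeftComod k D) (y : M ⊗[k] W) :
    TensorProduct.lid k (M ⊗[k] W)
      ((Coalgebra.counit (R := k) (A := D)).rTensor (M ⊗[k] W) (tensorCoact M W y)) = y :=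
  leftStep_counit _ (fun x => LinearMap.congr_fun M.counit_lcoact x) y

/-- The left comodule `M □_D W` of a bicomodule `M` and a left comodule `W`, with coaction
induced by the left coaction of `M`. -/
abbrev leftCotensor (M : Bicomod k D) (W : LeftComod k D) : LeftComod k D where
  carrier := cotensor M.right W
  coact := cotensorCoact M W
  coassoc := by
    ext1 x
    apply Module.Flat.lTensor_preserves_injective_linearMap (M := D) _
      (lTensor_incl_injective M W D)
    simp only [LinearMap.comp_apply, LinearEquiv.coe_coe]
    have e1 : ∀ t : D ⊗[k] cotensor M.right W, ((cotensorIncl M W).lTensor D).lTensor D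
        (TensorProduct.assoc k D D _ ((Coalgebra.comul (R := k) (A := D)).rTensor _ t)) =
        TensorProduct.assoc k D D _ ((Coalgebra.comul (R := k) (A := D)).rTensor _
          ((cotensorIncl M W).lTensor D t)) := by
      intro t
      induction t with
      | zero => simp
      | add a b ha hb => simp only [map_add, ha, hb]
      | tmul a b =>
        simp only [LinearMap.rTensor_tmul, LinearMap.lTensor_tmul]
        induction Coalgebra.comul (R := k) a with
        | zero => simp
        | add p q hp hq => simp only [TensorProduct.add_tmul, map_add, hp, hq]
        | tmul p q => simp
    have e2 : ∀ t : D ⊗[k] cotensor M.right W, ((cotensorIncl M W).lTensor D).lTensor D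
        ((cotensorCoact M W).lTensor D t) =
        (tensorCoact M W).lTensor D ((cotensorIncl M W).lTensor D t) := by
      intro t
      induction t with
      | zero => simp
      | add a b ha hb => simp only [map_add, ha, hb]
      | tmul a b =>
        simp only [LinearMap.lTensor_tmul]
        exact congrArg _ (lTensor_incl_cotensorCoact M W b)
    rw [e1, e2, lTensor_incl_cotensorCoact, tensorCoact_coassoc]
  counit_coact := by
    ext1 x
    apply Submodule.subtype_injective (cotensor M.right W)
    simp only [LinearMap.comp_apply, LinearEquiv.coe_coe, LinearMap.id_apply]
    have e1 : ∀ t : D ⊗[k] cotensor M.right W, cotensorIncl M W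
        (TensorProduct.lid k _ ((Coalgebra.counit (R := k) (A := D)).rTensor _ t)) =
        TensorProduct.lid k _ ((Coalgebra.counit (R := k) (A := D)).rTensor _
          ((cotensorIncl M W).lTensor D t)) := by
      intro t
      induction t with
      | zero => simp
      | add a b ha hb => simp only [map_add, ha, hb]
      | tmul a b => simp
    exact (e1 _).trans (by rw [lTensor_incl_cotensorCoact, tensorCoact_counit]; rfl)

/-- Functoriality of `M □_D W` in the bicomodule `M`. -/
def leftCotensorMap {M N : Bicomod k D} (f : M.Hom N) (W : LeftComod k D) :
    (leftCotensor M W).Hom (leftCotensor N W) where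
  lin := cotensorMap (V := M.right) (V' := N.right) ⟨f.lin, f.rcomm⟩ (LeftComod.Hom.id W)
  comm := by
    ext1 x
    apply lTensor_incl_injective N W D
    simp only [LinearMap.comp_apply]
    set F := cotensorMap (V := M.right) (V' := N.right) ⟨f.lin, f.rcomm⟩ (LeftComod.Hom.id W)
    have hF : ∀ y, cotensorIncl N W (F y) =
        TensorProduct.map f.lin LinearMap.id (cotensorIncl M W y) := fun y => rfl
    have e1 : ∀ t : D ⊗[k] cotensor M.right W, (cotensorIncl N W).lTensor D (F.lTensor D t) =
        (TensorProduct.map f.lin LinearMap.id).lTensor D ((cotensorIncl M W).lTensor D t) := by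
      intro t
      induction t with
      | zero => simp
      | add a b ha hb => simp only [map_add, ha, hb]
      | tmul a b => simp only [LinearMap.lTensor_tmul, hF]
    have e2 : ∀ y : M ⊗[k] W, tensorCoact N W (TensorProduct.map f.lin LinearMap.id y) =
        (TensorProduct.map f.lin LinearMap.id).lTensor D (tensorCoact M W y) := by
      intro y
      induction y with
      | zero => simp
      | add a b ha hb => simp only [map_add, ha, hb]
      | tmul m w =>
        have hc := LinearMap.congr_fun f.lcomm m
        simp only [LinearMap.comp_apply] at hc
        simp only [tensorCoact, leftStep, LinearMap.comp_apply, TensorProduct.map_tmul,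
          LinearMap.rTensor_tmul, hc, LinearEquiv.coe_coe, LinearMap.id_apply]
        induction M.lcoact m with
        | zero => simp
        | add a b ha hb => simp only [TensorProduct.add_tmul, map_add, ha, hb]
        | tmul a b => simp
    exact (lTensor_incl_cotensorCoact N W (F x)).trans (by
      rw [hF, e2]
      exact (congrArg _ (lTensor_incl_cotensorCoact M W x).symm).trans (e1 _).symm)

/-! ### Injective bicomodule resolutions of the coalgebra and `Cotor` -/

/-- Injective objects among `D`-bicomodules. -/
def Bicomod.Injective (I : Bicomod k D) : Prop :=
  ∀ (M N : Bicomod k D) (i : M.Hom N) (f : M.Hom I), Function.Injective i.lin →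
    ∃ g : N.Hom I, g.lin ∘ₗ i.lin = f.lin

variable (k D) in
/-- An injective resolution `0 → D → Y⁰ → Y¹ → ⋯` of `D` in the category of `D`-bicomodules. -/
structure InjBicomodResolution where
  obj : ℕ → Bicomod k D
  d : ∀ n, (obj n).Hom (obj (n + 1))
  aug : (Bicomod.regular k D).Hom (obj 0)
  injective : ∀ n, (obj n).Injective
  aug_injective : Function.Injective aug.lin
  exact_zero : Function.Exact aug.lin (d 0).lin
  exact_succ : ∀ n, Function.Exact (d n).lin (d (n + 1)).lin

/-- The complex `V □_D Y □_D W`. -/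
def InjBicomodResolution.complex (Y : InjBicomodResolution k D) (V : RightComod k D)
    (W : LeftComod k D) : CochainComplex (ModuleCat.{v} k) ℕ :=
  CochainComplex.of (fun n => ModuleCat.of k (cotensor V (leftCotensor (Y.obj n) W)))
    (fun n => ModuleCat.ofHom
      (cotensorMap (RightComod.Hom.id V) (leftCotensorMap (Y.d n) W)))
    (fun n => by
      rw [← ModuleCat.ofHom_comp]
      refine ModuleCat.hom_ext (LinearMap.ext fun x => Subtype.ext ?_)
      have h0 : ∀ y : cotensor (Y.obj n).right W,
          (leftCotensorMap (Y.d (n + 1)) W).lin ((leftCotensorMap (Y.d n) W).lin y) = 0 := by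
        intro y
        apply Subtype.ext
        change TensorProduct.map (Y.d (n + 1)).lin LinearMap.id
          (TensorProduct.map (Y.d n).lin LinearMap.id y.1) = 0
        induction y.1 with
        | zero => simp
        | add a b ha hb => simp only [map_add, ha, hb, add_zero]
        | tmul a b =>
          simp only [TensorProduct.map_tmul, (Y.exact_succ n).apply_apply_eq_zero,
            TensorProduct.zero_tmul]
      change TensorProduct.map LinearMap.id (leftCotensorMap (Y.d (n + 1)) W).lin
        (TensorProduct.map LinearMap.id (leftCotensorMap (Y.d n) W).lin x.1) = 0
      induction x.1 with
      | zero => simp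
      | add a b ha hb => simp only [map_add, ha, hb, add_zero]
      | tmul a b =>
        simp only [TensorProduct.map_tmul]
        rw [h0, TensorProduct.tmul_zero])

/-- `Cotor_D^n(V, W) = H^n(V □_D Y □_D W)`, computed by the injective bicomodule resolution `Y`
of `D`. -/
def cotor (Y : InjBicomodResolution k D) (V : RightComod k D) (W : LeftComod k D) (n : ℕ) :
    ModuleCat.{v} k :=
  (Y.complex V W).homology n

/-! ### The cobar complex -/

variable (D) in
/-- `D ⊗ (D ⊗ ⋯ ⊗ (D ⊗ W))`, with `n` factors `D`. -/
abbrev iterTensor (W : Type v) [AddCommGroup W] [Module k W] : ℕ → ModuleCat.{v} k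
  | 0 => ModuleCat.of k W
  | n + 1 => ModuleCat.of k (D ⊗[k] iterTensor W n)

/-- For a linear map `l : W → D ⊗ W`, the map `D^{⊗ n} ⊗ W → D^{⊗ n + 1} ⊗ W`,
`c¹ ⊗ ⋯ ⊗ cⁿ ⊗ w ↦ ∑_{j=1}^{n} (-1)^{j-1} c¹ ⊗ ⋯ ⊗ Δ(cʲ) ⊗ ⋯ ⊗ cⁿ ⊗ w
  + (-1)ⁿ c¹ ⊗ ⋯ ⊗ cⁿ ⊗ l(w)`, defined by recursion:
`innerDiff (n + 1) (c ⊗ x) = Δ(c) ⊗ x - c ⊗ innerDiff n x`. -/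
def innerDiff {W : Type v} [AddCommGroup W] [Module k W] (l : W →ₗ[k] D ⊗[k] W) :
    ∀ n, iterTensor (k := k) D W n →ₗ[k] iterTensor (k := k) D W (n + 1)
  | 0 => l
  | n + 1 => (TensorProduct.assoc k D D (iterTensor (k := k) D W n)).toLinearMap ∘ₗ
      (Coalgebra.comul (R := k) (A := D)).rTensor (iterTensor (k := k) D W n) -
      (innerDiff l n).lTensor D

/-- The differential of the two-sided cobar complex on `V ⊗ (D^{⊗ n} ⊗ W)`:
`v ⊗ c¹ ⊗ ⋯ ⊗ cⁿ ⊗ w ↦ v₍₀₎ ⊗ v₍₁₎ ⊗ c¹ ⊗ ⋯ ⊗ w + ∑_{j=1}^{n} (-1)ʲ v ⊗ c¹ ⊗ ⋯ ⊗ Δ(cʲ) ⊗ ⋯ ⊗ w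
  + (-1)^{n+1} v ⊗ c¹ ⊗ ⋯ ⊗ cⁿ ⊗ w₍₋₁₎ ⊗ w₍₀₎`. -/
def cobarDiff (V : RightComod k D) (W : LeftComod k D) (n : ℕ) :
    V ⊗[k] iterTensor (k := k) D W n →ₗ[k] V ⊗[k] iterTensor (k := k) D W (n + 1) :=
  (TensorProduct.assoc k V D (iterTensor (k := k) D W n)).toLinearMap ∘ₗ
    V.coact.rTensor (iterTensor (k := k) D W n) - (innerDiff W.coact n).lTensor V

lemma comul_step (A : Type v) [AddCommGroup A] [Module k A] (c : D) (x : A) :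
    TensorProduct.assoc k D D (D ⊗[k] A) ((Coalgebra.comul (R := k) (A := D)).rTensor (D ⊗[k] A)
      (TensorProduct.assoc k D D A (Coalgebra.comul (R := k) c ⊗ₜ[k] x))) =
    ((TensorProduct.assoc k D D A).toLinearMap ∘ₗ
      (Coalgebra.comul (R := k) (A := D)).rTensor A).lTensor D
      (TensorProduct.assoc k D D A (Coalgebra.comul (R := k) c ⊗ₜ[k] x)) := by
  have hc := LinearMap.congr_fun (Coalgebra.coassoc (R := k) (A := D)) c
  simp only [LinearMap.comp_apply, LinearEquiv.coe_coe] at hc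
  have e1 : ∀ t : D ⊗[k] D, TensorProduct.assoc k D D (D ⊗[k] A)
      ((Coalgebra.comul (R := k) (A := D)).rTensor (D ⊗[k] A)
        (TensorProduct.assoc k D D A (t ⊗ₜ[k] x))) =
      (TensorProduct.assoc k D D A).toLinearMap.lTensor D (TensorProduct.assoc k D (D ⊗[k] D) A
        (TensorProduct.assoc k D D D ((Coalgebra.comul (R := k) (A := D)).rTensor D t) ⊗ₜ x)) := by
    intro t
    induction t with
    | zero => simp
    | add a b ha hb => simp only [TensorProduct.add_tmul, map_add, ha, hb]
    | tmul a b =>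
      simp only [TensorProduct.assoc_tmul, LinearMap.rTensor_tmul]
      induction Coalgebra.comul (R := k) a with
      | zero => simp
      | add p q hp hq => simp only [TensorProduct.add_tmul, map_add, hp, hq]
      | tmul p q => simp
  have e2 : ∀ t : D ⊗[k] D, ((TensorProduct.assoc k D D A).toLinearMap ∘ₗ
      (Coalgebra.comul (R := k) (A := D)).rTensor A).lTensor D
        (TensorProduct.assoc k D D A (t ⊗ₜ[k] x)) =
      (TensorProduct.assoc k D D A).toLinearMap.lTensor D (TensorProduct.assoc k D (D ⊗[k] D) A
        ((Coalgebra.comul (R := k) (A := D)).lTensor D t ⊗ₜ x)) := by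
    intro t
    induction t with
    | zero => simp
    | add a b ha hb => simp only [TensorProduct.add_tmul, map_add, ha, hb]
    | tmul a b => simp
  rw [e1, e2, hc]

lemma innerDiff_tmul {W : Type v} [AddCommGroup W] [Module k W] (l : W →ₗ[k] D ⊗[k] W) (n : ℕ)
    (c : D) (x : iterTensor (k := k) D W n) :
    innerDiff l (n + 1) (c ⊗ₜ[k] x) =
      TensorProduct.assoc k D D (iterTensor (k := k) D W n) (Coalgebra.comul (R := k) c ⊗ₜ[k] x) -
        c ⊗ₜ[k] innerDiff l n x := rfl

lemma innerDiff_succ {W : Type v} [AddCommGroup W] [Module k W] (l : W →ₗ[k] D ⊗[k] W) (n : ℕ)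
    (y : D ⊗[k] iterTensor (k := k) D W n) :
    innerDiff l (n + 1) y =
      TensorProduct.assoc k D D (iterTensor (k := k) D W n)
        ((Coalgebra.comul (R := k) (A := D)).rTensor (iterTensor (k := k) D W n) y) -
        (innerDiff l n).lTensor D y := rfl

lemma innerDiff_innerDiff {W : Type v} [AddCommGroup W] [Module k W] (l : W →ₗ[k] D ⊗[k] W)
    (hl : ∀ w, TensorProduct.assoc k D D W
      ((Coalgebra.comul (R := k) (A := D)).rTensor W (l w)) = l.lTensor D (l w)) :
    ∀ (n : ℕ) (x : iterTensor (k := k) D W n), innerDiff l (n + 1) (innerDiff l n x) = 0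
  | 0, x => by
    refine (innerDiff_succ l 0 _).trans ?_
    exact sub_eq_zero.2 (hl x)
  | n + 1, x => by
    have ih := innerDiff_innerDiff l hl n
    refine TensorProduct.induction_on x ?_ ?_ ?_
    · rw [map_zero, map_zero]
    · intro c x
      have h1 := comul_step (k := k) (D := D) (iterTensor (k := k) D W n) c x
      rw [innerDiff_tmul, map_sub, innerDiff_tmul, ih, TensorProduct.tmul_zero, sub_zero,
        innerDiff_succ, h1]
      have h2 : ∀ t : D ⊗[k] D, (innerDiff l (n + 1)).lTensor D
          (TensorProduct.assoc k D D (iterTensor (k := k) D W n) (t ⊗ₜ[k] x)) =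
          ((TensorProduct.assoc k D D (iterTensor (k := k) D W n)).toLinearMap ∘ₗ
            (Coalgebra.comul (R := k) (A := D)).rTensor (iterTensor (k := k) D W n)).lTensor D
            (TensorProduct.assoc k D D (iterTensor (k := k) D W n) (t ⊗ₜ[k] x)) -
          TensorProduct.assoc k D D (iterTensor (k := k) D W (n + 1))
            (t ⊗ₜ[k] innerDiff l n x) := by
        intro t
        induction t with
        | zero => simp
        | add a b ha hb => simp only [TensorProduct.add_tmul, map_add, ha, hb]; abel
        | tmul a b =>
          simp only [TensorProduct.assoc_tmul, LinearMap.lTensor_tmul]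
          rw [innerDiff_tmul, TensorProduct.tmul_sub]
          rfl
      rw [h2]
      abel
    · intro a b ha hb
      rw [map_add, map_add, ha, hb, add_zero]

lemma cobarDiff_cobarDiff (V : RightComod k D) (W : LeftComod k D) (n : ℕ)
    (y : V ⊗[k] iterTensor (k := k) D W n) :
    cobarDiff V W (n + 1) (cobarDiff V W n y) = 0 := by
  have hl : ∀ w, TensorProduct.assoc k D D W
      ((Coalgebra.comul (R := k) (A := D)).rTensor W (W.coact w)) =
      W.coact.lTensor D (W.coact w) := fun w => LinearMap.congr_fun W.coassoc w
  induction y with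
  | zero => rw [map_zero, map_zero]
  | add a b ha hb => rw [map_add, map_add, ha, hb, add_zero]
  | tmul v x =>
    have h0 : ∀ (m : ℕ) (v : V) (x : iterTensor (k := k) D W m), cobarDiff V W m (v ⊗ₜ[k] x) =
        TensorProduct.assoc k V D _ (V.coact v ⊗ₜ[k] x) - v ⊗ₜ[k] innerDiff W.coact m x :=
      fun _ _ _ => rfl
    have hc := LinearMap.congr_fun V.coassoc v
    simp only [LinearMap.comp_apply, LinearEquiv.coe_coe] at hc
    have h1 : ∀ t : V ⊗[k] D, cobarDiff V W (n + 1) (TensorProduct.assoc k V D _ (t ⊗ₜ[k] x)) =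
        (TensorProduct.assoc k D D (iterTensor (k := k) D W n)).toLinearMap.lTensor V
          (TensorProduct.assoc k V (D ⊗[k] D) (iterTensor (k := k) D W n)
            (TensorProduct.assoc k V D D (V.coact.rTensor D t) ⊗ₜ[k] x)) -
        (TensorProduct.assoc k D D (iterTensor (k := k) D W n)).toLinearMap.lTensor V
          (TensorProduct.assoc k V (D ⊗[k] D) (iterTensor (k := k) D W n)
            ((Coalgebra.comul (R := k) (A := D)).lTensor V t ⊗ₜ[k] x)) +
        TensorProduct.assoc k V D _ (t ⊗ₜ[k] innerDiff W.coact n x) := by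
      intro t
      induction t with
      | zero => simp
      | add a b ha hb => simp only [TensorProduct.add_tmul, map_add, ha, hb]; abel
      | tmul a b =>
        simp only [TensorProduct.assoc_tmul, LinearMap.lTensor_tmul, LinearMap.rTensor_tmul]
        rw [h0, innerDiff_tmul, TensorProduct.tmul_sub]
        have h2 : ∀ t : V ⊗[k] D, TensorProduct.assoc k V D _ (t ⊗ₜ[k] (b ⊗ₜ[k] x)) =
            (TensorProduct.assoc k D D (iterTensor (k := k) D W n)).toLinearMap.lTensor V
              (TensorProduct.assoc k V (D ⊗[k] D) (iterTensor (k := k) D W n)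
                (TensorProduct.assoc k V D D (t ⊗ₜ[k] b) ⊗ₜ[k] x)) := by
          intro t
          induction t with
          | zero => simp
          | add p q hp hq => simp only [TensorProduct.add_tmul, map_add, hp, hq]
          | tmul p q => simp
        rw [h2]
        simp only [LinearEquiv.coe_coe]
        abel
    rw [h0, map_sub, h1, hc, h0, innerDiff_innerDiff _ hl, TensorProduct.tmul_zero]
    abel

/-- The two-sided cobar complex `CB(V, D, W)`. -/
def cobarComplex (V : RightComod k D) (W : LeftComod k D) :
    CochainComplex (ModuleCat.{v} k) ℕ :=
  CochainComplex.of (fun n => ModuleCat.of k (V ⊗[k] iterTensor (k := k) D W n))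
    (fun n => ModuleCat.ofHom (cobarDiff V W n))
    (fun n => by
      rw [← ModuleCat.ofHom_comp]
      exact ModuleCat.hom_ext (LinearMap.ext fun x => cobarDiff_cobarDiff V W n x))

/-! ### Hochschild cohomology -/

section Step

variable {A : Type v} [AddCommGroup A] [Module k A]

/-- `a ⊗ c ↦ f(a) ⊗ c + s a ⊗ Δ(c)`. -/
def innerStep (f : A →ₗ[k] A ⊗[k] D) (s : k) : A ⊗[k] D →ₗ[k] (A ⊗[k] D) ⊗[k] D :=
  f.rTensor D + s • ((TensorProduct.assoc k A D D).symm.toLinearMap ∘ₗ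
    (Coalgebra.comul (R := k) (A := D)).lTensor A)

lemma innerStep_tmul (f : A →ₗ[k] A ⊗[k] D) (s : k) (y : A) (c : D) :
    innerStep f s (y ⊗ₜ[k] c) = f y ⊗ₜ[k] c + s •
      (TensorProduct.assoc k A D D).symm (y ⊗ₜ[k] Coalgebra.comul (R := k) c) := rfl

lemma innerStep_innerStep (f : A →ₗ[k] A ⊗[k] D) (s t : k) (hst : t = -s)
    (hf : ∀ y, innerStep f s (f y) = 0) (y : A ⊗[k] D) :
    innerStep (innerStep f s) t (innerStep f s y) = 0 := by
  subst hst
  induction y with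
  | zero => simp
  | add a b ha hb => rw [map_add, map_add, ha, hb, add_zero]
  | tmul y c =>
    have hc := LinearMap.congr_fun (Coalgebra.coassoc (R := k) (A := D)) c
    simp only [LinearMap.comp_apply, LinearEquiv.coe_coe] at hc
    have h1 : ∀ t : D ⊗[k] D, innerStep (innerStep f s) (-s)
        ((TensorProduct.assoc k A D D).symm (y ⊗ₜ[k] t)) =
        (TensorProduct.assoc k (A ⊗[k] D) D D).symm (f y ⊗ₜ[k] t) +
        s • ((TensorProduct.assoc k A D D).symm.toLinearMap.rTensor D
          ((TensorProduct.assoc k A (D ⊗[k] D) D).symm (y ⊗ₜ[k]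
            (Coalgebra.comul (R := k) (A := D)).rTensor D t)) -
          (TensorProduct.assoc k A D D).symm.toLinearMap.rTensor D
          ((TensorProduct.assoc k A (D ⊗[k] D) D).symm (y ⊗ₜ[k]
            (TensorProduct.assoc k D D D).symm
              ((Coalgebra.comul (R := k) (A := D)).lTensor D t)))) := by
      intro t
      induction t with
      | zero => simp
      | add a b ha hb =>
        simp only [TensorProduct.tmul_add, map_add, ha, hb, smul_sub, smul_add]; abel
      | tmul a b =>
        simp only [TensorProduct.assoc_symm_tmul, LinearMap.lTensor_tmul, LinearMap.rTensor_tmul]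
        rw [innerStep_tmul, innerStep_tmul]
        have h2 : ∀ t : D ⊗[k] D,
            (TensorProduct.assoc k (A ⊗[k] D) D D).symm ((y ⊗ₜ[k] a) ⊗ₜ[k] t) =
            (TensorProduct.assoc k A D D).symm.toLinearMap.rTensor D
              ((TensorProduct.assoc k A (D ⊗[k] D) D).symm (y ⊗ₜ[k]
                (TensorProduct.assoc k D D D).symm (a ⊗ₜ[k] t))) := by
          intro t
          induction t with
          | zero => simp
          | add p q hp hq => simp only [TensorProduct.tmul_add, map_add, hp, hq]
          | tmul p q => simp
        have hn : ∀ x : ((A ⊗[k] D) ⊗[k] D) ⊗[k] D, (-s) • x = -(s • x) := fun x => neg_smul s x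
        rw [h2, hn, smul_sub, TensorProduct.add_tmul, ← TensorProduct.smul_tmul', add_assoc,
          sub_eq_add_neg]
        rfl
    rw [innerStep_tmul, map_add, map_smul, h1, innerStep_tmul, hf, ← hc,
      LinearEquiv.symm_apply_apply, sub_self, smul_zero, add_zero,
      TensorProduct.zero_tmul, zero_add, ← add_smul, neg_add_cancel, zero_smul]

lemma leftStep_innerStep (f : A →ₗ[k] A ⊗[k] D) (l : A →ₗ[k] D ⊗[k] A) (s : k)
    (h : ∀ y, leftStep D l (f y) = f.lTensor D (l y)) (y : A ⊗[k] D) :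
    leftStep D (leftStep D l) (innerStep f s y) = (innerStep f s).lTensor D (leftStep D l y) := by
  induction y with
  | zero => simp
  | add a b ha hb => simp only [map_add, ha, hb]
  | tmul y c =>
    have h1 : ∀ t : D ⊗[k] D, leftStep D (leftStep D l)
        ((TensorProduct.assoc k A D D).symm (y ⊗ₜ[k] t)) =
        (TensorProduct.assoc k A D D).symm.toLinearMap.lTensor D
          (TensorProduct.assoc k D A (D ⊗[k] D) (l y ⊗ₜ[k] t)) := by
      intro t
      induction t with
      | zero => simp
      | add a b ha hb => simp only [TensorProduct.tmul_add, map_add, ha, hb]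
      | tmul a b =>
        rw [TensorProduct.assoc_symm_tmul, leftStep_tmul, leftStep_tmul]
        induction l y with
        | zero => simp
        | add p q hp hq => simp only [TensorProduct.add_tmul, map_add, hp, hq]
        | tmul p q => simp
    have h2 : ∀ t : D ⊗[k] A, (innerStep f s).lTensor D
        (TensorProduct.assoc k D A D (t ⊗ₜ[k] c)) =
        TensorProduct.assoc k D (A ⊗[k] D) D (f.lTensor D t ⊗ₜ[k] c) +
        s • (TensorProduct.assoc k A D D).symm.toLinearMap.lTensor D
          (TensorProduct.assoc k D A (D ⊗[k] D)
            (t ⊗ₜ[k] Coalgebra.comul (R := k) c)) := by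
      intro t
      induction t with
      | zero => simp
      | add a b ha hb => simp only [TensorProduct.add_tmul, map_add, ha, hb, smul_add]; abel
      | tmul a b =>
        simp only [TensorProduct.assoc_tmul, LinearMap.lTensor_tmul]
        rw [innerStep_tmul, TensorProduct.tmul_add, TensorProduct.tmul_smul]
        rfl
    rw [innerStep_tmul, map_add, map_smul, leftStep_tmul, leftStep_tmul, h2, ← h, h1]

/-- `f + s • (last factor := left coaction)`. -/
def diffStep (f : A →ₗ[k] A ⊗[k] D) (l : A →ₗ[k] D ⊗[k] A) (s : k) : A →ₗ[k] A ⊗[k] D :=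
  f + s • ((TensorProduct.comm k D A).toLinearMap ∘ₗ l)

lemma diffStep_diffStep (f : A →ₗ[k] A ⊗[k] D) (l : A →ₗ[k] D ⊗[k] A) (s t : k) (hst : t = -s)
    (hs : s * s = 1) (hf : ∀ y, innerStep f s (f y) = 0)
    (hfl : ∀ y, leftStep D l (f y) = f.lTensor D (l y))
    (hl : ∀ y, TensorProduct.assoc k D D A ((Coalgebra.comul (R := k) (A := D)).rTensor A (l y)) =
      l.lTensor D (l y)) (y : A) :
    diffStep (innerStep f s) (leftStep D l) t (diffStep f l s y) = 0 := by
  subst hst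
  have h0 : ∀ y, diffStep f l s y = f y + s • TensorProduct.comm k D A (l y) := fun _ => rfl
  have h0' : ∀ y, diffStep (innerStep f s) (leftStep D l) (-s) y = innerStep f s y +
      (-s) • TensorProduct.comm k D (A ⊗[k] D) (leftStep D l y) := fun _ => rfl
  have h1 : ∀ t : D ⊗[k] A, innerStep f s (TensorProduct.comm k D A t) =
      TensorProduct.comm k D (A ⊗[k] D) (f.lTensor D t) +
      s • TensorProduct.comm k D (A ⊗[k] D)
        ((TensorProduct.comm k D A).toLinearMap.lTensor D
          (TensorProduct.assoc k D D A
            ((TensorProduct.comm k D D).toLinearMap.rTensor A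
              ((Coalgebra.comul (R := k) (A := D)).rTensor A t)))) := by
    intro t
    induction t with
    | zero => simp
    | add a b ha hb => simp only [map_add, ha, hb, smul_add]; abel
    | tmul a b =>
      rw [TensorProduct.comm_tmul, innerStep_tmul, LinearMap.lTensor_tmul,
        TensorProduct.comm_tmul, LinearMap.rTensor_tmul, LinearMap.rTensor_tmul]
      congr 2
      induction Coalgebra.comul (R := k) a with
      | zero => simp
      | add p q hp hq => simp only [TensorProduct.tmul_add, TensorProduct.add_tmul, map_add, hp, hq]
      | tmul p q => simp
  have h2 : ∀ t : D ⊗[k] A, leftStep D l (TensorProduct.comm k D A t) =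
      (TensorProduct.comm k D A).toLinearMap.lTensor D
        (TensorProduct.assoc k D D A ((TensorProduct.comm k D D).toLinearMap.rTensor A
          ((TensorProduct.assoc k D D A).symm (l.lTensor D t)))) := by
    intro t
    induction t with
    | zero => simp
    | add a b ha hb => simp only [map_add, ha, hb]
    | tmul a b =>
      rw [TensorProduct.comm_tmul, leftStep_tmul, LinearMap.lTensor_tmul]
      induction l b with
      | zero => simp
      | add p q hp hq => simp only [TensorProduct.tmul_add, TensorProduct.add_tmul, map_add, hp, hq]
      | tmul p q => simp
  rw [h0, h0', map_add, hf, map_smul, h1, map_add, map_smul, hfl, h2, ← hl,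
    LinearEquiv.symm_apply_apply, map_add, map_smul, smul_add, smul_add, smul_smul, smul_smul,
    hs, neg_mul, hs, neg_smul, neg_smul]
  abel

end Step

/-- The space `V ⊗ D^{⊗ n}`, as `((V ⊗ D) ⊗ ⋯) ⊗ D`. -/
abbrev hochObj (V : Bicomod k D) : ℕ → ModuleCat.{v} k
  | 0 => ModuleCat.of k V
  | n + 1 => ModuleCat.of k (hochObj V n ⊗[k] D)

/-- The part of the Hochschild differential that involves the right coaction and `Δ`:
`v ⊗ c¹ ⊗ ⋯ ⊗ cⁿ ↦ v₍₀₎ ⊗ v₍₁₎ ⊗ c¹ ⊗ ⋯ ⊗ cⁿ + ∑_{j=1}^{n} (-1)ʲ v ⊗ c¹ ⊗ ⋯ ⊗ Δ(cʲ) ⊗ ⋯ ⊗ cⁿ`,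
defined by recursion on `n`. -/
def hochInner (V : Bicomod k D) : ∀ n, hochObj V n →ₗ[k] hochObj V n ⊗[k] D
  | 0 => V.rcoact
  | n + 1 => innerStep (hochInner V n) ((-1) ^ (n + 1))

/-- The map `v ⊗ c¹ ⊗ ⋯ ⊗ cⁿ ↦ v₍₋₁₎ ⊗ (v₍₀₎ ⊗ c¹ ⊗ ⋯ ⊗ cⁿ)`. -/
def hochLeft (V : Bicomod k D) : ∀ n, hochObj V n →ₗ[k] D ⊗[k] hochObj V n
  | 0 => V.lcoact
  | n + 1 => leftStep D (hochLeft V n)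

/-- The Hochschild differential `b`:
`v ⊗ c¹ ⊗ ⋯ ⊗ cⁿ ↦ v₍₀₎ ⊗ v₍₁₎ ⊗ c¹ ⊗ ⋯ ⊗ cⁿ + ∑_{j=1}^{n} (-1)ʲ v ⊗ c¹ ⊗ ⋯ ⊗ Δ(cʲ) ⊗ ⋯ ⊗ cⁿ
  + (-1)^{n+1} v₍₀₎ ⊗ c¹ ⊗ ⋯ ⊗ cⁿ ⊗ v₍₋₁₎`. -/
def hochDiff (V : Bicomod k D) (n : ℕ) : hochObj V n →ₗ[k] hochObj V (n + 1) :=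
  diffStep (hochInner V n) (hochLeft V n) ((-1) ^ (n + 1))

lemma neg_one_pow_step (n : ℕ) : (-1 : k) ^ (n + 1 + 1) = -(-1) ^ (n + 1) := by
  rw [pow_succ, mul_neg_one]

lemma hochInner_hochInner (V : Bicomod k D) :
    ∀ (n : ℕ) (y : hochObj V n), innerStep (hochInner V n) ((-1) ^ (n + 1)) (hochInner V n y) = 0
  | 0, y => by
    have hc := LinearMap.congr_fun V.rcoassoc y
    simp only [LinearMap.comp_apply, LinearEquiv.coe_coe] at hc
    have h1 : ∀ t : V ⊗[k] D, innerStep V.rcoact ((-1 : k) ^ (0 + 1)) t = V.rcoact.rTensor D t -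
        (TensorProduct.assoc k V D D).symm
          ((Coalgebra.comul (R := k) (A := D)).lTensor V t) := by
      intro t
      have h2 : ∀ x : (V ⊗[k] D) ⊗[k] D, (-1 : k) • x = -x := fun x => neg_one_smul k x
      rw [sub_eq_add_neg, ← h2, zero_add, pow_one]
      rfl
    refine (h1 _).trans ?_
    rw [sub_eq_zero]
    exact (LinearEquiv.eq_symm_apply _).2 hc
  | n + 1, y => innerStep_innerStep (hochInner V n) _ _ (neg_one_pow_step n)
      (hochInner_hochInner V n) y

lemma hochLeft_hochInner (V : Bicomod k D) :
    ∀ (n : ℕ) (y : hochObj V n), leftStep D (hochLeft V n) (hochInner V n y) =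
      (hochInner V n).lTensor D (hochLeft V n y)
  | 0, y => LinearMap.congr_fun V.coact_comm y
  | n + 1, y => leftStep_innerStep (hochInner V n) (hochLeft V n) _ (hochLeft_hochInner V n) y

lemma hochLeft_coassoc (V : Bicomod k D) :
    ∀ (n : ℕ) (y : hochObj V n), TensorProduct.assoc k D D (hochObj V n)
      ((Coalgebra.comul (R := k) (A := D)).rTensor (hochObj V n) (hochLeft V n y)) =
      (hochLeft V n).lTensor D (hochLeft V n y)
  | 0, y => LinearMap.congr_fun V.lcoassoc y
  | n + 1, y => leftStep_coassoc (hochLeft V n) (hochLeft_coassoc V n) y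

/-- The Hochschild complex `CH(D, V)`. -/
def hochComplex (V : Bicomod k D) : CochainComplex (ModuleCat.{v} k) ℕ :=
  CochainComplex.of (hochObj V) (fun n => ModuleCat.ofHom (hochDiff V n))
    (fun n => by
      rw [← ModuleCat.ofHom_comp]
      exact ModuleCat.hom_ext (LinearMap.ext fun x =>
        diffStep_diffStep (hochInner V n) (hochLeft V n) _ _ (neg_one_pow_step n)
          (by rw [← mul_pow]; simp) (hochInner_hochInner V n) (hochLeft_hochInner V n)
          (hochLeft_coassoc V n) x))

/-- The Hochschild cohomology `HH^n(D, V)` of the coalgebra `D` with coefficients in the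
bicomodule `V`. -/
def hochschild (V : Bicomod k D) (n : ℕ) : ModuleCat.{v} k :=
  (hochComplex V).homology n

/-- The bicomodule `V' ⊗ V''`, with left coaction that of `V'` and right coaction that of `V''`. -/
def tensorBicomod (V' : LeftComod k D) (V'' : RightComod k D) : Bicomod k D where
  carrier := V' ⊗[k] V''
  lcoact := leftStep V'' V'.coact
  rcoact := rightStep V' V''.coact
  lcoassoc := LinearMap.ext (leftStep_coassoc _ (LinearMap.congr_fun V'.coassoc))
  counit_lcoact := LinearMap.ext (leftStep_counit _ (LinearMap.congr_fun V'.counit_coact))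
  rcoassoc := LinearMap.ext (rightStep_coassoc _ (LinearMap.congr_fun V''.coassoc))
  counit_rcoact := LinearMap.ext (rightStep_counit _ (LinearMap.congr_fun V''.counit_coact))
  coact_comm := LinearMap.ext (leftStep_rightStep _ _)

end Comodules

section Corestriction

variable {k : Type u} {C D : Type v} [Field k] [AddCommGroup C] [Module k C] [Coalgebra k C]
  [AddCommGroup D] [Module k D] [Coalgebra k D]

lemma comul_coalgHom (π : C →ₗc[k] D) (c : C) : Coalgebra.comul (R := k) (π c) =
    TensorProduct.map (π : C →ₗ[k] D) (π : C →ₗ[k] D) (Coalgebra.comul (R := k) c) :=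
  (CoalgHomClass.map_comp_comul_apply π c).symm

/-- A left `C`-comodule as a left `D`-comodule via a coalgebra map `π : C → D`. -/
abbrev LeftComod.corestrict (π : C →ₗc[k] D) (M : LeftComod k C) : LeftComod k D where
  carrier := M
  coact := (π : C →ₗ[k] D).rTensor M ∘ₗ M.coact
  coassoc := by
    ext1 m
    have hc := LinearMap.congr_fun M.coassoc m
    simp only [LinearMap.comp_apply, LinearEquiv.coe_coe] at hc ⊢
    have e1 : ∀ t : C ⊗[k] M, TensorProduct.assoc k D D M
        ((Coalgebra.comul (R := k) (A := D)).rTensor M ((π : C →ₗ[k] D).rTensor M t)) =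
        TensorProduct.map (π : C →ₗ[k] D) ((π : C →ₗ[k] D).rTensor M)
          (TensorProduct.assoc k C C M ((Coalgebra.comul (R := k) (A := C)).rTensor M t)) := by
      intro t
      induction t with
      | zero => simp
      | add a b ha hb => simp only [map_add, ha, hb]
      | tmul a b =>
        simp only [LinearMap.rTensor_tmul, CoalgHom.coe_toLinearMap, comul_coalgHom]
        induction Coalgebra.comul (R := k) a with
        | zero => simp
        | add p q hp hq => simp only [TensorProduct.add_tmul, map_add, hp, hq]
        | tmul p q => simp
    have e2 : ∀ t : C ⊗[k] M, ((π : C →ₗ[k] D).rTensor M ∘ₗ M.coact).lTensor D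
        ((π : C →ₗ[k] D).rTensor M t) =
        TensorProduct.map (π : C →ₗ[k] D) ((π : C →ₗ[k] D).rTensor M) (M.coact.lTensor C t) := by
      intro t
      induction t with
      | zero => simp
      | add a b ha hb => simp only [map_add, ha, hb]
      | tmul a b => simp
    rw [e1, e2, hc]
  counit_coact := by
    rw [← M.counit_coact]
    ext1 m
    simp only [LinearMap.comp_apply, ← LinearMap.rTensor_comp_apply]
    rw [CoalgHomClass.counit_comp]

/-- A right `C`-comodule as a right `D`-comodule via a coalgebra map `π : C → D`. -/
abbrev RightComod.corestrict (π : C →ₗc[k] D) (M : RightComod k C) : RightComod k D where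
  carrier := M
  coact := (π : C →ₗ[k] D).lTensor M ∘ₗ M.coact
  coassoc := by
    ext1 m
    have hc := LinearMap.congr_fun M.coassoc m
    simp only [LinearMap.comp_apply, LinearEquiv.coe_coe] at hc ⊢
    have e1 : ∀ t : M ⊗[k] C, (Coalgebra.comul (R := k) (A := D)).lTensor M
        ((π : C →ₗ[k] D).lTensor M t) =
        TensorProduct.map LinearMap.id (TensorProduct.map (π : C →ₗ[k] D) (π : C →ₗ[k] D))
          ((Coalgebra.comul (R := k) (A := C)).lTensor M t) := by
      intro t
      induction t with
      | zero => simp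
      | add a b ha hb => simp only [map_add, ha, hb]
      | tmul a b =>
        simp only [LinearMap.lTensor_tmul, CoalgHom.coe_toLinearMap, comul_coalgHom]
        rfl
    have e2 : ∀ t : M ⊗[k] C, TensorProduct.assoc k M D D
        (((π : C →ₗ[k] D).lTensor M ∘ₗ M.coact).rTensor D ((π : C →ₗ[k] D).lTensor M t)) =
        TensorProduct.map LinearMap.id (TensorProduct.map (π : C →ₗ[k] D) (π : C →ₗ[k] D))
          (TensorProduct.assoc k M C C (M.coact.rTensor C t)) := by
      intro t
      induction t with
      | zero => simp
      | add a b ha hb => simp only [map_add, ha, hb]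
      | tmul a b =>
        simp only [LinearMap.lTensor_tmul, LinearMap.rTensor_tmul, LinearMap.comp_apply]
        induction M.coact a with
        | zero => simp
        | add p q hp hq => simp only [TensorProduct.add_tmul, map_add, hp, hq]
        | tmul p q => simp
    rw [e1, e2, hc]
  counit_coact := by
    rw [← M.counit_coact]
    ext1 m
    simp only [LinearMap.comp_apply, ← LinearMap.lTensor_comp_apply]
    rw [CoalgHomClass.counit_comp]

/-- A `C`-bicomodule as a `D`-bicomodule via a coalgebra map `π : C → D`. -/
abbrev Bicomod.corestrict (π : C →ₗc[k] D) (M : Bicomod k C) : Bicomod k D where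
  carrier := M
  lcoact := (π : C →ₗ[k] D).rTensor M ∘ₗ M.lcoact
  rcoact := (π : C →ₗ[k] D).lTensor M ∘ₗ M.rcoact
  lcoassoc := (M.left.corestrict π).coassoc
  counit_lcoact := (M.left.corestrict π).counit_coact
  rcoassoc := (M.right.corestrict π).coassoc
  counit_rcoact := (M.right.corestrict π).counit_coact
  coact_comm := by
    ext1 m
    have hc := LinearMap.congr_fun M.coact_comm m
    simp only [LinearMap.comp_apply, LinearEquiv.coe_coe] at hc ⊢
    have e1 : ∀ t : M ⊗[k] C, TensorProduct.assoc k D M D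
        (((π : C →ₗ[k] D).rTensor M ∘ₗ M.lcoact).rTensor D ((π : C →ₗ[k] D).lTensor M t)) =
        TensorProduct.map (π : C →ₗ[k] D) ((π : C →ₗ[k] D).lTensor M)
          (TensorProduct.assoc k C M C (M.lcoact.rTensor C t)) := by
      intro t
      induction t with
      | zero => simp
      | add a b ha hb => simp only [map_add, ha, hb]
      | tmul a b =>
        simp only [LinearMap.lTensor_tmul, LinearMap.rTensor_tmul, LinearMap.comp_apply]
        induction M.lcoact a with
        | zero => simp
        | add p q hp hq => simp only [TensorProduct.add_tmul, map_add, hp, hq]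
        | tmul p q => simp
    have e2 : ∀ t : C ⊗[k] M, ((π : C →ₗ[k] D).lTensor M ∘ₗ M.rcoact).lTensor D
        ((π : C →ₗ[k] D).rTensor M t) =
        TensorProduct.map (π : C →ₗ[k] D) ((π : C →ₗ[k] D).lTensor M)
          (M.rcoact.lTensor C t) := by
      intro t
      induction t with
      | zero => simp
      | add a b ha hb => simp only [map_add, ha, hb]
      | tmul a b => simp
    rw [e1, e2, hc]

/-- `B^{□_D i} □_D W = B □_D (B □_D ⋯ (B □_D W))` (`i` factors `B`), as a left `D`-comodule. -/
def cotensorPower (B : Bicomod k D) (W : LeftComod k D) : ℕ → LeftComod k D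
  | 0 => W
  | i + 1 => leftCotensor B (cotensorPower B W i)

end Corestriction

/-- Convergence of a first quadrant cohomological spectral sequence `E` (with pages from `E₁` on,
and `d_r` of bidegree `(r, 1 - r)`) to a graded vector space `H`: each `H^n` carries a decreasing
filtration `H^n = F^0 ⊇ F^1 ⊇ ⋯ ⊇ F^{n+1} = 0` with `F^i / F^{i+1} ≅ E_∞^{i,n-i}`. In total degree
`n` all differentials `d_r` with `r ≥ n + 2` vanish, so that `E_r^{i,n-i} = E_∞^{i,n-i}`. -/
def ConvergesTo {k : Type u} [Field k]
    (E : CohomologicalSpectralSequenceNat (ModuleCat.{v} k) 1) (H : ℕ → ModuleCat.{v} k) : Prop :=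
  ∀ n : ℕ, ∃ F : ℕ → Submodule k (H n), Antitone F ∧ F 0 = ⊤ ∧ F (n + 1) = ⊥ ∧
    ∀ i j : ℕ, i + j = n → ∀ (r : ℤ) (hr : (n : ℤ) + 2 ≤ r),
      Nonempty ((E.page r (by omega)).X (i, j) ≃ₗ[k] (F i ⧸ (F (i + 1)).submoduleOf (F i)))

end CoalgCoh

end

open CoalgCoh

/-! Write `N` for a left `C`-comodule. The coaction embeds `N` in `C □_D N`, and iterating gives the
relative cobar resolution `N → C □_D N → C □_D (C □_D N) → ⋯` of left `C`-comodules (`relDiff`). It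
is exact for a formal reason: the counit on the outer factor is a `k`-linear contraction
(`relDiff_exact`).

Take `N = V'` and form the cobar complex over `C`, with coefficients in `V''`, of every term after
the augmentation. This gives the first quadrant bicomplex `relBicomplex`, with entry `V'' ⊗ C^{⊗ j}
⊗ (C^{□_D (i+1)} □_D V')` at `(i, j)`. Since `k` is a field, its rows stay exact after tensoring, so
its total complex computes the cohomology of the augmentation column, the cobar complex of `V''` and
`V'` over `C`. Moving `V'` from the front to the end identifies that complex with the Hochschild
complex of `V' ⊗ V''` (`cobarDiff_hochCobarEquiv`). The filtration by columns then yields a spectral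
sequence converging to Hochschild cohomology, and its first page is the cohomology of the columns.

Column `i` is, up to sign, the cobar complex over `C` of `C □_D X` with `X = C^{□_D i} □_D V'`.
Change of coalgebras (`nonempty_cobar_coinduced_iso`) replaces it by the cobar complex over `D` of
`X`. The comparison uses a bicomplex with entries `V'' ⊗ C^{⊗ j} ⊗ C ⊗ D^{⊗ i} ⊗ X`: its columns are
contractible because `C ⊗ M` is cofree, and its rows are exact because cotensoring the cobar
resolution of `X` with the coflat right `D`-comodule `C` is exact (`cobarDiff_exact_of_coflat`).
This is where coflatness enters.

It remains to see that the cobar complex over `D` computes `Cotor` defined by an injective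
bicomodule resolution `Y` (`nonempty_cobar_iso_cotor`). An injective bicomodule splits off both of
its cofree hulls `D ⊗ Y` and `Y ⊗ D`. The right splitting makes `D → Y` contractible as a complex of
right comodules, so `Y □_D W` resolves `W`; the left splitting makes each `Y^i □_D W` acyclic for
the cobar complex. A third bicomplex finishes the comparison.

Both comparisons of cohomology rest on `Bicomplex.nonempty_homology_iso`: with exact augmented rows
and columns, the two augmentations have the cohomology of the same total complex. -/

noncomputable section

namespace CoalgCoh

/-! ### Homology of complexes of modules in terms of elements -/

section Homology

variable {k : Type u} [Ring k]

/-- A surjective linear map with kernel `B` identifies the quotient by `B` with its target. -/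
def quotientEquivOfSurjective {N Q : Type*} [AddCommGroup N] [Module k N] [AddCommGroup Q]
    [Module k Q] (f : N →ₗ[k] Q) (hf : Function.Surjective f) (B : Submodule k N)
    (hB : ∀ x, x ∈ B ↔ f x = 0) : (N ⧸ B) ≃ₗ[k] Q :=
  (Submodule.quotEquivOfEq B (LinearMap.ker f)
    (Submodule.ext fun x => (hB x).trans LinearMap.mem_ker.symm)).trans
    (f.quotKerEquivOfSurjective hf)

/-- If the image of `φ : N → K.X j` is the space of cycles and `B` is the preimage of the space of
boundaries, then the homology of `K` at `j` is `N ⧸ B`. -/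
def homologyIsoQuotient {ι : Type*} {c : ComplexShape ι} (K : HomologicalComplex (ModuleCat.{v} k) c)
    (j : ι) {N : Type v} [AddCommGroup N] [Module k N] (φ : N →ₗ[k] K.X j)
    (hφ : ∀ x : K.X j, (∃ y, φ y = x) ↔ ∀ j', (K.d j j').hom x = 0) (B : Submodule k N)
    (hB : ∀ y, y ∈ B ↔ ∃ (i : ι) (x : K.X i), (K.d i j).hom x = φ y) :
    K.homology j ≅ ModuleCat.of k (N ⧸ B) :=
  (K.sc j).moduleCatHomologyIso ≪≫ (LinearEquiv.toModuleIso <| LinearEquiv.symm <|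
    quotientEquivOfSurjective
      ((LinearMap.range (K.sc j).moduleCatToCycles).mkQ ∘ₗ φ.codRestrict
        (LinearMap.ker (K.sc j).g.hom) (fun y => (hφ (φ y)).1 ⟨y, rfl⟩ _))
      (by
        intro z
        obtain ⟨⟨x, hx⟩, rfl⟩ := Submodule.mkQ_surjective _ z
        obtain ⟨y, rfl⟩ := (hφ x).2 (fun j' => by
          -- Testing against every target is harmless: the differential to an unrelated index is
          -- zero.
          by_cases h : c.Rel j j'
          · obtain rfl := c.next_eq' h
            exact hx
          · rw [K.shape _ _ h]; rfl)
        exact ⟨y, rfl⟩)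
      B
      (by
        intro y
        rw [hB, LinearMap.comp_apply, Submodule.mkQ_apply, Submodule.Quotient.mk_eq_zero]
        constructor
        · rintro ⟨i, x, hx⟩
          by_cases h : c.Rel i j
          · obtain rfl := c.prev_eq' h
            exact ⟨x, Subtype.ext hx⟩
          · rw [K.shape _ _ h] at hx
            -- With no differential arriving from `i`, the hypothesis says `φ y = 0`, which is the
            -- boundary of zero.
            exact ⟨0, Subtype.ext (by rw [map_zero]; exact hx)⟩
        · rintro ⟨x, hx⟩
          exact ⟨_, x, congrArg Subtype.val hx⟩))

end Homology

/-! ### The spectral sequence of a filtered graded module with differential -/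

/-- A graded module with differential and a decreasing filtration, which in degree `n` is
exhausted by step `0` and vanishes from step `n + 1` on. -/
structure FilteredDiffModule (k : Type u) [Field k] where
  carrier : Type v
  [addCommGroup : AddCommGroup carrier]
  [module : Module k carrier]
  D : carrier →ₗ[k] carrier
  deg : ℤ → Submodule k carrier
  fil : ℤ → Submodule k carrier
  D_D : ∀ x, D (D x) = 0
  D_mem_deg : ∀ {n m : ℤ} {x}, x ∈ deg n → n + 1 = m → D x ∈ deg m
  D_mem_fil : ∀ {p : ℤ} {x}, x ∈ fil p → D x ∈ fil p
  fil_le : ∀ {p q : ℤ}, q ≤ p → fil p ≤ fil q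
  mem_fil : ∀ {p : ℤ} (x), p ≤ 0 → x ∈ fil p
  eq_zero : ∀ {n p : ℤ} {x}, x ∈ deg n → x ∈ fil p → n < p → x = 0

attribute [instance] FilteredDiffModule.addCommGroup FilteredDiffModule.module

namespace FilteredDiffModule

variable {k : Type u} [Field k] (M : FilteredDiffModule.{u, v} k)

/-- Elements of degree `n` and filtration `p` with differential of filtration `p + r`. -/
def Z (r p n : ℤ) : Submodule k M.carrier :=
  M.deg n ⊓ M.fil p ⊓ (M.fil (p + r)).comap M.D

/-- The submodule of `Z r p n` that vanishes on the `r`-th page. -/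
def B (r p n : ℤ) : Submodule k M.carrier :=
  M.Z (r - 1) (p + 1) n ⊔ (M.Z (r - 1) (p - r + 1) (n - 1)).map M.D

variable {M}

lemma mem_Z {r p n : ℤ} {x : M.carrier} :
    x ∈ M.Z r p n ↔ x ∈ M.deg n ∧ x ∈ M.fil p ∧ M.D x ∈ M.fil (p + r) := by
  simp [Z, and_assoc]

lemma mem_B {r p n : ℤ} {x : M.carrier} :
    x ∈ M.B r p n ↔ ∃ u ∈ M.Z (r - 1) (p + 1) n, ∃ w ∈ M.Z (r - 1) (p - r + 1) (n - 1),
      u + M.D w = x := by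
  simp [B, Submodule.mem_sup]

lemma fil_of_eq {p q : ℤ} {x : M.carrier} (hx : x ∈ M.fil p) (h : q ≤ p) : x ∈ M.fil q :=
  M.fil_le h hx

lemma D_mem_B {r p n m : ℤ} (hm : m + 1 = n) {w : M.carrier}
    (hw : w ∈ M.Z (r - 1) (p - r + 1) m) : M.D w ∈ M.B r p n := by
  obtain rfl : m = n - 1 := by omega
  exact mem_B.2 ⟨0, zero_mem _, w, hw, zero_add _⟩

lemma mem_B_of_mem_Z {r p n : ℤ} {u : M.carrier} (hu : u ∈ M.Z (r - 1) (p + 1) n) :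
    u ∈ M.B r p n :=
  mem_B.2 ⟨u, hu, 0, zero_mem _, by rw [map_zero, add_zero]⟩

lemma D_mem_Z {r s p q n m : ℤ} (hm : n + 1 = m) (hq : p + r = q) {x : M.carrier}
    (hx : x ∈ M.Z r p n) : M.D x ∈ M.Z s q m := by
  obtain ⟨h1, h2, h3⟩ := mem_Z.1 hx
  refine mem_Z.2 ⟨M.D_mem_deg h1 hm, fil_of_eq h3 hq.ge, ?_⟩
  rw [M.D_D]
  exact zero_mem _

/-- The summand `D w` dies because `D² = 0`. With `q = p + r`, the summand `u` of filtration `p + 1`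
has filtration exactly `q - r + 1`, which is what the boundary part of `B r q m` asks for. -/
lemma D_mem_B_of_mem_B {r p q n m : ℤ} (hm : n + 1 = m) (hq : p + r = q) {x : M.carrier}
    (hx : x ∈ M.B r p n) : M.D x ∈ M.B r q m := by
  obtain ⟨u, hu, w, hw, rfl⟩ := mem_B.1 hx
  rw [map_add, M.D_D, add_zero]
  refine D_mem_B hm ?_
  obtain ⟨h1, h2, h3⟩ := mem_Z.1 hu
  exact mem_Z.2 ⟨h1, fil_of_eq h2 (by omega), fil_of_eq h3 (by omega)⟩

variable (M)

/-- The entry in filtration degree `p` and total degree `n` of the `r`-th page. -/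
abbrev E (r p n : ℤ) : Type v := M.Z r p n ⧸ (M.B r p n).submoduleOf (M.Z r p n)

variable {M} in
lemma E_mk_eq_zero {r p n : ℤ} (x : M.Z r p n) :
    (Submodule.Quotient.mk x : M.E r p n) = 0 ↔ (x : M.carrier) ∈ M.B r p n := by
  rw [Submodule.Quotient.mk_eq_zero]
  exact Submodule.mem_comap

variable {M} in
lemma E_mk_eq_mk {r p n : ℤ} (x y : M.Z r p n) :
    (Submodule.Quotient.mk x : M.E r p n) = Submodule.Quotient.mk y ↔
      (x : M.carrier) - y ∈ M.B r p n := by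
  rw [← sub_eq_zero, ← Submodule.Quotient.mk_sub, E_mk_eq_zero]
  rfl

/-- The differential of the `r`-th page. -/
def dE (r p n q m : ℤ) (hm : n + 1 = m) (hq : p + r = q) : M.E r p n →ₗ[k] M.E r q m :=
  Submodule.mapQ _ _ (M.D.restrict fun _ hx => D_mem_Z hm hq hx)
    (fun x hx => show M.D x ∈ M.B r q m from D_mem_B_of_mem_B (x := x.1) hm hq hx)

open Classical in
/-- The `r`-th page. -/
def page (r : ℤ) :
    HomologicalComplex (ModuleCat.{v} k) (ComplexShape.spectralSequenceNat ⟨r, 1 - r⟩) where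
  X a := ModuleCat.of k (M.E r a.1 (a.1 + a.2))
  d a b := if h : (a.1 : ℤ) + r = b.1 ∧ (a.2 : ℤ) + (1 - r) = b.2 then
    ModuleCat.ofHom (M.dE r a.1 (a.1 + a.2) b.1 (b.1 + b.2) (by omega) h.1) else 0
  shape a b h := dif_neg h
  d_comp_d' a b c h h' := by
    rw [ComplexShape.spectralSequenceNat_rel_iff] at h h'
    rw [dif_pos h, dif_pos h', ← ModuleCat.ofHom_comp]
    refine ModuleCat.hom_ext (LinearMap.ext fun x => ?_)
    obtain ⟨x, rfl⟩ := Submodule.Quotient.mk_surjective _ x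
    refine (E_mk_eq_zero _).2 ?_
    change M.D (M.D x) ∈ _
    rw [M.D_D]
    exact zero_mem _

lemma page_d_mk (r : ℤ) (a b : ℕ × ℕ) (h : (a.1 : ℤ) + r = b.1 ∧ (a.2 : ℤ) + (1 - r) = b.2)
    (x : M.Z r a.1 (a.1 + a.2)) :
    ((M.page r).d a b).hom (Submodule.Quotient.mk x : M.E r a.1 (a.1 + a.2)) =
      (Submodule.Quotient.mk ⟨M.D x, D_mem_Z (by omega) h.1 x.2⟩ : M.E r b.1 (b.1 + b.2)) := by
  simp only [page, dif_pos h]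
  rfl

variable {M} in
lemma Z_succ_le {r r' p n : ℤ} (h : r + 1 = r') : M.Z r' p n ≤ M.Z r p n := fun x hx => by
  obtain ⟨h1, h2, h3⟩ := mem_Z.1 hx
  exact mem_Z.2 ⟨h1, h2, fil_of_eq h3 (by omega)⟩

/-- The homology of the `r`-th page is the next page. -/
def pageIso (r r' : ℤ) (a : ℕ × ℕ) (hr : r + 1 = r') (hr1 : 1 ≤ r) :
    (M.page r).homology a ≅ (M.page r').X a :=
  homologyIsoQuotient (M.page r) a (N := M.Z r' a.1 (a.1 + a.2))
    (((M.B r a.1 (a.1 + a.2)).submoduleOf (M.Z r a.1 (a.1 + a.2))).mkQ ∘ₗ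
      Submodule.inclusion (Z_succ_le hr))
    (by
      intro z
      constructor
      · rintro ⟨x, rfl⟩ b
        by_cases h : (a.1 : ℤ) + r = b.1 ∧ (a.2 : ℤ) + (1 - r) = b.2
        · exact (M.page_d_mk r a b h _).trans ((E_mk_eq_zero _).2
            (mem_B_of_mem_Z (D_mem_Z (by omega) (by omega) x.2)))
        · rw [(M.page r).shape _ _ h]; rfl
      · intro hz
        obtain ⟨x, rfl⟩ := Submodule.Quotient.mk_surjective _ z
        obtain ⟨h1, h2, h3⟩ := mem_Z.1 x.2
        -- The condition says that the target of `d_r` lies in the first quadrant.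
        by_cases hb : r ≤ a.2 + 1
        · obtain ⟨b1, hb1⟩ := Int.eq_ofNat_of_zero_le (show 0 ≤ (a.1 : ℤ) + r by omega)
          obtain ⟨b2, hb2⟩ := Int.eq_ofNat_of_zero_le (show 0 ≤ (a.2 : ℤ) + (1 - r) by omega)
          have hB := (E_mk_eq_zero _).1
            ((M.page_d_mk r a (b1, b2) ⟨hb1, hb2⟩ x).symm.trans (hz (b1, b2)))
          obtain ⟨u, hu, w, hw, hx⟩ := mem_B.1 hB
          obtain ⟨u1, u2, u3⟩ := mem_Z.1 hu
          obtain ⟨w1, w2, w3⟩ := mem_Z.1 hw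
          dsimp only at w1 w2 w3 hx u2 hb1 hb2
          rw [show (b1 : ℤ) + b2 - 1 = a.1 + a.2 by omega] at w1
          -- From `D x = u + D w`, the corrected element `x - w` has differential `u`, one
          -- filtration step deeper. The correction `w` has filtration above `a.1`, so it does not
          -- change the class on page `r`.
          refine ⟨⟨x - w, mem_Z.2 ⟨sub_mem h1 w1, sub_mem h2 (fil_of_eq w2 (by omega)), ?_⟩⟩, ?_⟩
          · rw [map_sub, ← hx, add_sub_cancel_right]
            exact fil_of_eq u2 (by omega)
          · refine (E_mk_eq_mk _ _).2 ?_
            change (x : M.carrier) - w - x ∈ _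
            rw [sub_sub_cancel_left]
            exact neg_mem (mem_B_of_mem_Z (mem_Z.2
              ⟨w1, fil_of_eq w2 (by omega), fil_of_eq w3 (by omega)⟩))
        -- Target outside the quadrant: `D x` has filtration larger than its degree, so it vanishes
        -- and `x` already survives.
        · have h0 : M.D x = 0 := M.eq_zero (M.D_mem_deg h1 rfl) h3 (by omega)
          exact ⟨⟨x, mem_Z.2 ⟨h1, h2, by rw [h0]; exact zero_mem _⟩⟩, rfl⟩)
    _ (by
      intro y
      obtain ⟨y1, y2, y3⟩ := mem_Z.1 y.2
      rw [Submodule.submoduleOf, Submodule.mem_comap]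
      constructor
      · intro hy
        obtain ⟨u, hu, w, hw, hx⟩ := mem_B.1 hy
        obtain ⟨u1, u2, u3⟩ := mem_Z.1 hu
        have hu' : u ∈ M.B r a.1 (a.1 + a.2) :=
          mem_B_of_mem_Z (mem_Z.2 ⟨u1, u2, fil_of_eq u3 (by omega)⟩)
        by_cases hb : r ≤ a.1
        · obtain ⟨b1, hb1⟩ := Int.eq_ofNat_of_zero_le (show 0 ≤ (a.1 : ℤ) - r by omega)
          obtain ⟨b2, hb2⟩ := Int.eq_ofNat_of_zero_le (show 0 ≤ (a.2 : ℤ) + r - 1 by omega)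
          have hw' : w ∈ M.Z r b1 (b1 + b2) := by
            obtain ⟨w1, w2, w3⟩ := mem_Z.1 hw
            refine mem_Z.2 ⟨?_, fil_of_eq w2 (by omega), fil_of_eq w3 (by omega)⟩
            rwa [show (b1 : ℤ) + b2 = a.1 + a.2 - 1 by omega]
          refine ⟨(b1, b2), Submodule.Quotient.mk ⟨w, hw'⟩,
            (M.page_d_mk r (b1, b2) a ⟨by dsimp only; omega, by dsimp only; omega⟩ _).trans
              ((E_mk_eq_mk _ _).2 ?_)⟩
          change M.D w - (y : M.carrier) ∈ _
          rw [← Submodule.subtype_apply, ← hx, sub_add_cancel_right]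
          exact neg_mem hu'
        -- Source outside the quadrant: `a.1 - r + 1 ≤ 0`, so the filtration condition that
        -- separates the sources allowed in `B r` and `B r'` is void. The class is zero on page `r`
        -- already, and zero at any index serves as preimage.
        · refine ⟨a, 0, (map_zero _).trans ((E_mk_eq_zero _).2 ?_).symm⟩
          change (y : M.carrier) ∈ _
          rw [← Submodule.subtype_apply, ← hx]
          refine add_mem hu' (D_mem_B (by omega) (m := a.1 + a.2 - 1) ?_)
          obtain ⟨w1, w2, w3⟩ := mem_Z.1 hw
          exact mem_Z.2 ⟨w1, M.mem_fil _ (by omega), fil_of_eq w3 (by omega)⟩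
      · rintro ⟨b, z, hz⟩
        -- Treats an actual source and a missing one (`w = 0`) together.
        have key : ∀ w ∈ M.Z r (a.1 - r) (a.1 + a.2 - 1),
            (y : M.carrier) - M.D w ∈ M.B r a.1 (a.1 + a.2) →
            (y : M.carrier) ∈ M.B r' a.1 (a.1 + a.2) := by
          intro w hw hB
          obtain ⟨u, hu, w', hw', hx⟩ := mem_B.1 hB
          obtain ⟨w1, w2, w3⟩ := mem_Z.1 hw
          obtain ⟨w1', w2', w3'⟩ := mem_Z.1 hw'
          obtain ⟨u1, u2, u3⟩ := mem_Z.1 hu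
          refine mem_B.2 ⟨u, mem_Z.2 ⟨u1, u2, ?_⟩, w + w', mem_Z.2 ⟨add_mem w1 w1',
            add_mem (fil_of_eq w2 (by omega)) (fil_of_eq w2' (by omega)), ?_⟩, ?_⟩
          -- `u` differs from `y` by boundaries, so it inherits the extra filtration step of `D y`,
          -- `y` being taken from `Z r'`.
          · have : M.D u = M.D y := by
              rw [eq_sub_of_add_eq hx, map_sub, map_sub, M.D_D, M.D_D, sub_zero, sub_zero]
            rw [this]
            exact fil_of_eq y3 (by omega)
          · rw [map_add]
            exact add_mem (fil_of_eq w3 (by omega)) (fil_of_eq w3' (by omega))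
          · rw [map_add, add_left_comm, hx, add_sub_cancel]
        by_cases h : (b.1 : ℤ) + r = a.1 ∧ (b.2 : ℤ) + (1 - r) = a.2
        · obtain ⟨w, rfl⟩ := Submodule.Quotient.mk_surjective _ z
          have hB := (E_mk_eq_mk _ _).1 ((M.page_d_mk r b a h w).symm.trans hz)
          refine key w ?_ ?_
          · obtain ⟨w1, w2, w3⟩ := mem_Z.1 w.2
            refine mem_Z.2 ⟨?_, fil_of_eq w2 (by omega), fil_of_eq w3 (by omega)⟩
            rwa [show (a.1 : ℤ) + a.2 - 1 = b.1 + b.2 by omega]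
          · rw [← neg_sub]
            exact neg_mem hB
        · rw [(M.page r).shape _ _ h] at hz
          refine key 0 (zero_mem _) ?_
          rw [map_zero, sub_zero]
          exact (E_mk_eq_zero _).1 (hz.symm.trans rfl))

/-- The spectral sequence of a filtered differential module. -/
def spectralSequence : CohomologicalSpectralSequenceNat (ModuleCat.{v} k) 1 where
  page r _ := M.page r
  iso r r' a hr hr1 := M.pageIso r r' a hr hr1

/-! ### Homology of a filtered differential module and convergence -/

/-- Cycles of degree `n`. -/
def cycles (n : ℤ) : Submodule k M.carrier := M.deg n ⊓ LinearMap.ker M.D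

/-- Boundaries of degree `n`. -/
def boundaries (n : ℤ) : Submodule k M.carrier := (M.deg (n - 1)).map M.D

/-- The homology of a filtered differential module. -/
abbrev homology (n : ℤ) : Type v := M.cycles n ⧸ (M.boundaries n).submoduleOf (M.cycles n)

variable {M} in
lemma mem_cycles {n : ℤ} {x : M.carrier} : x ∈ M.cycles n ↔ x ∈ M.deg n ∧ M.D x = 0 := by
  simp [cycles]

variable {M} in
lemma mem_boundaries {n : ℤ} {x : M.carrier} :
    x ∈ M.boundaries n ↔ ∃ y ∈ M.deg (n - 1), M.D y = x := by
  simp [boundaries]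

variable {M} in
lemma homology_mk_eq_mk {n : ℤ} (x y : M.cycles n) :
    (Submodule.Quotient.mk x : M.homology n) = Submodule.Quotient.mk y ↔
      (x : M.carrier) - y ∈ M.boundaries n := by
  rw [Submodule.Quotient.eq]
  rfl

variable {M} in
lemma homology_mk_eq_zero {n : ℤ} (x : M.cycles n) :
    (Submodule.Quotient.mk x : M.homology n) = 0 ↔ (x : M.carrier) ∈ M.boundaries n := by
  rw [Submodule.Quotient.mk_eq_zero]
  rfl

/-- The filtration of the homology. -/
def homologyFil (n p : ℤ) : Submodule k (M.homology n) :=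
  ((M.fil p).submoduleOf (M.cycles n)).map (Submodule.mkQ _)

variable {M} in
lemma mem_homologyFil {n p : ℤ} {z : M.homology n} :
    z ∈ M.homologyFil n p ↔ ∃ x : M.cycles n, (x : M.carrier) ∈ M.fil p ∧
      Submodule.Quotient.mk x = z := Iff.rfl

variable {M} in
-- The filtration is bounded in each degree: `D x` has degree `n + 1` and filtration `p + r > n +
-- 1`, so it is zero.
lemma cycle_of_mem_Z {r p n : ℤ} (hr : n + 1 < p + r) {x : M.carrier} (hx : x ∈ M.Z r p n) :
    x ∈ M.cycles n := by
  obtain ⟨h1, h2, h3⟩ := mem_Z.1 hx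
  exact mem_cycles.2 ⟨h1, M.eq_zero (M.D_mem_deg h1 rfl) h3 hr⟩

/-- The graded pieces of the homology are the entries of the pages far enough. -/
def gradedPieceEquiv (r n p : ℤ) (hr : n + 1 < p + r) (hp : p + 1 ≤ r) (W : Type*)
    [AddCommGroup W] [Module k W] (e : M.homology n ≃ₗ[k] W) :
    M.E r p n ≃ₗ[k] ((M.homologyFil n p).map e.toLinearMap ⧸
      ((M.homologyFil n (p + 1)).map e.toLinearMap).submoduleOf
        ((M.homologyFil n p).map e.toLinearMap)) :=
  quotientEquivOfSurjective
    (Submodule.mkQ _ ∘ₗ (e.toLinearMap ∘ₗ Submodule.mkQ _ ∘ₗ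
      Submodule.inclusion (fun _ hx => cycle_of_mem_Z hr hx)).codRestrict
        ((M.homologyFil n p).map e.toLinearMap)
        (fun x => Submodule.mem_map_of_mem
          (Submodule.mem_map_of_mem (Submodule.mem_comap.2 (mem_Z.1 x.2).2.1))))
    (by
      intro z
      obtain ⟨⟨_, _, ⟨x, hx, rfl⟩, rfl⟩, rfl⟩ := Submodule.mkQ_surjective _ z
      obtain ⟨h1, h2⟩ := mem_cycles.1 x.2
      exact ⟨⟨x, mem_Z.2 ⟨h1, hx, by rw [h2]; exact zero_mem _⟩⟩, rfl⟩)
    ((M.B r p n).submoduleOf (M.Z r p n))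
    (by
      intro x
      rw [LinearMap.comp_apply, Submodule.mkQ_apply, Submodule.Quotient.mk_eq_zero,
        Submodule.submoduleOf, Submodule.mem_comap]
      change (x : M.carrier) ∈ _ ↔ e _ ∈ (M.homologyFil n (p + 1)).map e.toLinearMap
      rw [Submodule.mem_map_equiv, LinearEquiv.symm_apply_apply]
      change _ ↔ (Submodule.Quotient.mk ⟨(x : M.carrier), cycle_of_mem_Z hr x.2⟩ :
        M.homology n) ∈ _
      rw [mem_homologyFil]
      constructor
      · intro hx
        obtain ⟨u, hu, w, hw, hx⟩ := mem_B.1 hx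
        refine ⟨⟨u, cycle_of_mem_Z (by omega) hu⟩, (mem_Z.1 hu).2.1, ?_⟩
        rw [homology_mk_eq_mk, mem_boundaries]
        refine ⟨-w, neg_mem (mem_Z.1 hw).1, ?_⟩
        rw [map_neg, ← hx, sub_add_cancel_left]
      · rintro ⟨u, hu, h⟩
        rw [homology_mk_eq_mk, mem_boundaries] at h
        obtain ⟨w, hw, h⟩ := h
        obtain ⟨u1, u2⟩ := mem_cycles.1 u.2
        have hxw : (u : M.carrier) + M.D (-w) = x := by
          rw [map_neg, h]
          exact (sub_eq_add_neg _ _).symm.trans (sub_sub_cancel _ _)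
        -- A boundary may start anywhere in degree `n - 1`. This is allowed because `p - r + 1 ≤ 0`,
        -- where the filtration is the whole module.
        refine mem_B.2 ⟨u, mem_Z.2 ⟨u1, hu, by rw [u2]; exact zero_mem _⟩, -w,
          mem_Z.2 ⟨neg_mem hw, M.mem_fil _ (by omega), ?_⟩, hxw⟩
        rw [eq_sub_of_add_eq' hxw]
        exact sub_mem (fil_of_eq (mem_Z.1 x.2).2.1 (by omega)) (fil_of_eq hu (by omega)))

/-- The spectral sequence of a filtered differential module converges to its homology. -/
lemma convergesTo (H : ℕ → ModuleCat.{v} k) (e : ∀ n : ℕ, M.homology n ≃ₗ[k] H n) :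
    ConvergesTo M.spectralSequence H := by
  intro n
  refine ⟨fun p => (M.homologyFil n p).map (e n).toLinearMap, ?_, ?_, ?_, ?_⟩
  · intro p q hpq
    refine Submodule.map_mono (Submodule.map_mono fun x hx => ?_)
    exact M.fil_le (by omega) hx
  · refine Submodule.eq_top_iff'.2 fun z => ?_
    rw [Submodule.mem_map_equiv]
    obtain ⟨x, hx⟩ := Submodule.Quotient.mk_surjective _ ((e n).symm z)
    exact ⟨x, M.mem_fil _ (by simp), hx⟩
  · refine (Submodule.eq_bot_iff _).2 ?_
    rintro _ ⟨_, ⟨x, hx, rfl⟩, rfl⟩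
    have h0 : x = 0 := Subtype.ext (M.eq_zero (mem_cycles.1 x.2).1 hx (by push_cast; omega))
    rw [h0, map_zero, map_zero]
  · intro i j hij r hr
    -- The total degree is made a variable so that passing between `i + j` and `n` is a
    -- substitution.
    have key : ∀ m : ℤ, m = n → Nonempty (M.E r i m ≃ₗ[k]
        ((M.homologyFil n i).map (e n).toLinearMap ⧸
          ((M.homologyFil n (i + 1 : ℕ)).map (e n).toLinearMap).submoduleOf
            ((M.homologyFil n i).map (e n).toLinearMap))) := by
      rintro _ rfl
      exact ⟨M.gradedPieceEquiv r n i (by omega) (by omega) (H n) (e n)⟩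
    exact key (i + j) (by omega)

end FilteredDiffModule

/-! ### First quadrant bicomplexes -/

/-- A first quadrant bicomplex with anticommuting differentials. -/
structure Bicomplex (k : Type u) [Field k] where
  X : ℕ → ℕ → ModuleCat.{v} k
  dh : ∀ i j, X i j →ₗ[k] X (i + 1) j
  dv : ∀ i j, X i j →ₗ[k] X i (j + 1)
  dh_dh : ∀ i j x, dh (i + 1) j (dh i j x) = 0
  dv_dv : ∀ i j x, dv i (j + 1) (dv i j x) = 0
  anticomm : ∀ i j x, dh i (j + 1) (dv i j x) + dv (i + 1) j (dh i j x) = 0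

namespace Bicomplex

variable {k : Type u} [Field k] (K : Bicomplex.{u, v} k)

/-- The product of all entries. -/
abbrev Prod : Type v := ∀ i j, K.X i j

/-- The horizontal part of the total differential. -/
def hPart (x : K.Prod) : K.Prod
  | 0, _ => 0
  | i + 1, j => K.dh i j (x i j)

/-- The vertical part of the total differential. -/
def vPart (x : K.Prod) : K.Prod
  | _, 0 => 0
  | i, j + 1 => K.dv i j (x i j)

/-- The total differential. -/
def totD : K.Prod →ₗ[k] K.Prod where
  toFun x := K.hPart x + K.vPart x
  map_add' x y := by
    funext i j
    rcases i with _ | i <;> rcases j with _ | j <;> simp [hPart, vPart] <;> abel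
  map_smul' c x := by
    funext i j
    rcases i with _ | i <;> rcases j with _ | j <;> simp [hPart, vPart]

lemma totD_zero_zero (x : K.Prod) : K.totD x 0 0 = 0 := add_zero _

lemma totD_succ_zero (x : K.Prod) (i : ℕ) : K.totD x (i + 1) 0 = K.dh i 0 (x i 0) := add_zero _

lemma totD_zero_succ (x : K.Prod) (j : ℕ) : K.totD x 0 (j + 1) = K.dv 0 j (x 0 j) := zero_add _

lemma totD_succ_succ (x : K.Prod) (i j : ℕ) :
    K.totD x (i + 1) (j + 1) = K.dh i (j + 1) (x i (j + 1)) + K.dv (i + 1) j (x (i + 1) j) := rfl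

lemma totD_succ (x : K.Prod) (i j : ℕ) (h : ∀ j', x (i + 1) j' = 0) :
    K.totD x (i + 1) j = K.dh i j (x i j) := by
  cases j with
  | zero => exact K.totD_succ_zero x i
  | succ j => rw [totD_succ_succ, h, map_zero, add_zero]

lemma totD_totD (x : K.Prod) : K.totD (K.totD x) = 0 := by
  funext i j
  rcases i with _ | _ | i <;> rcases j with _ | _ | j <;>
    simp [totD_zero_zero, totD_succ_zero, totD_zero_succ, totD_succ_succ, K.dh_dh, K.dv_dv,
      K.anticomm]

/-- The total complex, filtered by columns. -/
abbrev tot : FilteredDiffModule.{u, v} k where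
  carrier := K.Prod
  D := K.totD
  deg n :=
    { carrier := {x | ∀ i j : ℕ, (i : ℤ) + j ≠ n → x i j = 0}
      add_mem' := fun hx hy i j h => by simp [hx i j h, hy i j h]
      zero_mem' := fun _ _ _ => rfl
      smul_mem' := fun c x hx i j h => by simp [hx i j h] }
  fil p :=
    { carrier := {x | ∀ i j : ℕ, (i : ℤ) < p → x i j = 0}
      add_mem' := fun hx hy i j h => by simp [hx i j h, hy i j h]
      zero_mem' := fun _ _ _ => rfl
      smul_mem' := fun c x hx i j h => by simp [hx i j h] }
  D_D := K.totD_totD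
  D_mem_deg := by
    rintro n m x hx rfl i j h
    rcases i with _ | i <;> rcases j with _ | j
    · exact K.totD_zero_zero x
    · rw [totD_zero_succ, hx _ _ (by push_cast at h ⊢; omega), map_zero]
    · rw [totD_succ_zero, hx _ _ (by push_cast at h ⊢; omega), map_zero]
    · rw [totD_succ_succ, hx _ _ (by push_cast at h ⊢; omega),
        hx _ _ (by push_cast at h ⊢; omega), map_zero, map_zero, add_zero]
  D_mem_fil := by
    rintro p x hx i j h
    rcases i with _ | i <;> rcases j with _ | j
    · exact K.totD_zero_zero x
    · rw [totD_zero_succ, hx _ _ h, map_zero]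
    · rw [totD_succ_zero, hx _ _ (by push_cast at h ⊢; omega), map_zero]
    · rw [totD_succ_succ, hx _ _ (by push_cast at h ⊢; omega), hx _ _ h,
        map_zero, map_zero, add_zero]
  fil_le := fun h x hx i j h' => hx i j (by omega)
  mem_fil := fun x hp i j h => by omega
  eq_zero := fun {n p x} h1 h2 h => by
    funext i j
    by_cases hi : (i : ℤ) < p
    · exact h2 i j hi
    · exact h1 i j (by omega)

/-- The element of the product concentrated at the position `(i, j)`. -/
def single (i j : ℕ) : K.X i j →ₗ[k] K.Prod :=
  LinearMap.single k (fun i => ∀ j, K.X i j) i ∘ₗ LinearMap.single k (fun j => K.X i j) j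

lemma single_same (i j : ℕ) (a : K.X i j) : K.single i j a i j = a := by
  simp [single]

lemma single_of_ne (i j : ℕ) (a : K.X i j) (i' j' : ℕ) (h : i' ≠ i ∨ j' ≠ j) :
    K.single i j a i' j' = 0 := by
  by_cases hi : i' = i
  · subst hi
    have hj : j' ≠ j := by tauto
    simp [single, hj]
  · simp [single, hi]

lemma eq_single {x : K.Prod} {i j : ℕ} (h : ∀ i' j', (i' ≠ i ∨ j' ≠ j) → x i' j' = 0) :
    x = K.single i j (x i j) := by
  funext i' j'
  by_cases h' : i' = i ∧ j' = j
  · obtain ⟨rfl, rfl⟩ := h'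
    rw [single_same]
  · have h' : i' ≠ i ∨ j' ≠ j := by tauto
    rw [h _ _ h', single_of_ne _ _ _ _ _ _ h']

lemma totD_single (i j : ℕ) (a : K.X i j) :
    K.totD (K.single i j a) = K.single (i + 1) j (K.dh i j a) + K.single i (j + 1) (K.dv i j a) := by
  have hh : K.hPart (K.single i j a) = K.single (i + 1) j (K.dh i j a) := by
    funext i' j'
    rcases i' with _ | i'
    · rw [single_of_ne _ _ _ _ _ _ (Or.inl (by omega))]; rfl
    · by_cases h : i' = i ∧ j' = j
      · obtain ⟨rfl, rfl⟩ := h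
        rw [single_same]
        exact congrArg _ (single_same ..)
      · rw [single_of_ne _ _ _ _ _ _ (by omega)]
        exact (congrArg (K.dh i' j') (single_of_ne _ _ _ _ _ _ (by omega))).trans (map_zero _)
  have hv : K.vPart (K.single i j a) = K.single i (j + 1) (K.dv i j a) := by
    funext i' j'
    rcases j' with _ | j'
    · rw [single_of_ne _ _ _ _ _ _ (Or.inr (by omega))]; rfl
    · by_cases h : i' = i ∧ j' = j
      · obtain ⟨rfl, rfl⟩ := h
        rw [single_same]
        exact congrArg _ (single_same ..)
      · rw [single_of_ne _ _ _ _ _ _ (by omega)]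
        exact (congrArg (K.dv i' j') (single_of_ne _ _ _ _ _ _ (by omega))).trans (map_zero _)
  exact congrArg₂ (· + ·) hh hv

lemma single_mem_deg (i j : ℕ) (n : ℤ) (h : (i : ℤ) + j = n) (a : K.X i j) :
    K.single i j a ∈ K.tot.deg n := fun i' j' h' => single_of_ne _ _ _ _ _ _ (by omega)

/-! #### Exact rows -/

/-- If the rows are exact in positive degrees, a cochain whose differential is concentrated in the
zeroth column is, up to a coboundary, concentrated in the zeroth column. -/
lemma exists_sub_totD (hrow : ∀ i j, Function.Exact (K.dh i j) (K.dh (i + 1) j)) (p : ℕ) :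
    ∀ (n : ℤ) (x : K.Prod), x ∈ K.tot.deg n → (∀ i j, p < i → x i j = 0) →
      (∀ i j, K.totD x (i + 1) j = 0) →
      ∃ y ∈ K.tot.deg (n - 1), ∀ i j, (x - K.totD y) (i + 1) j = 0 := by
  induction p with
  | zero =>
    intro n x hx hp hD
    exact ⟨0, zero_mem _, fun i j => by
      rw [map_zero, sub_zero, hp _ _ (Nat.succ_pos i)]⟩
  | succ p ih =>
    intro n x hx hp hD
    -- The last column `p + 1` meets degree `n` in at most one entry. As the next column is zero,
    -- the horizontal differential kills that entry, so row exactness lifts it to column `p`, and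
    -- subtracting the total differential of the lift empties column `p + 1`. If `n < p + 1` that
    -- column is empty from the start.
    by_cases hn : (p : ℤ) + 1 ≤ n
    · obtain ⟨j, hj⟩ := Int.eq_ofNat_of_zero_le (show 0 ≤ n - (p + 1) by omega)
      have h0 : K.dh (p + 1) j (x (p + 1) j) = 0 := by
        rw [← K.totD_succ x (p + 1) j (fun j' => hp _ _ (by omega)), hD]
      obtain ⟨a, ha⟩ := (hrow p j _).1 h0
      have hy0 : K.single p j a ∈ K.tot.deg (n - 1) := K.single_mem_deg _ _ _ (by omega) a
      obtain ⟨y, hy, h⟩ := ih n (x - K.totD (K.single p j a))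
        (sub_mem hx (K.tot.D_mem_deg hy0 (by omega)))
        (by
          intro i j' hi
          rw [totD_single]
          by_cases hij : i = p + 1 ∧ j' = j
          · obtain ⟨rfl, rfl⟩ := hij
            simp only [Pi.sub_apply, Pi.add_apply]
            rw [single_same, single_of_ne _ _ _ _ _ _ (by omega), ha, add_zero, sub_self]
          · simp only [Pi.sub_apply, Pi.add_apply]
            rw [single_of_ne _ _ _ _ _ _ (by omega), single_of_ne _ _ _ _ _ _ (by omega),
              add_zero, sub_zero]
            by_cases hi' : i = p + 1
            · exact hx _ _ (by omega)
            · exact hp _ _ (by omega))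
        (by
          intro i j'
          rw [map_sub, totD_totD, sub_zero, hD])
      exact ⟨K.single p j a + y, add_mem hy0 hy, fun i j' => by
        rw [map_add, ← sub_sub]; exact h i j'⟩
    · refine ih n x hx (fun i j hi => ?_) hD
      by_cases hi' : i = p + 1
      · exact hx _ _ (by omega)
      · exact hp _ _ (by omega)

/-- A cochain of degree `n` has no entries in columns beyond `n`, so the induction on the last
column can start at `n.toNat`. -/
lemma exists_sub_totD' (hrow : ∀ i j, Function.Exact (K.dh i j) (K.dh (i + 1) j)) (n : ℤ)
    (x : K.Prod) (hx : x ∈ K.tot.deg n) (hD : ∀ i j, K.totD x (i + 1) j = 0) :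
    ∃ y ∈ K.tot.deg (n - 1), ∀ i j, (x - K.totD y) (i + 1) j = 0 :=
  K.exists_sub_totD hrow n.toNat n x hx (fun i j hi => hx _ _ (by omega)) hD

section Augmentation

variable (A : CochainComplex (ModuleCat.{v} k) ℕ) (α : ∀ j, A.X j →ₗ[k] K.X 0 j)
  (hαd : ∀ j a, K.dv 0 j (α j a) = α (j + 1) ((A.d j (j + 1)).hom a))
  (hα : ∀ j, Function.Injective (α j)) (hrow0 : ∀ j, Function.Exact (α j) (K.dh 0 j))
  (hrow : ∀ i j, Function.Exact (K.dh i j) (K.dh (i + 1) j))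

include hαd hrow0 in
lemma totD_single_aug (j : ℕ) (a : A.X j) : K.totD (K.single 0 j (α j a)) =
    K.single 0 (j + 1) (α (j + 1) ((A.d j (j + 1)).hom a)) := by
  rw [totD_single, (hrow0 j).apply_apply_eq_zero, map_zero, zero_add, hαd]

include hαd hα hrow0 hrow in
/-- The cohomology of the total complex of a bicomplex with exact augmented rows is the cohomology
of the augmentation column. -/
lemma nonempty_homology_equiv_tot (n : ℕ) : Nonempty (A.homology n ≃ₗ[k] K.tot.homology n) := by
  have hm : ∀ x : LinearMap.ker (A.d n (n + 1)).hom, K.single 0 n (α n x) ∈ K.tot.cycles n := by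
    intro x
    refine FilteredDiffModule.mem_cycles.2 ⟨K.single_mem_deg _ _ _ (by omega) _, ?_⟩
    refine (K.totD_single_aug A α hαd hrow0 n _).trans ?_
    rw [LinearMap.mem_ker.1 x.2, map_zero, map_zero]
  let f : LinearMap.ker (A.d n (n + 1)).hom →ₗ[k] K.tot.homology n := Submodule.mkQ _ ∘ₗ
    (K.single 0 n ∘ₗ α n ∘ₗ Submodule.subtype _).codRestrict (K.tot.cycles n) hm
  have hf0 : ∀ x, f x = 0 ↔ K.single 0 n (α n x) ∈ K.tot.boundaries n :=
    fun x => FilteredDiffModule.homology_mk_eq_zero (M := K.tot) ⟨_, hm x⟩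
  -- A cochain concentrated in column zero whose differential stays there is killed by `dh 0`, so it
  -- comes from the augmentation.
  have hcol : ∀ (m : ℕ) (x : K.Prod), x ∈ K.tot.deg m → (∀ i j, x (i + 1) j = 0) →
      (∀ i j, K.totD x (i + 1) j = 0) → ∃ a, x = K.single 0 m (α m a) := by
    intro m x hx h0 hD
    obtain ⟨a, ha⟩ := (hrow0 m _).1 ((K.totD_succ x 0 m (h0 0)).symm.trans (hD 0 m))
    refine ⟨a, ?_⟩
    rw [ha]
    refine K.eq_single fun i j h => ?_
    rcases i with _ | i
    · exact hx _ _ (by push_cast; omega)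
    · exact h0 _ _
  have hsurj : Function.Surjective f := by
    intro z
    obtain ⟨x, rfl⟩ := Submodule.Quotient.mk_surjective _ z
    obtain ⟨hx1, hx2⟩ := FilteredDiffModule.mem_cycles.1 x.2
    change K.totD x.1 = 0 at hx2
    obtain ⟨y, hy, h⟩ := K.exists_sub_totD' hrow n x.1 hx1 (by simp [hx2])
    have hDx : K.totD (x.1 - K.totD y) = 0 := by rw [map_sub, hx2, totD_totD, sub_zero]
    obtain ⟨a, ha⟩ := hcol n (x.1 - K.totD y) (sub_mem hx1 (K.tot.D_mem_deg hy (by omega))) h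
      (by rw [hDx]; exact fun _ _ => rfl)
    have ha0 : (A.d n (n + 1)).hom a = 0 := by
      apply hα
      rw [ha, K.totD_single_aug A α hαd hrow0] at hDx
      rw [← K.single_same 0 (n + 1) (α _ _), hDx, map_zero]
      rfl
    refine ⟨⟨a, ha0⟩, (FilteredDiffModule.homology_mk_eq_mk (M := K.tot) ⟨_, hm ⟨a, ha0⟩⟩ x).2 ?_⟩
    refine FilteredDiffModule.mem_boundaries.2 ⟨-y, neg_mem hy, ?_⟩
    change K.totD (-y) = K.single 0 n (α n a) - x.1
    rw [← ha, map_neg, sub_sub_cancel_left]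
  refine ⟨((homologyIsoQuotient A n (Submodule.subtype _) ?_ (LinearMap.ker f)
    ?_).toLinearEquiv).trans (f.quotKerEquivOfSurjective hsurj)⟩
  · intro x
    constructor
    · rintro ⟨y, rfl⟩ j
      by_cases h : n + 1 = j
      · subst h; exact y.2
      · rw [A.shape _ _ h]; rfl
    · exact fun h => ⟨⟨x, h _⟩, rfl⟩
  · intro x
    rw [LinearMap.mem_ker, hf0, FilteredDiffModule.mem_boundaries]
    constructor
    · rintro ⟨y, hy, h⟩
      change K.totD y = _ at h
      -- The cochain `y` bounding the augmented class can be pushed into column zero without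
      -- changing its differential; it then comes from an element of `A`.
      obtain ⟨w, hw, hyw⟩ := K.exists_sub_totD' hrow (n - 1) y hy (by
        intro i j
        rw [h, single_of_ne _ _ _ _ _ _ (Or.inl (by omega))])
      have hD : K.totD (y - K.totD w) = K.single 0 n (α n x) := by
        rw [map_sub, totD_totD, sub_zero, h]
      rcases n with _ | m
      -- In degree zero the bounding cochain has degree `-1`, hence vanishes, and injectivity of `α`
      -- forces `x = 0`.
      · have hyw0 : y - K.totD w = 0 := by
          funext i j
          exact (sub_mem hy (K.tot.D_mem_deg hw (by omega)) : y - K.totD w ∈ K.tot.deg _) i j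
            (by push_cast; omega)
        rw [hyw0, map_zero] at hD
        refine ⟨0, 0, ?_⟩
        apply hα
        rw [map_zero, map_zero, ← K.single_same 0 0 (α 0 _), Submodule.subtype_apply, ← hD]
        rfl
      · obtain ⟨a, ha⟩ := hcol m (y - K.totD w)
          (by
            have := sub_mem hy (K.tot.D_mem_deg hw (sub_add_cancel _ _))
            rwa [show ((m + 1 : ℕ) : ℤ) - 1 = m by push_cast; omega] at this)
          hyw (by
            intro i j
            rw [hD, single_of_ne _ _ _ _ _ _ (Or.inl (by omega))])
        refine ⟨m, a, hα _ ?_⟩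
        rw [ha, K.totD_single_aug A α hαd hrow0] at hD
        rw [← K.single_same 0 (m + 1) (α _ _), hD, single_same]
        rfl
    · rintro ⟨i, a, ha⟩
      by_cases h : i + 1 = n
      · subst h
        refine ⟨K.single 0 i (α i a), K.single_mem_deg _ _ _ (by push_cast; omega) _, ?_⟩
        refine (K.totD_single_aug A α hαd hrow0 i a).trans ?_
        rw [ha]
        rfl
      · rw [A.shape _ _ h] at ha
        refine ⟨0, zero_mem _, ?_⟩
        have : α n x = 0 := (congrArg (α n) ha.symm).trans (map_zero _)
        rw [map_zero, this, map_zero]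

end Augmentation

/-! #### Transposition -/

/-- The transposed bicomplex. -/
def transpose : Bicomplex.{u, v} k where
  X i j := K.X j i
  dh i j := K.dv j i
  dv i j := K.dh j i
  dh_dh i j := K.dv_dv j i
  dv_dv i j := K.dh_dh j i
  anticomm i j x := (add_comm _ _).trans (K.anticomm j i x)

lemma totD_transpose (x : K.Prod) : K.transpose.totD (fun i j => x j i) = fun i j => K.totD x j i := by
  funext i j
  rcases i with _ | i <;> rcases j with _ | j
  · rfl
  · exact (K.transpose.totD_zero_succ _ _).trans (K.totD_succ_zero _ _).symm
  · exact (K.transpose.totD_succ_zero _ _).trans (K.totD_zero_succ _ _).symm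
  · exact (K.transpose.totD_succ_succ _ _ _).trans (add_comm _ _)

/-- The total complexes of a bicomplex and its transpose have the same homology. -/
def totHomologyTranspose (n : ℤ) : K.tot.homology n ≃ₗ[k] K.transpose.tot.homology n :=
  quotientEquivOfSurjective
    (Submodule.mkQ _ ∘ₗ
      ({ toFun x := ⟨fun i j => x.1 j i, FilteredDiffModule.mem_cycles.2
          ⟨fun i j h => (FilteredDiffModule.mem_cycles.1 x.2).1 j i (by omega),
            (K.totD_transpose x.1).trans (by
              have h : K.totD x.1 = 0 := (FilteredDiffModule.mem_cycles.1 x.2).2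
              rw [h]; rfl)⟩⟩
         map_add' _ _ := rfl
         map_smul' _ _ := rfl } : K.tot.cycles n →ₗ[k] K.transpose.tot.cycles n))
    (by
      intro z
      obtain ⟨x, rfl⟩ := Submodule.Quotient.mk_surjective _ z
      obtain ⟨h1, h2⟩ := FilteredDiffModule.mem_cycles.1 x.2
      exact ⟨⟨fun i j => x.1 j i, FilteredDiffModule.mem_cycles.2
          ⟨fun i j h => h1 j i (by omega), (K.transpose.totD_transpose x.1).trans (by
              change K.transpose.totD x.1 = 0 at h2
              rw [h2]; rfl)⟩⟩, rfl⟩)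
    _
    (by
      intro x
      refine Iff.trans ?_ (FilteredDiffModule.homology_mk_eq_zero (M := K.transpose.tot) _).symm
      refine FilteredDiffModule.mem_boundaries.trans
        (Iff.trans ?_ FilteredDiffModule.mem_boundaries.symm)
      constructor
      · rintro ⟨y, hy, h⟩
        refine ⟨fun i j => y j i, fun i j h' => hy j i (by omega),
          (K.totD_transpose y).trans ?_⟩
        change K.totD y = x.1 at h
        rw [h]
        rfl
      · rintro ⟨y, hy, h⟩
        refine ⟨fun i j => y j i, fun i j h' => hy j i (by omega),
          (K.transpose.totD_transpose y).trans ?_⟩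
        change K.transpose.totD y = fun i j => x.1 j i at h
        rw [h]
        rfl)

/-! #### The first page -/

/-- The first page of the spectral sequence of a bicomplex consists of the homology of its
columns. -/
lemma nonempty_page_one_iso (A : CochainComplex (ModuleCat.{v} k) ℕ) (i : ℕ)
    (e : ∀ j, A.X j ≃ₗ[k] K.X i j) (s : k) (hs : s ≠ 0)
    (he : ∀ j a, K.dv i j (e j a) = s • e (j + 1) ((A.d j (j + 1)).hom a)) (j : ℕ) :
    Nonempty ((K.tot.spectralSequence.page 1 le_rfl).X (i, j) ≅ A.homology j) := by
  have hm : ∀ x : LinearMap.ker (A.d j (j + 1)).hom,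
      K.single i j (e j x) ∈ K.tot.Z 1 i (i + j) := by
    intro x
    refine FilteredDiffModule.mem_Z.2 ⟨K.single_mem_deg _ _ _ rfl _,
      fun i' j' h => single_of_ne _ _ _ _ _ _ (Or.inl (by omega)), ?_⟩
    have hD : K.totD (K.single i j (e j x)) = K.single (i + 1) j (K.dh i j (e j x)) := by
      rw [totD_single, he, LinearMap.mem_ker.1 x.2, map_zero, smul_zero, map_zero, add_zero]
    intro i' j' h
    refine (congrFun (congrFun hD i') j').trans (single_of_ne _ _ _ _ _ _ (Or.inl (by omega)))
  let f : LinearMap.ker (A.d j (j + 1)).hom →ₗ[k] K.tot.E 1 i (i + j) := Submodule.mkQ _ ∘ₗ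
    (K.single i j ∘ₗ (e j).toLinearMap ∘ₗ Submodule.subtype _).codRestrict
      (K.tot.Z 1 i (i + j)) hm
  have hf0 : ∀ x, f x = 0 ↔ K.single i j (e j x) ∈ K.tot.B 1 i (i + j) :=
    fun x => FilteredDiffModule.E_mk_eq_zero (M := K.tot) ⟨_, hm x⟩
  -- Everything supported strictly to the right of column `i` is zero on the first page, so only the
  -- entry at `(i, j)` matters.
  have hB : ∀ u : K.Prod, u ∈ K.tot.deg (i + j) → u ∈ K.tot.fil (i + 1) →
      u ∈ K.tot.B 1 i (i + j) := fun u h1 h2 =>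
    FilteredDiffModule.mem_B_of_mem_Z (FilteredDiffModule.mem_Z.2
      ⟨h1, h2, FilteredDiffModule.fil_of_eq (K.tot.D_mem_fil h2) (by omega)⟩)
  have hvert : ∀ (x : K.Prod), x ∈ K.tot.fil i → K.totD x i (j + 1) = K.dv i j (x i j) := by
    intro x hx
    rcases i with _ | i
    · exact K.totD_zero_succ _ _
    · rw [totD_succ_succ, hx i (j + 1) (by push_cast; omega), map_zero, zero_add]
  have hsurj : Function.Surjective f := by
    intro z
    obtain ⟨x, rfl⟩ := Submodule.Quotient.mk_surjective _ z
    obtain ⟨h1, h2, h3⟩ := FilteredDiffModule.mem_Z.1 x.2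
    have h0 : K.dv i j (x.1 i j) = 0 := (hvert x.1 h2).symm.trans (h3 i (j + 1) (by omega))
    have ha : (A.d j (j + 1)).hom ((e j).symm (x.1 i j)) = 0 := by
      have := he j ((e j).symm (x.1 i j))
      rw [LinearEquiv.apply_symm_apply, h0] at this
      exact (e (j + 1)).map_eq_zero_iff.1 ((smul_eq_zero.1 this.symm).resolve_left hs)
    refine ⟨⟨_, ha⟩, (FilteredDiffModule.E_mk_eq_mk (M := K.tot) ⟨_, hm ⟨_, ha⟩⟩ x).2 ?_⟩
    change K.single i j (e j ((e j).symm (x.1 i j))) - x.1 ∈ _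
    rw [LinearEquiv.apply_symm_apply]
    refine hB _ (sub_mem (K.single_mem_deg _ _ _ rfl _) h1) (fun i' j' h => ?_)
    by_cases hi : i' = i
    · subst hi
      by_cases hj : j' = j
      · subst hj
        rw [Pi.sub_apply, Pi.sub_apply, single_same, sub_self]
      · rw [Pi.sub_apply, Pi.sub_apply, single_of_ne _ _ _ _ _ _ (Or.inr hj),
          h1 _ _ (by omega), sub_zero]
    · rw [Pi.sub_apply, Pi.sub_apply, single_of_ne _ _ _ _ _ _ (Or.inl hi),
        h2 _ _ (by omega), sub_zero]
  refine ⟨(LinearEquiv.toModuleIso (f.quotKerEquivOfSurjective hsurj)).symm ≪≫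
    (homologyIsoQuotient A j (Submodule.subtype _) ?_ (LinearMap.ker f) ?_).symm⟩
  · intro x
    constructor
    · rintro ⟨y, rfl⟩ j'
      by_cases h : j + 1 = j'
      · subst h; exact y.2
      · rw [A.shape _ _ h]; rfl
    · exact fun h => ⟨⟨x, h _⟩, rfl⟩
  · intro x
    rw [LinearMap.mem_ker, hf0]
    constructor
    · intro hx
      obtain ⟨u, hu, w, hw, h⟩ := FilteredDiffModule.mem_B.1 hx
      obtain ⟨u1, u2, u3⟩ := FilteredDiffModule.mem_Z.1 hu
      obtain ⟨w1, w2, w3⟩ := FilteredDiffModule.mem_Z.1 hw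
      have hDw : K.totD w i j = e j x := by
        rw [← K.single_same i j (e j x), ← h]
        change _ = u i j + K.totD w i j
        rw [u2 i j (by omega), zero_add]
      rw [sub_add_cancel] at w2
      rcases j with _ | j
      -- In row zero no vertical differential arrives, and `w` has no entries left of column `i`, so
      -- the entry of `D w` at `(i, 0)` is zero.
      · refine ⟨0, 0, ?_⟩
        rw [map_zero]
        apply (e 0).injective
        rw [map_zero]
        refine Eq.trans ?_ hDw
        rcases i with _ | i
        · exact (K.totD_zero_zero w).symm
        · rw [totD_succ_zero, w2 _ _ (by push_cast; omega), map_zero]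
      · have hDw' : K.totD w i (j + 1) = K.dv i j (w i j) := by
          rcases i with _ | i
          · exact K.totD_zero_succ _ _
          · rw [totD_succ_succ, w2 i (j + 1) (by push_cast; omega), map_zero, zero_add]
        -- The scalar is `s` itself; it absorbs the sign by which `K.dv` differs from the
        -- differential of `A`.
        refine ⟨j, s⁻¹⁻¹ • (e j).symm (w i j), (e (j + 1)).injective ?_⟩
        rw [inv_inv, map_smul, map_smul, ← he, LinearEquiv.apply_symm_apply, ← hDw', hDw]
        rfl
    · rintro ⟨i', a, ha⟩
      by_cases h : i' + 1 = j
      · subst h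
        -- The vertical part of this differential is the wanted boundary. The horizontal part lies
        -- in column `i + 1`, so it is zero on the first page.
        have hD : K.totD (K.single i i' (s⁻¹ • e i' a)) - K.single (i + 1) i'
            (K.dh i i' (s⁻¹ • e i' a)) = K.single i (i' + 1) (e (i' + 1) x) := by
          rw [totD_single, add_sub_cancel_left, map_smul, he, smul_smul, inv_mul_cancel₀ hs,
            one_smul, ha]
          rfl
        rw [← hD]
        refine sub_mem (FilteredDiffModule.D_mem_B (m := i + i') (by push_cast; omega)
          (FilteredDiffModule.mem_Z.2 ⟨K.single_mem_deg _ _ _ rfl _, fun i'' j h => ?_,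
            K.tot.D_mem_fil fun i'' j h => ?_⟩)) (hB _ (K.single_mem_deg _ _ _ (by push_cast; omega) _)
              fun i'' j h => ?_)
        · exact single_of_ne _ _ _ _ _ _ (Or.inl (by omega))
        · exact single_of_ne _ _ _ _ _ _ (Or.inl (by omega))
        · exact single_of_ne _ _ _ _ _ _ (Or.inl (by omega))
      · rw [A.shape _ _ h] at ha
        have h0 : (x : A.X j) = 0 := ha.symm
        rw [h0, map_zero, map_zero]
        exact zero_mem _

end Bicomplex

/-! ### Commuting bicomplexes and comparison of their two augmentations -/

namespace Bicomplex

variable {k : Type u} [Field k]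

/-- The bicomplex with anticommuting differentials obtained from commuting differentials by
changing the signs of the vertical differentials in odd columns. -/
def ofComm (X : ℕ → ℕ → ModuleCat.{v} k) (dh : ∀ i j, X i j →ₗ[k] X (i + 1) j)
    (dv : ∀ i j, X i j →ₗ[k] X i (j + 1)) (dh_dh : ∀ i j x, dh (i + 1) j (dh i j x) = 0)
    (dv_dv : ∀ i j x, dv i (j + 1) (dv i j x) = 0)
    (comm : ∀ i j x, dh i (j + 1) (dv i j x) = dv (i + 1) j (dh i j x)) : Bicomplex k where
  X := X
  dh := dh
  dv i j := (-1 : k) ^ i • dv i j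
  dh_dh := dh_dh
  dv_dv i j x := by
    rw [LinearMap.smul_apply, LinearMap.smul_apply, map_smul, dv_dv, smul_zero, smul_zero]
  anticomm i j x := by
    rw [LinearMap.smul_apply, LinearMap.smul_apply, map_smul, comm, pow_succ, mul_neg_one,
      neg_smul, add_neg_cancel]

variable (X : ℕ → ℕ → ModuleCat.{v} k) (dh : ∀ i j, X i j →ₗ[k] X (i + 1) j)
  (dv : ∀ i j, X i j →ₗ[k] X i (j + 1))

lemma exact_smul {M N P : Type*} [AddCommGroup M] [Module k M] [AddCommGroup N]
    [Module k N] [AddCommGroup P] [Module k P] {f : M →ₗ[k] N} {g : N →ₗ[k] P}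
    (h : Function.Exact f g) (s t : k) (hs : s ≠ 0) (ht : t ≠ 0) :
    Function.Exact (s • f) (t • g) := by
  intro y
  rw [LinearMap.smul_apply, smul_eq_zero, or_iff_right ht, h y]
  constructor
  · rintro ⟨x, rfl⟩
    exact ⟨s⁻¹ • x, by rw [LinearMap.smul_apply, map_smul, smul_smul, mul_inv_cancel₀ hs, one_smul]⟩
  · rintro ⟨x, rfl⟩
    exact ⟨s • x, by rw [LinearMap.smul_apply, map_smul]⟩

/-- For a commutative first quadrant bicomplex with exact augmented rows and exact augmented
columns, the augmentation column and the augmentation row have the same cohomology. -/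
theorem nonempty_homology_iso (comm : ∀ i j x, dh i (j + 1) (dv i j x) = dv (i + 1) j (dh i j x))
    (A B : CochainComplex (ModuleCat.{v} k) ℕ)
    (α : ∀ j, A.X j →ₗ[k] X 0 j) (β : ∀ i, B.X i →ₗ[k] X i 0)
    (hαd : ∀ j a, dv 0 j (α j a) = α (j + 1) ((A.d j (j + 1)).hom a))
    (hβd : ∀ i b, dh i 0 (β i b) = β (i + 1) ((B.d i (i + 1)).hom b))
    (hα : ∀ j, Function.Injective (α j)) (hβ : ∀ i, Function.Injective (β i))
    (hrow0 : ∀ j, Function.Exact (α j) (dh 0 j))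
    (hrow : ∀ i j, Function.Exact (dh i j) (dh (i + 1) j))
    (hcol0 : ∀ i, Function.Exact (β i) (dv i 0))
    (hcol : ∀ i j, Function.Exact (dv i j) (dv i (j + 1))) (n : ℕ) :
    Nonempty (A.homology n ≅ B.homology n) := by
  let K : Bicomplex k := ofComm X dh dv (fun i j => (hrow i j).apply_apply_eq_zero)
    (fun i j => (hcol i j).apply_apply_eq_zero) comm
  have hs : ∀ i : ℕ, (-1 : k) ^ i ≠ 0 := fun i => pow_ne_zero _ (neg_ne_zero.2 one_ne_zero)
  obtain ⟨e₁⟩ := K.nonempty_homology_equiv_tot A α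
    (fun j a => by
      change ((-1 : k) ^ 0 • dv 0 j) (α j a) = _
      rw [pow_zero, one_smul, hαd]
      rfl)
    hα hrow0 hrow n
  -- After transposition the columns become rows. Their maps carry the signs introduced by `ofComm`,
  -- and rescaling by units does not affect exactness.
  obtain ⟨e₂⟩ := K.transpose.nonempty_homology_equiv_tot B β hβd hβ
    (fun i => by
      have := exact_smul (hcol0 i) 1 _ one_ne_zero (hs i)
      rw [one_smul] at this
      exact this)
    (fun i j => exact_smul (hcol j i) _ _ (hs j) (hs j)) n
  exact ⟨(e₁.trans ((K.totHomologyTranspose n).trans e₂.symm)).toModuleIso⟩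

end Bicomplex

/-! ### Relatively injective comodules and the cobar complex -/

section Cobar

variable {k : Type u} {D : Type v} [Field k] [AddCommGroup D] [Module k D] [Coalgebra k D]

section iterMap

variable {W W' W'' : Type v} [AddCommGroup W] [Module k W] [AddCommGroup W'] [Module k W']
  [AddCommGroup W''] [Module k W'']

variable (D) in
/-- Functoriality of `D^{⊗ n} ⊗ W` in `W`. -/
def iterMap (f : W →ₗ[k] W') : ∀ n, iterTensor (k := k) D W n →ₗ[k] iterTensor (k := k) D W' n
  | 0 => f
  | n + 1 => (iterMap f n).lTensor D

omit [Coalgebra k D] in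
lemma iterMap_exact {f : W →ₗ[k] W'} {g : W' →ₗ[k] W''} (h : Function.Exact f g) :
    ∀ n, Function.Exact (iterMap D f n) (iterMap D g n)
  | 0 => h
  | n + 1 => Module.Flat.lTensor_exact D (iterMap_exact h n)

omit [Coalgebra k D] in
lemma iterMap_injective {f : W →ₗ[k] W'} (h : Function.Injective f) :
    ∀ n, Function.Injective (iterMap D f n)
  | 0 => h
  | n + 1 => Module.Flat.lTensor_preserves_injective_linearMap _ (iterMap_injective h n)

lemma innerDiff_iterMap {l : W →ₗ[k] D ⊗[k] W} {l' : W' →ₗ[k] D ⊗[k] W'} (f : W →ₗ[k] W')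
    (h : l' ∘ₗ f = f.lTensor D ∘ₗ l) : ∀ n, innerDiff l' n ∘ₗ iterMap D f n =
      iterMap D f (n + 1) ∘ₗ innerDiff l n
  | 0 => h
  | n + 1 => by
    refine TensorProduct.ext' fun c x => ?_
    have ih := LinearMap.congr_fun (innerDiff_iterMap f h n) x
    simp only [LinearMap.comp_apply] at ih ⊢
    change innerDiff l' (n + 1) (c ⊗ₜ[k] iterMap D f n x) = _
    rw [innerDiff_tmul, innerDiff_tmul, ih, map_sub]
    congr 1
    induction Coalgebra.comul (R := k) c with
    | zero => simp
    | add p q hp hq => simp only [TensorProduct.add_tmul, map_add, hp, hq]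
    | tmul p q => rfl

end iterMap

lemma cobarDiff_tmul (V : RightComod k D) (W : LeftComod k D) (n : ℕ) (v : V)
    (x : iterTensor (k := k) D W n) : cobarDiff V W n (v ⊗ₜ[k] x) =
      TensorProduct.assoc k V D _ (V.coact v ⊗ₜ[k] x) - v ⊗ₜ[k] innerDiff W.coact n x := rfl

/-- Functoriality of the terms of the cobar complex. -/
def cobarMap (V : Type v) [AddCommGroup V] [Module k V] {W W' : LeftComod k D} (f : W.Hom W')
    (n : ℕ) : V ⊗[k] iterTensor (k := k) D W n →ₗ[k] V ⊗[k] iterTensor (k := k) D W' n :=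
  (iterMap D f.lin n).lTensor V

lemma cobarDiff_cobarMap (V : RightComod k D) {W W' : LeftComod k D} (f : W.Hom W') (n : ℕ)
    (y : V ⊗[k] iterTensor (k := k) D W n) :
    cobarDiff V W' n (cobarMap V f n y) = cobarMap V f (n + 1) (cobarDiff V W n y) := by
  induction y with
  | zero => simp only [map_zero]
  | add a b ha hb => simp only [map_add, ha, hb]
  | tmul v x =>
    have h := LinearMap.congr_fun (innerDiff_iterMap f.lin f.comm n) x
    simp only [LinearMap.comp_apply] at h
    change cobarDiff V W' n (v ⊗ₜ[k] iterMap D f.lin n x) = _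
    rw [cobarDiff_tmul, cobarDiff_tmul, h, map_sub]
    congr 1
    induction V.coact v with
    | zero => simp
    | add p q hp hq => simp only [TensorProduct.add_tmul, map_add, hp, hq]
    | tmul p q => rfl

/-- A left comodule is relatively injective if its coaction has a colinear retraction. -/
def LeftComod.RelInjective (W : LeftComod k D) : Prop :=
  ∃ r : D ⊗[k] W →ₗ[k] W, (∀ w, r (W.coact w) = w) ∧
    ∀ t, W.coact (r t) = r.lTensor D (leftStep W (Coalgebra.comul (R := k) (A := D)) t)

/-- The contraction of `D^{⊗ n} ⊗ W` induced by `r : D ⊗ W → W`. -/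
def iterContr {W : Type v} [AddCommGroup W] [Module k W] (r : D ⊗[k] W →ₗ[k] W) :
    ∀ n, iterTensor (k := k) D W (n + 1) →ₗ[k] iterTensor (k := k) D W n
  | 0 => r
  | n + 1 => -(iterContr r n).lTensor D

omit [Coalgebra k D] in
lemma iterContr_tmul {W : Type v} [AddCommGroup W] [Module k W] (r : D ⊗[k] W →ₗ[k] W) (n : ℕ)
    (c : D) (x : iterTensor (k := k) D W (n + 1)) :
    iterContr r (n + 1) (c ⊗ₜ[k] x) = -(c ⊗ₜ[k] iterContr r n x) := rfl

/-- A contracting homotopy in positive degrees. In degree one it is colinearity of `r` together with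
`r ∘ l = id`. Above that, the terms with `Δ` on the outer factor cancel because `iterContr` changes
sign with every factor it passes, and the rest is the previous degree. -/
lemma innerDiff_iterContr {W : Type v} [AddCommGroup W] [Module k W] (l : W →ₗ[k] D ⊗[k] W)
    (r : D ⊗[k] W →ₗ[k] W) (h1 : ∀ w, r (l w) = w)
    (h2 : ∀ t, l (r t) = r.lTensor D (leftStep W (Coalgebra.comul (R := k) (A := D)) t)) :
    ∀ (n : ℕ) (y : iterTensor (k := k) D W (n + 1)),
      innerDiff l n (iterContr r n y) + iterContr r (n + 1) (innerDiff l (n + 1) y) = y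
  | 0, y => by
    refine TensorProduct.induction_on y ?_ ?_ ?_
    · simp only [map_zero, add_zero]
    · intro c w
      rw [innerDiff_tmul, map_sub, iterContr_tmul]
      change l (r (c ⊗ₜ[k] w)) + (-r.lTensor D _ - -(c ⊗ₜ[k] r (l w))) = _
      rw [h1, h2, leftStep_tmul]
      abel
    · intro a b ha hb
      rw [map_add, map_add, map_add, map_add, add_add_add_comm, ha, hb]
  | n + 1, y => by
    refine TensorProduct.induction_on y ?_ ?_ ?_
    · simp only [map_zero, add_zero]
    · intro c x
      have ih := innerDiff_iterContr l r h1 h2 n x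
      have h3 : ∀ t : D ⊗[k] D, iterContr r (n + 2) (TensorProduct.assoc k D D _ (t ⊗ₜ[k] x)) =
          TensorProduct.assoc k D D _ (t ⊗ₜ[k] iterContr r n x) := by
        intro t
        induction t with
        | zero => simp
        | add p q hp hq => simp only [TensorProduct.add_tmul, map_add, hp, hq]
        | tmul p q =>
          rw [TensorProduct.assoc_tmul, TensorProduct.assoc_tmul, iterContr_tmul, iterContr_tmul,
            TensorProduct.tmul_neg, neg_neg]
      rw [innerDiff_tmul, map_sub, iterContr_tmul, iterContr_tmul, map_neg, innerDiff_tmul, h3,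
        neg_sub, sub_neg_eq_add, ← add_assoc, sub_add_cancel, ← TensorProduct.tmul_add, ih]
    · intro a b ha hb
      rw [map_add, map_add, map_add, map_add, add_add_add_comm, ha, hb]

/-- The coaction of `V` anticommutes with the contraction and drops out. The inner differential
enters `cobarDiff` with a minus sign, so the homotopy identity gives `-y`. -/
lemma cobarDiff_contr (V : RightComod k D) (W : LeftComod k D) (r : D ⊗[k] W →ₗ[k] W)
    (h1 : ∀ w, r (W.coact w) = w)
    (h2 : ∀ t, W.coact (r t) = r.lTensor D (leftStep W (Coalgebra.comul (R := k) (A := D)) t))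
    (n : ℕ) (y : V ⊗[k] iterTensor (k := k) D W (n + 1)) :
    cobarDiff V W n ((iterContr r n).lTensor V y) +
      (iterContr r (n + 1)).lTensor V (cobarDiff V W (n + 1) y) = -y := by
  induction y with
  | zero => simp only [map_zero, add_zero, neg_zero]
  | add a b ha hb => simp only [map_add]; rw [add_add_add_comm, ha, hb, neg_add]
  | tmul v x =>
    have ih := innerDiff_iterContr W.coact r h1 h2 n x
    have h3 : ∀ t : V ⊗[k] D, (iterContr r (n + 1)).lTensor V
        (TensorProduct.assoc k V D _ (t ⊗ₜ[k] x)) =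
        -TensorProduct.assoc k V D _ (t ⊗ₜ[k] iterContr r n x) := by
      intro t
      induction t with
      | zero => simp
      | add p q hp hq => simp only [TensorProduct.add_tmul, map_add, hp, hq, neg_add]
      | tmul p q =>
        rw [TensorProduct.assoc_tmul, TensorProduct.assoc_tmul, LinearMap.lTensor_tmul,
          iterContr_tmul, TensorProduct.tmul_neg]
    rw [LinearMap.lTensor_tmul, cobarDiff_tmul, cobarDiff_tmul, map_sub, h3,
      LinearMap.lTensor_tmul]
    conv_rhs => rw [← ih, TensorProduct.tmul_add]
    abel

lemma cobarDiff_exact (V : RightComod k D) {W : LeftComod k D} (hW : W.RelInjective) (n : ℕ) :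
    Function.Exact (cobarDiff V W n) (cobarDiff V W (n + 1)) := by
  obtain ⟨r, h1, h2⟩ := hW
  intro y
  constructor
  · intro hy
    have := cobarDiff_contr V W r h1 h2 n y
    rw [hy, map_zero, add_zero] at this
    exact ⟨-(iterContr r n).lTensor V y, by rw [map_neg, this, neg_neg]⟩
  · rintro ⟨x, rfl⟩
    exact cobarDiff_cobarDiff V W n x

lemma cotensor_exact (V : RightComod k D) (W : LeftComod k D) :
    Function.Exact (cotensor V W).subtype (cobarDiff V W 0) := by
  intro y
  constructor
  · intro hy; exact ⟨⟨y, hy⟩, rfl⟩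
  · rintro ⟨z, rfl⟩; exact z.2

/-! ### Cofree comodules -/

variable (D) in
/-- The cofree left comodule `D ⊗ M`. -/
abbrev LeftComod.cofree (M : Type v) [AddCommGroup M] [Module k M] : LeftComod k D where
  carrier := D ⊗[k] M
  coact := leftStep M Coalgebra.comul
  coassoc := LinearMap.ext (leftStep_coassoc _ (LinearMap.congr_fun Coalgebra.coassoc))
  counit_coact := LinearMap.ext
    (leftStep_counit _ (LinearMap.congr_fun (Bicomod.regular k D).counit_lcoact))

/-- Apply the counit to the first factor. -/
def counitLeft (M : Type v) [AddCommGroup M] [Module k M] : D ⊗[k] M →ₗ[k] M :=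
  (TensorProduct.lid k M).toLinearMap ∘ₗ (Coalgebra.counit (R := k) (A := D)).rTensor M

lemma counitLeft_tmul (M : Type v) [AddCommGroup M] [Module k M] (c : D) (m : M) :
    counitLeft M (c ⊗ₜ[k] m) = Coalgebra.counit (R := k) c • m := rfl

lemma counitLeft_comul (M : Type v) [AddCommGroup M] [Module k M] (t : D ⊗[k] M) :
    counitLeft (D ⊗[k] M) (leftStep M (Coalgebra.comul (R := k) (A := D)) t) = t :=
  LinearMap.congr_fun (LeftComod.cofree D M).counit_coact t

lemma lTensor_counitLeft_comul (M : Type v) [AddCommGroup M] [Module k M] (t : D ⊗[k] M) :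
    (counitLeft M).lTensor D (leftStep M (Coalgebra.comul (R := k) (A := D)) t) = t := by
  induction t with
  | zero => simp only [map_zero]
  | add a b ha hb => simp only [map_add, ha, hb]
  | tmul c m =>
    have hc := LinearMap.congr_fun (Bicomod.regular k D).counit_rcoact c
    simp only [LinearMap.comp_apply, LinearEquiv.coe_coe, LinearMap.id_apply] at hc
    conv_rhs => rw [← hc]
    rw [leftStep_tmul]
    induction Coalgebra.comul (R := k) c with
    | zero => simp
    | add p q hp hq => simp only [TensorProduct.add_tmul, map_add, hp, hq]
    | tmul p q => simp [counitLeft_tmul, TensorProduct.smul_tmul]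

/-- The retraction of `Δ ⊗ M` is `c ⊗ d ⊗ m ↦ ε(d) c ⊗ m`. Putting the counit on the inner factor
leaves the outer one to carry the coaction, which makes the map colinear. -/
lemma LeftComod.cofree_relInjective (M : Type v) [AddCommGroup M] [Module k M] :
    (LeftComod.cofree (k := k) D M).RelInjective := by
  refine ⟨(counitLeft M).lTensor D, lTensor_counitLeft_comul M, fun t => ?_⟩
  induction t with
  | zero => simp only [map_zero]
  | add a b ha hb => simp only [map_add, ha, hb]
  | tmul c t =>
    rw [LinearMap.lTensor_tmul, leftStep_tmul, leftStep_tmul]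
    induction Coalgebra.comul (R := k) c with
    | zero => simp
    | add p q hp hq => simp only [TensorProduct.add_tmul, map_add, hp, hq]
    | tmul p q => simp

end Cobar

/-! ### Comparison of the Hochschild complex and the cobar complex -/

lemma add_smul_sub_neg_one_pow {k : Type u} [Field k] {M : Type*} [AddCommGroup M] [Module k M]
    (n : ℕ) (a p q : M) : a + (-1 : k) ^ (n + 1) • (p - q) =
      a + (-1 : k) ^ (n + 1) • p + (-1 : k) ^ (n + 1 + 1) • q := by
  rw [pow_succ _ (n + 1), mul_neg_one, neg_smul, smul_sub]
  abel

section HochschildCobar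

variable {k : Type u} {C : Type v} [Field k] [AddCommGroup C] [Module k C] [Coalgebra k C]

/-- `((V ⊗ C) ⊗ ⋯) ⊗ C`, with `n` factors `C`. -/
abbrev iterTensorRight (V : RightComod k C) : ℕ → ModuleCat.{v} k
  | 0 => ModuleCat.of k V
  | n + 1 => ModuleCat.of k (iterTensorRight V n ⊗[k] C)

/-- The part of the cobar differential on `V ⊗ C^{⊗ n}` that does not involve the left comodule. -/
def innerDiffRight (V : RightComod k C) :
    ∀ n, iterTensorRight V n →ₗ[k] iterTensorRight V n ⊗[k] C
  | 0 => V.coact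
  | n + 1 => innerStep (innerDiffRight V n) ((-1) ^ (n + 1))

/-- `V' ⊗ (V'' ⊗ C^{⊗ n}) ≃ (V' ⊗ V'') ⊗ C^{⊗ n}`. -/
def hochEquiv (V' : LeftComod k C) (V'' : RightComod k C) :
    ∀ n, V' ⊗[k] iterTensorRight V'' n ≃ₗ[k] hochObj (tensorBicomod V' V'') n
  | 0 => LinearEquiv.refl k _
  | n + 1 => (TensorProduct.assoc k V' (iterTensorRight V'' n) C).symm.trans
      ((hochEquiv V' V'' n).rTensor C)

variable (V' : LeftComod k C) (V'' : RightComod k C)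

lemma hochEquiv_tmul (n : ℕ) (v : V') (y : iterTensorRight V'' n) (c : C) :
    hochEquiv V' V'' (n + 1) (v ⊗ₜ[k] (y ⊗ₜ[k] c)) = hochEquiv V' V'' n (v ⊗ₜ[k] y) ⊗ₜ[k] c := rfl

lemma hochInner_hochEquiv : ∀ (n : ℕ) (v : V') (y : iterTensorRight V'' n),
    hochInner (tensorBicomod V' V'') n (hochEquiv V' V'' n (v ⊗ₜ[k] y)) =
      hochEquiv V' V'' (n + 1) (v ⊗ₜ[k] innerDiffRight V'' n y)
  | 0, v, y => by
    change (TensorProduct.assoc k V' V'' C).symm (v ⊗ₜ[k] V''.coact y) =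
      hochEquiv V' V'' 1 (v ⊗ₜ[k] V''.coact y)
    exact (LinearMap.congr_fun TensorProduct.map_id _).symm
  | n + 1, v, y => by
    refine TensorProduct.induction_on y ?_ ?_ ?_
    · simp only [TensorProduct.tmul_zero, map_zero]
    · intro y c
      have ih := hochInner_hochEquiv n v y
      have h1 : ∀ t : iterTensorRight V'' n ⊗[k] C, hochEquiv V' V'' (n + 2)
          (v ⊗ₜ[k] (t ⊗ₜ[k] c)) = hochEquiv V' V'' (n + 1) (v ⊗ₜ[k] t) ⊗ₜ[k] c := fun t => rfl
      have h2 : ∀ t : C ⊗[k] C, hochEquiv V' V'' (n + 2) (v ⊗ₜ[k]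
          (TensorProduct.assoc k (iterTensorRight V'' n) C C).symm (y ⊗ₜ[k] t)) =
          (TensorProduct.assoc k (hochObj (tensorBicomod V' V'') n) C C).symm
            (hochEquiv V' V'' n (v ⊗ₜ[k] y) ⊗ₜ[k] t) := by
        intro t
        induction t with
        | zero => simp
        | add a b ha hb => simp only [TensorProduct.tmul_add, map_add, ha, hb]
        | tmul a b => rfl
      rw [hochEquiv_tmul]
      change innerStep _ _ (_ ⊗ₜ[k] c) = hochEquiv V' V'' (n + 2) (v ⊗ₜ[k] innerStep _ _ _)
      rw [innerStep_tmul, innerStep_tmul, ih, TensorProduct.tmul_add, map_add, h1,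
        TensorProduct.tmul_smul, map_smul, h2]
    · intro a b ha hb
      simp only [TensorProduct.tmul_add, map_add, ha, hb]

lemma hochLeft_hochEquiv : ∀ (n : ℕ) (v : V') (y : iterTensorRight V'' n),
    hochLeft (tensorBicomod V' V'') n (hochEquiv V' V'' n (v ⊗ₜ[k] y)) =
      (hochEquiv V' V'' n).toLinearMap.lTensor C
        (TensorProduct.assoc k C V' (iterTensorRight V'' n) (V'.coact v ⊗ₜ[k] y))
  | 0, v, y => by
    exact (LinearMap.congr_fun TensorProduct.map_id _).symm
  | n + 1, v, y => by
    refine TensorProduct.induction_on y ?_ ?_ ?_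
    · simp only [TensorProduct.tmul_zero, map_zero]
    · intro y c
      rw [hochEquiv_tmul]
      change leftStep _ _ _ = _
      rw [leftStep_tmul, hochLeft_hochEquiv n v y]
      induction V'.coact v with
      | zero => simp
      | add a b ha hb => simp only [TensorProduct.add_tmul, map_add, ha, hb]
      | tmul a b => rfl
    · intro a b ha hb
      simp only [TensorProduct.tmul_add, map_add, ha, hb]

/-- Only the wrap-around term of the Hochschild differential sees `V'`, since the right coaction of
`V' ⊗ V''` is that of `V''`. The other terms therefore act on `V'' ⊗ C^{⊗ n}` alone. -/
lemma hochDiff_hochEquiv (n : ℕ) (v : V') (y : iterTensorRight V'' n) :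
    hochDiff (tensorBicomod V' V'') n (hochEquiv V' V'' n (v ⊗ₜ[k] y)) =
      hochEquiv V' V'' (n + 1) (v ⊗ₜ[k] innerDiffRight V'' n y + (-1 : k) ^ (n + 1) •
        TensorProduct.comm k _ V' ((TensorProduct.assoc k (iterTensorRight V'' n) C V').symm
          (y ⊗ₜ[k] V'.coact v))) := by
  change hochInner _ n _ + (-1 : k) ^ (n + 1) • TensorProduct.comm k C _ (hochLeft _ n _) = _
  rw [hochInner_hochEquiv, hochLeft_hochEquiv, map_add, map_smul]
  congr 2
  induction V'.coact v with
  | zero => simp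
  | add a b ha hb =>
    simp only [TensorProduct.add_tmul, TensorProduct.tmul_add, map_add, ha, hb]
  | tmul a b => rfl

section

variable (C) in
/-- `C^{⊗ n} ⊗ (C ⊗ W) ≃ C^{⊗ n + 1} ⊗ W`. -/
def iterShift (W : Type v) [AddCommGroup W] [Module k W] :
    ∀ n, iterTensor (k := k) C (C ⊗[k] W) n ≃ₗ[k] iterTensor (k := k) C W (n + 1)
  | 0 => LinearEquiv.refl k _
  | n + 1 => (iterShift W n).lTensor C

lemma innerDiff_iterShift {W : Type v} [AddCommGroup W] [Module k W] (l : W →ₗ[k] C ⊗[k] W) :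
    ∀ (n : ℕ) (y : iterTensor (k := k) C (C ⊗[k] W) n),
      innerDiff l (n + 1) (iterShift C W n y) =
        iterShift C W (n + 1) (innerDiff (W := C ⊗[k] W) (innerDiff l 1) n y)
  | 0, y => by
    change innerDiff l 1 y = iterShift C W 1 (innerDiff l 1 y)
    have h : ∀ t : C ⊗[k] (C ⊗[k] W), iterShift C W 1 t = t := by
      intro t
      induction t with
      | zero => exact map_zero _
      | add a b ha hb => rw [map_add, ha, hb]
      | tmul a b => rfl
    exact (h _).symm
  | n + 1, y => by
    refine TensorProduct.induction_on y ?_ ?_ ?_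
    · simp only [map_zero]
    · intro c x
      have ih := innerDiff_iterShift l n x
      change innerDiff l (n + 2) (c ⊗ₜ[k] iterShift C W n x) = _
      rw [innerDiff_tmul, innerDiff_tmul, ih, map_sub]
      congr 1
      induction Coalgebra.comul (R := k) c with
      | zero => simp
      | add p q hp hq => simp only [TensorProduct.add_tmul, map_add, hp, hq]
      | tmul p q => rfl
    · intro a b ha hb
      simp only [map_add, ha, hb]

/-- `(V ⊗ C^{⊗ n}) ⊗ W ≃ V ⊗ (C^{⊗ n} ⊗ W)`. -/
def cobarEquiv (V : RightComod k C) : ∀ (n : ℕ) (W : Type v) [AddCommGroup W] [Module k W],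
    iterTensorRight V n ⊗[k] W ≃ₗ[k] V ⊗[k] iterTensor (k := k) C W n
  | 0, _, _, _ => LinearEquiv.refl k _
  | n + 1, W, _, _ => (TensorProduct.assoc k (iterTensorRight V n) C W).trans
      ((cobarEquiv V n (C ⊗[k] W)).trans ((iterShift C W n).lTensor V))

/-- The cobar differential for an arbitrary linear map `l : W → C ⊗ W`. -/
def preCobarDiff (V : RightComod k C) {W : Type v} [AddCommGroup W] [Module k W]
    (l : W →ₗ[k] C ⊗[k] W) (n : ℕ) :
    V ⊗[k] iterTensor (k := k) C W n →ₗ[k] V ⊗[k] iterTensor (k := k) C W (n + 1) :=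
  (TensorProduct.assoc k V C (iterTensor (k := k) C W n)).toLinearMap ∘ₗ
    V.coact.rTensor (iterTensor (k := k) C W n) - (innerDiff l n).lTensor V

lemma preCobarDiff_iterShift (V : RightComod k C) {W : Type v} [AddCommGroup W] [Module k W]
    (l : W →ₗ[k] C ⊗[k] W) (n : ℕ) (t : V ⊗[k] iterTensor (k := k) C (C ⊗[k] W) n) :
    preCobarDiff V l (n + 1) ((iterShift C W n).lTensor V t) =
      (iterShift C W (n + 1)).lTensor V
        (preCobarDiff V (W := C ⊗[k] W) (innerDiff l 1) n t) := by
  induction t with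
  | zero => simp only [map_zero]
  | add a b ha hb => simp only [map_add, ha, hb]
  | tmul v x =>
    have h := innerDiff_iterShift l n x
    change TensorProduct.assoc k V C _ (V.coact v ⊗ₜ[k] iterShift C W n x) -
      v ⊗ₜ[k] innerDiff l (n + 1) (iterShift C W n x) = (iterShift C W (n + 1)).lTensor V
        (TensorProduct.assoc k V C _ (V.coact v ⊗ₜ[k] x) -
          v ⊗ₜ[k] innerDiff (W := C ⊗[k] W) (innerDiff l 1) n x)
    rw [h, map_sub]
    congr 1
    induction V.coact v with
    | zero => simp
    | add p q hp hq => simp only [TensorProduct.add_tmul, map_add, hp, hq]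
    | tmul p q => rfl

/-- Rebracketing from left-nested to right-nested tensors, by absorbing the last factor `C` into
`W`. The induction replaces `l` by `innerDiff l 1` on `C ⊗ W`, which is not a coaction in general;
hence `W` and the linear map `l` are arbitrary in the statement. -/
lemma preCobarDiff_cobarEquiv (V : RightComod k C) :
    ∀ (n : ℕ) (W : Type v) [AddCommGroup W] [Module k W] (l : W →ₗ[k] C ⊗[k] W)
      (y : iterTensorRight V n) (w : W),
      preCobarDiff V l n (cobarEquiv V n W (y ⊗ₜ[k] w)) =
        cobarEquiv V (n + 1) W (innerDiffRight V n y ⊗ₜ[k] w + (-1 : k) ^ (n + 1) •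
          (TensorProduct.assoc k (iterTensorRight V n) C W).symm (y ⊗ₜ[k] l w))
  | 0, W, _, _, l, y, w => by
    have h : ∀ t : (V ⊗[k] C) ⊗[k] W, cobarEquiv V 1 W t = TensorProduct.assoc k V C W t := by
      intro t
      change (iterShift C W 0).lTensor V (TensorProduct.assoc k V C W t) = _
      induction TensorProduct.assoc k V C W t with
      | zero => exact map_zero _
      | add a b ha hb => rw [map_add, ha, hb]
      | tmul a b => rfl
    refine Eq.trans ?_ (h _).symm
    rw [map_add, map_smul, LinearEquiv.apply_symm_apply]
    have hs : ∀ x : V ⊗[k] (C ⊗[k] W), (-1 : k) ^ (0 + 1) • x = -x := fun x => by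
      rw [zero_add, pow_one, neg_one_smul]
    refine Eq.trans ?_ (congrArg₂ (· + ·) rfl (hs _).symm)
    rw [← sub_eq_add_neg]
    rfl
  | n + 1, W, _, _, l, y, w => by
    refine TensorProduct.induction_on y ?_ ?_ ?_
    · simp only [TensorProduct.zero_tmul, map_zero, smul_zero, add_zero]
    · intro y c
      have ih := preCobarDiff_cobarEquiv V n (C ⊗[k] W) (innerDiff l 1) y (c ⊗ₜ[k] w)
      have h0 : ∀ t : (iterTensorRight V n ⊗[k] C) ⊗[k] W, cobarEquiv V (n + 1) W t =
          (iterShift C W n).lTensor V (cobarEquiv V n (C ⊗[k] W)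
            (TensorProduct.assoc k (iterTensorRight V n) C W t)) := fun t => rfl
      have h0' : ∀ t : (iterTensorRight V (n + 1) ⊗[k] C) ⊗[k] W, cobarEquiv V (n + 2) W t =
          (iterShift C W (n + 1)).lTensor V (cobarEquiv V (n + 1) (C ⊗[k] W)
            (TensorProduct.assoc k (iterTensorRight V (n + 1)) C W t)) := fun t => rfl
      refine (congrArg _ (h0 _)).trans ((preCobarDiff_iterShift V l n _).trans ?_)
      rw [TensorProduct.assoc_tmul, ih]
      refine Eq.trans ?_ (h0' _).symm
      congr 2
      have e1 : ∀ t : C ⊗[k] C, (TensorProduct.assoc k (iterTensorRight V n) C (C ⊗[k] W)).symm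
          (y ⊗ₜ[k] TensorProduct.assoc k C C W (t ⊗ₜ[k] w)) =
          TensorProduct.assoc k (iterTensorRight V n ⊗[k] C) C W
            ((TensorProduct.assoc k (iterTensorRight V n) C C).symm (y ⊗ₜ[k] t) ⊗ₜ[k] w) := by
        intro t
        induction t with
        | zero => simp
        | add p q hp hq =>
          simp only [TensorProduct.add_tmul, TensorProduct.tmul_add, map_add, hp, hq]
        | tmul p q => rfl
      have e2 : ∀ t : C ⊗[k] W, (TensorProduct.assoc k (iterTensorRight V n) C (C ⊗[k] W)).symm
          (y ⊗ₜ[k] (c ⊗ₜ[k] t)) = (y ⊗ₜ[k] c) ⊗ₜ[k] t := fun t => rfl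
      have e3 : innerDiff l 1 (c ⊗ₜ[k] w) = TensorProduct.assoc k C C W
          (Coalgebra.comul (R := k) c ⊗ₜ[k] w) - c ⊗ₜ[k] l w := rfl
      have e4 : innerDiffRight V (n + 1) (y ⊗ₜ[k] c) = innerDiffRight V n y ⊗ₜ[k] c +
          (-1 : k) ^ (n + 1) • (TensorProduct.assoc k (iterTensorRight V n) C C).symm
            (y ⊗ₜ[k] Coalgebra.comul (R := k) c) := rfl
      rw [e3, e4, TensorProduct.tmul_sub, map_sub, e1, e2, TensorProduct.add_tmul, map_add, map_add,
        map_smul, LinearEquiv.apply_symm_apply, ← TensorProduct.smul_tmul', map_smul]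
      exact add_smul_sub_neg_one_pow n _ _ _
    · intro a b ha hb
      simp only [TensorProduct.add_tmul, map_add, ha, hb, smul_add]
      abel

end

/-- The term of degree `n` of the Hochschild complex of `V' ⊗ V''` is that of the cobar complex. -/
def hochCobarEquiv (n : ℕ) : hochObj (tensorBicomod V' V'') n ≃ₗ[k]
    V'' ⊗[k] iterTensor (k := k) C V' n :=
  (hochEquiv V' V'' n).symm.trans ((TensorProduct.comm k _ _).trans (cobarEquiv V'' n V'))

/-- Once `V'` is moved to the far right, the wrap-around term `v₍₀₎ ⊗ c¹ ⊗ ⋯ ⊗ cⁿ ⊗ v₍₋₁₎` becomes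
the last term of the cobar differential, with the same sign `(-1)^{n+1}`. -/
lemma cobarDiff_hochCobarEquiv (n : ℕ) (y : hochObj (tensorBicomod V' V'') n) :
    cobarDiff V'' V' n (hochCobarEquiv V' V'' n y) =
      hochCobarEquiv V' V'' (n + 1) (hochDiff (tensorBicomod V' V'') n y) := by
  obtain ⟨t, rfl⟩ := (hochEquiv V' V'' n).surjective y
  induction t with
  | zero => simp only [map_zero]
  | add a b ha hb => simp only [map_add, ha, hb]
  | tmul v y =>
    rw [hochDiff_hochEquiv]
    simp only [hochCobarEquiv, LinearEquiv.trans_apply, LinearEquiv.symm_apply_apply]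
    refine (preCobarDiff_cobarEquiv V'' n V' V'.coact y v).trans ?_
    congr 1
    rw [map_add, map_smul, TensorProduct.comm_tmul]
    congr 2
    exact ((TensorProduct.comm k _ _).symm_apply_apply _).symm

end HochschildCobar

/-! ### Change of coalgebras -/

section ChangeOfCoalgebra

variable {k : Type u} {D : Type v} [Field k] [AddCommGroup D] [Module k D] [Coalgebra k D]

lemma cobarComplex_d (V : RightComod k D) (W : LeftComod k D) (n : ℕ)
    (x : V ⊗[k] iterTensor (k := k) D W n) :
    ((cobarComplex V W).d n (n + 1)).hom x = cobarDiff V W n x :=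
  LinearMap.congr_fun (congrArg ModuleCat.Hom.hom (CochainComplex.of_d
    (fun n => ModuleCat.of k (V ⊗[k] iterTensor (k := k) D W n)) _ n)) x

/-! ### Subcomodules -/

section Subcomodule

variable (M : LeftComod k D) (N : Submodule k M)

lemma lTensor_subtype_injective : Function.Injective (N.subtype.lTensor D) :=
  Module.Flat.lTensor_preserves_injective_linearMap _ (Submodule.subtype_injective _)

/-- The coaction on a subspace that is stable under the coaction. -/
def subCoact (h : ∀ x : N, M.coact x ∈ LinearMap.range (N.subtype.lTensor D)) :
    N →ₗ[k] D ⊗[k] N :=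
  (LinearEquiv.ofInjective _ (lTensor_subtype_injective M N)).symm.toLinearMap ∘ₗ
    (M.coact ∘ₗ N.subtype).codRestrict _ h

lemma lTensor_subCoact (h : ∀ x : N, M.coact x ∈ LinearMap.range (N.subtype.lTensor D)) (x : N) :
    N.subtype.lTensor D (subCoact M N h x) = M.coact x :=
  congrArg Subtype.val (LinearEquiv.apply_symm_apply
    (LinearEquiv.ofInjective _ (lTensor_subtype_injective M N))
    ((M.coact ∘ₗ N.subtype).codRestrict _ h x))

/-- A subspace that is stable under the coaction, as a comodule. -/
abbrev LeftComod.sub (h : ∀ x : N, M.coact x ∈ LinearMap.range (N.subtype.lTensor D)) :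
    LeftComod k D where
  carrier := N
  coact := subCoact M N h
  coassoc := by
    ext1 x
    apply Module.Flat.lTensor_preserves_injective_linearMap (M := D) _
      (lTensor_subtype_injective M N)
    have hM := LinearMap.congr_fun M.coassoc x
    simp only [LinearMap.comp_apply, LinearEquiv.coe_coe] at hM ⊢
    have e1 : ∀ t : D ⊗[k] N, (N.subtype.lTensor D).lTensor D
        (TensorProduct.assoc k D D _ ((Coalgebra.comul (R := k) (A := D)).rTensor _ t)) =
        TensorProduct.assoc k D D _ ((Coalgebra.comul (R := k) (A := D)).rTensor _
          (N.subtype.lTensor D t)) := by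
      intro t
      induction t with
      | zero => simp
      | add a b ha hb => simp only [map_add, ha, hb]
      | tmul a b =>
        simp only [LinearMap.rTensor_tmul, LinearMap.lTensor_tmul]
        induction Coalgebra.comul (R := k) a with
        | zero => simp
        | add p q hp hq => simp only [TensorProduct.add_tmul, map_add, hp, hq]
        | tmul p q => simp
    have e2 : ∀ t : D ⊗[k] N, (N.subtype.lTensor D).lTensor D ((subCoact M N h).lTensor D t) =
        M.coact.lTensor D (N.subtype.lTensor D t) := by
      intro t
      induction t with
      | zero => simp
      | add a b ha hb => simp only [map_add, ha, hb]
      | tmul a b =>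
        simp only [LinearMap.lTensor_tmul, lTensor_subCoact, Submodule.subtype_apply]
    rw [e1, e2, lTensor_subCoact, hM]
  counit_coact := by
    ext1 x
    apply Submodule.subtype_injective N
    have hM := LinearMap.congr_fun M.counit_coact x
    simp only [LinearMap.comp_apply, LinearEquiv.coe_coe, LinearMap.id_apply] at hM ⊢
    have e1 : ∀ t : D ⊗[k] N, N.subtype
        (TensorProduct.lid k _ ((Coalgebra.counit (R := k) (A := D)).rTensor _ t)) =
        TensorProduct.lid k _ ((Coalgebra.counit (R := k) (A := D)).rTensor _
          (N.subtype.lTensor D t)) := by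
      intro t
      induction t with
      | zero => simp
      | add a b ha hb => simp only [map_add, ha, hb]
      | tmul a b => simp
    exact (e1 _).trans (by rw [lTensor_subCoact, hM]; rfl)

/-- The inclusion of a subcomodule. -/
def LeftComod.subIncl (h : ∀ x : N, M.coact x ∈ LinearMap.range (N.subtype.lTensor D)) :
    (LeftComod.sub M N h).Hom M where
  lin := N.subtype
  comm := LinearMap.ext fun x => (lTensor_subCoact M N h x).symm

end Subcomodule

/-! ### Cotensor products with cofree comodules -/

/-- The map `v ⊗ m ↦ v₍₀₎ ⊗ v₍₁₎ ⊗ m`. -/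
def coactLeft (V : RightComod k D) (M : Type v) [AddCommGroup M] [Module k M] :
    V ⊗[k] M →ₗ[k] V ⊗[k] (D ⊗[k] M) :=
  (TensorProduct.assoc k V D M).toLinearMap ∘ₗ V.coact.rTensor M

variable (V : RightComod k D) {M N : Type v} [AddCommGroup M] [Module k M] [AddCommGroup N]
  [Module k N]

lemma coactLeft_tmul (v : V) (m : M) :
    coactLeft V M (v ⊗ₜ[k] m) = TensorProduct.assoc k V D M (V.coact v ⊗ₜ[k] m) := rfl

lemma cobarDiff_eq (W : LeftComod k D) (n : ℕ) (t : V ⊗[k] iterTensor (k := k) D W n) :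
    cobarDiff V W n t = coactLeft V _ t - (innerDiff W.coact n).lTensor V t := rfl

lemma coactLeft_lTensor (f : M →ₗ[k] N) (t : V ⊗[k] M) :
    coactLeft V N (f.lTensor V t) = (f.lTensor D).lTensor V (coactLeft V M t) := by
  induction t with
  | zero => simp only [map_zero]
  | add a b ha hb => simp only [map_add, ha, hb]
  | tmul v m =>
    rw [LinearMap.lTensor_tmul, coactLeft_tmul, coactLeft_tmul]
    induction V.coact v with
    | zero => simp
    | add p q hp hq => simp only [TensorProduct.add_tmul, map_add, hp, hq]
    | tmul p q => rfl

lemma coactLeft_coactLeft (t : V ⊗[k] M) : coactLeft V (D ⊗[k] M) (coactLeft V M t) =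
    (leftStep M (Coalgebra.comul (R := k) (A := D))).lTensor V (coactLeft V M t) := by
  induction t with
  | zero => simp only [map_zero]
  | add a b ha hb => simp only [map_add, ha, hb]
  | tmul v m =>
    have hc := LinearMap.congr_fun V.coassoc v
    simp only [LinearMap.comp_apply, LinearEquiv.coe_coe] at hc
    -- `G` appends `m` as last factor; both sides are `G` applied to the two sides of
    -- coassociativity of `V`.
    let G : V ⊗[k] (D ⊗[k] D) →ₗ[k] V ⊗[k] (D ⊗[k] (D ⊗[k] M)) :=
      (((TensorProduct.mk k D M).flip m).lTensor D).lTensor V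
    have e1 : ∀ t : V ⊗[k] D, coactLeft V (D ⊗[k] M) (TensorProduct.assoc k V D M (t ⊗ₜ[k] m)) =
        G (TensorProduct.assoc k V D D (V.coact.rTensor D t)) := by
      intro t
      induction t with
      | zero => simp
      | add p q hp hq => simp only [TensorProduct.add_tmul, map_add, hp, hq]
      | tmul p q =>
        rw [TensorProduct.assoc_tmul, coactLeft_tmul, LinearMap.rTensor_tmul]
        induction V.coact p with
        | zero => simp
        | add p q hp hq => simp only [TensorProduct.add_tmul, map_add, hp, hq]
        | tmul p q => rfl
    have e2 : ∀ t : V ⊗[k] D, (leftStep M (Coalgebra.comul (R := k) (A := D))).lTensor V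
        (TensorProduct.assoc k V D M (t ⊗ₜ[k] m)) =
        G ((Coalgebra.comul (R := k) (A := D)).lTensor V t) := by
      intro t
      induction t with
      | zero => simp
      | add p q hp hq => simp only [TensorProduct.add_tmul, map_add, hp, hq]
      | tmul p q =>
        rw [TensorProduct.assoc_tmul, LinearMap.lTensor_tmul, LinearMap.lTensor_tmul, leftStep_tmul]
        induction Coalgebra.comul (R := k) q with
        | zero => simp
        | add p q hp hq =>
          simp only [TensorProduct.add_tmul, TensorProduct.tmul_add, map_add, hp, hq]
        | tmul p q => rfl
    rw [coactLeft_tmul, e1, e2, hc]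

lemma lTensor_counitLeft_coactLeft (t : V ⊗[k] M) :
    (counitLeft M).lTensor V (coactLeft V M t) = t := by
  induction t with
  | zero => simp only [map_zero]
  | add a b ha hb => simp only [map_add, ha, hb]
  | tmul v m =>
    have hc := LinearMap.congr_fun V.counit_coact v
    simp only [LinearMap.comp_apply, LinearEquiv.coe_coe, LinearMap.id_apply] at hc
    conv_rhs => rw [← hc]
    rw [coactLeft_tmul]
    induction V.coact v with
    | zero => simp
    | add p q hp hq => simp only [TensorProduct.add_tmul, map_add, hp, hq]
    | tmul p q => simp [counitLeft_tmul, TensorProduct.smul_tmul]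

lemma coactLeft_injective : Function.Injective (coactLeft V M) :=
  Function.LeftInverse.injective (lTensor_counitLeft_coactLeft V)

/-- With injectivity of `coactLeft`, this is the isomorphism `V ⊗ M ≅ V □_D (D ⊗ M)`. The counit on
`D` gives the inverse: applied to the cotensor equation, it recovers `y` from its image. -/
lemma coactLeft_exact :
    Function.Exact (coactLeft V M) (cobarDiff V (LeftComod.cofree (k := k) D M) 0) := by
  intro y
  rw [cobarDiff_eq, sub_eq_zero]
  change coactLeft V (D ⊗[k] M) y = (leftStep M Coalgebra.comul).lTensor V y ↔ _
  constructor
  · intro h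
    refine ⟨(counitLeft M).lTensor V y, ?_⟩
    rw [coactLeft_lTensor, h, ← LinearMap.comp_apply, ← LinearMap.lTensor_comp]
    have : (counitLeft M).lTensor D ∘ₗ leftStep M (Coalgebra.comul (R := k) (A := D)) =
        LinearMap.id := LinearMap.ext (lTensor_counitLeft_comul M)
    rw [this, LinearMap.lTensor_id, LinearMap.id_apply]
  · rintro ⟨t, rfl⟩
    exact coactLeft_coactLeft V t

/-- The cobar differential corresponds to the differential of the cobar resolution of the left
comodule under the identification of `V ⊗ M` with `V □ (D ⊗ M)`. -/
lemma coactLeft_cobarDiff (W : LeftComod k D) (n : ℕ) (t : V ⊗[k] iterTensor (k := k) D W n) :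
    coactLeft V (iterTensor (k := k) D W (n + 1)) (cobarDiff V W n t) =
      (innerDiff W.coact (n + 1)).lTensor V (coactLeft V _ t) := by
  have h : innerDiff W.coact (n + 1) = leftStep (iterTensor (k := k) D W n) Coalgebra.comul -
      (innerDiff W.coact n).lTensor D := rfl
  rw [cobarDiff_eq, map_sub, h, LinearMap.lTensor_sub, LinearMap.sub_apply]
  exact congrArg₂ (· - ·) (coactLeft_coactLeft V t) (coactLeft_lTensor V _ t)

/-- The counit on the outer factor contracts the cobar resolution of `W`: it is a left inverse of
the `Δ` term and commutes with the remaining terms. The contraction is only `k`-linear. -/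
lemma innerDiff_exact (W : LeftComod k D) (n : ℕ) :
    Function.Exact (innerDiff W.coact n) (innerDiff W.coact (n + 1)) := by
  intro y
  constructor
  · intro hy
    refine ⟨counitLeft (iterTensor (k := k) D W n) y, ?_⟩
    have h1 : ∀ y : D ⊗[k] iterTensor (k := k) D W n,
        counitLeft (iterTensor (k := k) D W (n + 1)) ((innerDiff W.coact n).lTensor D y) =
          innerDiff W.coact n (counitLeft _ y) := by
      intro y
      induction y with
      | zero => simp only [map_zero]
      | add a b ha hb => simp only [map_add, ha, hb]
      | tmul c x => rw [LinearMap.lTensor_tmul, counitLeft_tmul, counitLeft_tmul, map_smul]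
    have h2 := congrArg (counitLeft (iterTensor (k := k) D W (n + 1))) hy
    have h3 : innerDiff W.coact (n + 1) y =
      leftStep (iterTensor (k := k) D W n) Coalgebra.comul y -
        (innerDiff W.coact n).lTensor D y := rfl
    rw [h3, map_sub, map_zero, h1, sub_eq_zero] at h2
    exact h2.symm.trans (counitLeft_comul _ y)
  · rintro ⟨x, rfl⟩
    exact innerDiff_innerDiff _ (fun w => LinearMap.congr_fun W.coassoc w) n x

/-- The differential of the cobar resolution, as a morphism of comodules. -/
def innerDiffHom (W : LeftComod k D) (n : ℕ) :
    (LeftComod.cofree (k := k) D (iterTensor (k := k) D W n)).Hom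
      (LeftComod.cofree D (iterTensor (k := k) D W (n + 1))) where
  lin := innerDiff W.coact (n + 1)
  comm := LinearMap.ext fun t => coactLeft_cobarDiff (Bicomod.regular k D).right W n t

/-- Under `V ⊗ M ≅ V □_D (D ⊗ M)` the cobar complex is `V □_D` applied to the cobar resolution of
`W`, an exact sequence of cofree comodules, so coflatness of `V` applies. -/
lemma cobarDiff_exact_of_coflat (hV : V.Coflat) (W : LeftComod k D) (n : ℕ) :
    Function.Exact (cobarDiff V W n) (cobarDiff V W (n + 1)) := by
  intro z
  constructor
  · intro hz
    have hmem : coactLeft V _ z ∈ cotensor V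
        (LeftComod.cofree D (iterTensor (k := k) D W (n + 1))) :=
      mem_cotensor.2 (coactLeft_coactLeft V z)
    obtain ⟨⟨w, hw⟩, hwz⟩ := (hV _ _ _ (innerDiffHom W n) (innerDiffHom W (n + 1))
      (innerDiff_exact W (n + 1)) ⟨_, hmem⟩).1 (Subtype.ext (by
        refine (coactLeft_cobarDiff V W (n + 1) z).symm.trans ?_
        rw [hz, map_zero]
        rfl))
    obtain ⟨x, rfl⟩ := (coactLeft_exact V _).1 hw
    refine ⟨x, coactLeft_injective V ?_⟩
    exact (coactLeft_cobarDiff V W n x).trans (congrArg Subtype.val hwz)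
  · rintro ⟨x, rfl⟩
    exact cobarDiff_cobarDiff V W n x

/-! ### Comparison along `π` -/

variable {C : Type v} [AddCommGroup C] [Module k C] [Coalgebra k C] (π : C →ₗc[k] D)

lemma cobarDiff_corestrict (V : RightComod k C) (X : LeftComod k D) (n : ℕ)
    (t : V ⊗[k] iterTensor (k := k) D X n) :
    cobarDiff (V.corestrict π) X n t =
      ((π : C →ₗ[k] D).rTensor _).lTensor V (coactLeft V _ t) -
        (innerDiff X.coact n).lTensor V t := by
  rw [cobarDiff_eq]
  congr 1
  induction t with
  | zero => simp only [map_zero]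
  | add a b ha hb => simp only [map_add, ha, hb]
  | tmul v m =>
    rw [coactLeft_tmul, coactLeft_tmul]
    change TensorProduct.assoc k V D _ ((π : C →ₗ[k] D).lTensor V (V.coact v) ⊗ₜ[k] m) = _
    induction V.coact v with
    | zero => simp
    | add p q hp hq => simp only [TensorProduct.add_tmul, map_add, hp, hq]
    | tmul p q => rfl

/-- By coassociativity, the coaction of `V` over `C` carries the `D`-cobar differential with
coefficients in `V` to the one with coefficients in `C`. For `V = C` this is colinearity of the
differential; for general `V` it makes the coaction a map of complexes. -/
lemma coactLeft_cobarDiff_corestrict (V : RightComod k C) (X : LeftComod k D) (n : ℕ)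
    (t : V ⊗[k] iterTensor (k := k) D X n) :
    coactLeft V _ (cobarDiff (V.corestrict π) X n t) =
      (cobarDiff ((Bicomod.regular k C).corestrict π).right X n).lTensor V (coactLeft V _ t) := by
  have h : cobarDiff ((Bicomod.regular k C).corestrict π).right X n =
      ((π : C →ₗ[k] D).rTensor _).lTensor C ∘ₗ leftStep _ (Coalgebra.comul (R := k) (A := C)) -
        (innerDiff X.coact n).lTensor C :=
    LinearMap.ext fun t => cobarDiff_corestrict π (Bicomod.regular k C).right X n t
  rw [cobarDiff_corestrict, map_sub, h, LinearMap.lTensor_sub, LinearMap.sub_apply,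
    LinearMap.lTensor_comp, LinearMap.comp_apply, ← coactLeft_coactLeft, ← coactLeft_lTensor,
    ← coactLeft_lTensor]

/-- The cobar differential for the right `D`-comodule `C` is a morphism of left `C`-comodules. -/
def cobarDiffHom (X : LeftComod k D) (n : ℕ) :
    (LeftComod.cofree (k := k) C (iterTensor (k := k) D X n)).Hom
      (LeftComod.cofree C (iterTensor (k := k) D X (n + 1))) where
  lin := cobarDiff ((Bicomod.regular k C).corestrict π).right X n
  comm := LinearMap.ext fun t =>
    coactLeft_cobarDiff_corestrict π (Bicomod.regular k C).right X n t

/-- `C □_D X` is the kernel of a morphism of left `C`-comodules, and `C ⊗ -` preserves kernels over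
a field. -/
lemma cofree_coact_mem (X : LeftComod k D)
    (x : cotensor ((Bicomod.regular k C).corestrict π).right X) :
    (LeftComod.cofree C X).coact x ∈ LinearMap.range
      ((cotensor ((Bicomod.regular k C).corestrict π).right X).subtype.lTensor C) := by
  refine (Module.Flat.lTensor_exact C
    (cotensor_exact ((Bicomod.regular k C).corestrict π).right X) _).1 ?_
  have h := LinearMap.congr_fun (cobarDiffHom π X 0).comm x
  refine h.symm.trans ?_
  have h0 : (cobarDiffHom π X 0).lin x = 0 := x.2
  rw [LinearMap.comp_apply, h0, map_zero]

/-- The cotensor product `C □_D X` as a left `C`-comodule. -/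
abbrev coinduced (X : LeftComod k D) : LeftComod k C :=
  LeftComod.sub (LeftComod.cofree C X) (cotensor ((Bicomod.regular k C).corestrict π).right X)
    (cofree_coact_mem π X)

/-- Change of coalgebras: the cobar complexes of `C □_D X` over `C` and of `X` over `D` have the
same cohomology if `C` is coflat as a right `D`-comodule. -/
theorem nonempty_cobar_coinduced_iso (V : RightComod k C) (X : LeftComod k D)
    (hC : ((Bicomod.regular k C).corestrict π).right.Coflat) (n : ℕ) :
    Nonempty ((cobarComplex V (coinduced π X)).homology n ≅
      (cobarComplex (V.corestrict π) X).homology n) :=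
  Bicomplex.nonempty_homology_iso
    -- Horizontally (index `i`) stands the cobar complex over `D` of `C` and `X`, augmented by `C
    -- □_D X`. Vertically (index `j`) stands the cobar complex over `C` of the cofree comodules `C ⊗
    -- D^{⊗ i} ⊗ X`, augmented by `V ⊗ D^{⊗ i} ⊗ X`.
    (fun i j => ModuleCat.of k
      (V ⊗[k] iterTensor (k := k) C (C ⊗[k] iterTensor (k := k) D X i) j))
    (fun i j => cobarMap V (cobarDiffHom π X i) j)
    (fun i j => cobarDiff V (LeftComod.cofree C (iterTensor (k := k) D X i)) j)
    (fun i j x => (cobarDiff_cobarMap V (cobarDiffHom π X i) j x).symm)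
    (cobarComplex V (coinduced π X)) (cobarComplex (V.corestrict π) X)
    (fun j => cobarMap V (LeftComod.subIncl _ _ (cofree_coact_mem π X)) j)
    (fun i => coactLeft V (iterTensor (k := k) D X i))
    (fun j a => (cobarDiff_cobarMap V (LeftComod.subIncl _ _ (cofree_coact_mem π X)) j a).trans
      (congrArg (cobarMap V (LeftComod.subIncl _ _ (cofree_coact_mem π X)) (j + 1))
        (cobarComplex_d V (coinduced π X) j a).symm))
    (fun i b => (coactLeft_cobarDiff_corestrict π V X i b).symm.trans
      (congrArg (coactLeft V (iterTensor (k := k) D X (i + 1)))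
        (cobarComplex_d (V.corestrict π) X i b).symm))
    (fun j => Module.Flat.lTensor_preserves_injective_linearMap _
      (iterMap_injective (Submodule.subtype_injective _) j))
    (fun _ => coactLeft_injective V)
    (fun j => Module.Flat.lTensor_exact V (iterMap_exact
      (cotensor_exact ((Bicomod.regular k C).corestrict π).right X) j))
    -- Exactness of the rows in positive degrees is the only place that needs coflatness.
    (fun i j => Module.Flat.lTensor_exact V
      (iterMap_exact (cobarDiff_exact_of_coflat _ hC X i) j))
    (fun _ => coactLeft_exact V)
    (fun _ j => cobarDiff_exact V (LeftComod.cofree_relInjective _) j)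
    n

end ChangeOfCoalgebra

/-! ### The relative cobar resolution -/

section RelativeResolution

variable {k : Type u} {C D : Type v} [Field k] [AddCommGroup C] [Module k C] [Coalgebra k C]
  [AddCommGroup D] [Module k D] [Coalgebra k D]

/-- The difference of two morphisms of left comodules. -/
def LeftComod.Hom.sub {M N : LeftComod k C} (f g : M.Hom N) : M.Hom N where
  lin := f.lin - g.lin
  comm := by
    rw [LinearMap.comp_sub, f.comm, g.comm, LinearMap.lTensor_sub, LinearMap.sub_comp]

/-- A morphism of `C`-comodules as a morphism of `D`-comodules. -/
def LeftComod.Hom.corestrict (π : C →ₗc[k] D) {M N : LeftComod k C} (f : M.Hom N) :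
    (M.corestrict π).Hom (N.corestrict π) where
  lin := f.lin
  comm := by
    ext1 x
    have h := LinearMap.congr_fun f.comm x
    simp only [LinearMap.comp_apply] at h ⊢
    rw [h]
    induction M.coact x with
    | zero => simp
    | add a b ha hb => simp only [map_add, ha, hb]
    | tmul a b => simp

variable (π : C →ₗc[k] D)

/-- `C □_D N` for a left `C`-comodule `N`. -/
abbrev relCofree (N : LeftComod k C) : LeftComod k C := coinduced π (N.corestrict π)

/-- Corestriction of a morphism of comodules to a subcomodule. -/
def LeftComod.Hom.codRestrict {M M' : LeftComod k C} (f : M.Hom M') (N : Submodule k M')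
    (h : ∀ x : N, M'.coact x ∈ LinearMap.range (N.subtype.lTensor C)) (hf : ∀ x, f.lin x ∈ N) :
    M.Hom (M'.sub N h) where
  lin := f.lin.codRestrict N hf
  comm := by
    ext1 x
    apply lTensor_subtype_injective M' N
    have h1 := LinearMap.congr_fun f.comm x
    simp only [LinearMap.comp_apply] at h1 ⊢
    rw [lTensor_subCoact, ← LinearMap.lTensor_comp_apply]
    exact h1

/-- Composition of morphisms of comodules. -/
def LeftComod.Hom.comp {M N P : LeftComod k C} (g : N.Hom P) (f : M.Hom N) : M.Hom P where
  lin := g.lin ∘ₗ f.lin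
  comm := by
    rw [← LinearMap.comp_assoc, g.comm, LinearMap.comp_assoc, f.comm, LinearMap.lTensor_comp,
      LinearMap.comp_assoc]

/-- The morphism of cofree comodules induced by a linear map. -/
def LeftComod.cofreeMap {M N : Type v} [AddCommGroup M] [Module k M] [AddCommGroup N]
    [Module k N] (f : M →ₗ[k] N) : (LeftComod.cofree (k := k) C M).Hom (LeftComod.cofree C N) where
  lin := f.lTensor C
  comm := LinearMap.ext fun t => coactLeft_lTensor (Bicomod.regular k C).right f t

/-- The inclusion of `C □_D N` into `C ⊗ N`. -/
def relIncl (N : LeftComod k C) : (relCofree π N).Hom (LeftComod.cofree C N) :=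
  LeftComod.subIncl (LeftComod.cofree C N)
    (cotensor ((Bicomod.regular k C).corestrict π).right (N.corestrict π))
    (cofree_coact_mem π (N.corestrict π))

lemma cofreeMap_relIncl_mem {N N' : LeftComod k C} (f : N.Hom N') (x : relCofree π N) :
    ((LeftComod.cofreeMap f.lin).comp (relIncl π N)).lin x ∈
      cotensor ((Bicomod.regular k C).corestrict π).right (N'.corestrict π) :=
  map_mem_cotensor (V := ((Bicomod.regular k C).corestrict π).right)
    (V' := ((Bicomod.regular k C).corestrict π).right) (W := N.corestrict π)
    (W' := N'.corestrict π) (RightComod.Hom.id _) (f.corestrict π) x.1 x.2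

/-- Functoriality of `C □_D N`. -/
def relCofreeMap {N N' : LeftComod k C} (f : N.Hom N') :
    (relCofree π N).Hom (relCofree π N') :=
  LeftComod.Hom.codRestrict ((LeftComod.cofreeMap f.lin).comp (relIncl π N))
    (cotensor ((Bicomod.regular k C).corestrict π).right (N'.corestrict π))
    (cofree_coact_mem π (N'.corestrict π)) (cofreeMap_relIncl_mem π f)

/-- Coassociativity over `C`, with `π` applied to the middle factor. -/
lemma coact_mem_cotensor (N : LeftComod k C) (x : N) :
    N.coact x ∈ cotensor ((Bicomod.regular k C).corestrict π).right (N.corestrict π) := by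
  change cobarDiff ((Bicomod.regular k C).right.corestrict π) (N.corestrict π) 0 (N.coact x) = 0
  rw [cobarDiff_corestrict]
  have h1 : coactLeft (Bicomod.regular k C).right N (N.coact x) = N.coact.lTensor C (N.coact x) :=
    LinearMap.congr_fun N.coassoc x
  refine sub_eq_zero.2 ((congrArg _ h1).trans ?_)
  exact (LinearMap.lTensor_comp_apply C _ _ _).symm

/-- The coaction `N → C □_D N`. -/
def relUnit (N : LeftComod k C) : N.Hom (relCofree π N) :=
  LeftComod.Hom.codRestrict (M' := LeftComod.cofree C N) ⟨N.coact, N.coassoc⟩ _ _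
    (coact_mem_cotensor π N)

/-- The linear map `ε ⊗ N : C □_D N → N`. -/
def relCounit (N : LeftComod k C) : relCofree π N →ₗ[k] N :=
  counitLeft N ∘ₗ
    (cotensor ((Bicomod.regular k C).corestrict π).right (N.corestrict π)).subtype

lemma relCounit_relUnit (N : LeftComod k C) (x : N) :
    relCounit π N ((relUnit π N).lin x) = x := LinearMap.congr_fun N.counit_coact x

/-- Together with `relCounit_relUnit`, this is what makes the counit contract the relative
resolution. -/
lemma relCounit_relCofreeMap {N N' : LeftComod k C} (f : N.Hom N') (x : relCofree π N) :
    relCounit π N' ((relCofreeMap π f).lin x) = f.lin (relCounit π N x) := by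
  suffices ∀ t : C ⊗[k] N, counitLeft N' (f.lin.lTensor C t) = f.lin (counitLeft N t) from
    this x.1
  intro t
  induction t with
  | zero => simp only [map_zero]
  | add a b ha hb => simp only [map_add, ha, hb]
  | tmul a b =>
    rw [LinearMap.lTensor_tmul, counitLeft_tmul]
    exact (map_smul f.lin _ _).symm

lemma relUnit_naturality {N N' : LeftComod k C} (f : N.Hom N') (x : N) :
    (relUnit π N').lin (f.lin x) = (relCofreeMap π f).lin ((relUnit π N).lin x) :=
  Subtype.ext (LinearMap.congr_fun f.comm x)

lemma relCofreeMap_eq_zero {N N' N'' : LeftComod k C} (f : N.Hom N') (g : N'.Hom N'')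
    (h : ∀ x, g.lin (f.lin x) = 0) (x : relCofree π N) :
    (relCofreeMap π g).lin ((relCofreeMap π f).lin x) = 0 := by
  apply Subtype.ext
  suffices ∀ t : C ⊗[k] N, g.lin.lTensor C (f.lin.lTensor C t) = 0 from this x.1
  intro t
  induction t with
  | zero => simp only [map_zero]
  | add a b ha hb => rw [map_add, map_add, ha, hb, add_zero]
  | tmul a b => rw [LinearMap.lTensor_tmul, LinearMap.lTensor_tmul, h, TensorProduct.tmul_zero]

/-- The `C`-comodules `C □_D (C □_D ⋯ (C □_D N))`. -/
def relResolution (N : LeftComod k C) : ℕ → LeftComod k C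
  | 0 => N
  | i + 1 => relCofree π (relResolution N i)

/-- The differentials of the relative cobar resolution of `N`, starting with the augmentation. -/
def relDiff (N : LeftComod k C) : ∀ i, (relResolution π N i).Hom (relResolution π N (i + 1))
  | 0 => relUnit π N
  | i + 1 => (relUnit π (relResolution π N (i + 1))).sub (relCofreeMap π (relDiff N i))

lemma relDiff_succ (N : LeftComod k C) (i : ℕ) (x : relResolution π N (i + 1)) :
    (relDiff π N (i + 1)).lin x = (relUnit π (relResolution π N (i + 1))).lin x -
      (relCofreeMap π (relDiff π N i)).lin x := rfl

/-- Naturality of the unit turns `d d x` into `(C □ d)(u x) - (C □ d)(u x - (C □ d) x)`, which is `C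
□_D -` applied to the preceding composite of differentials. -/
lemma relDiff_relDiff (N : LeftComod k C) : ∀ (i : ℕ) (x : relResolution π N i),
    (relDiff π N (i + 1)).lin ((relDiff π N i).lin x) = 0
  | 0, x => by
    rw [relDiff_succ, relUnit_naturality]
    exact sub_self _
  | i + 1, x => by
    have h := relCofreeMap_eq_zero π (relDiff π N i) (relDiff π N (i + 1))
      (relDiff_relDiff N i) x
    rw [relDiff_succ, relUnit_naturality]
    refine (map_sub (relCofreeMap π (relDiff π N (i + 1))).lin _ _).symm.trans
      (Eq.trans (congrArg _ ?_) h)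
    exact sub_sub_cancel _ _

/-- If `d x = 0` then `u x = (C □ d) x`. Applying the counit `ε` gives `x = d (ε x)`, an explicit
preimage. -/
lemma relDiff_exact (N : LeftComod k C) (i : ℕ) :
    Function.Exact (relDiff π N i).lin (relDiff π N (i + 1)).lin := by
  intro x
  constructor
  · intro hx
    refine ⟨relCounit π (relResolution π N i) x, ?_⟩
    have h : (relUnit π (relResolution π N (i + 1))).lin x =
      (relCofreeMap π (relDiff π N i)).lin x := sub_eq_zero.1 hx
    exact ((relCounit_relCofreeMap π (relDiff π N i) x).symm.trans
      (congrArg (relCounit π (relResolution π N (i + 1))) h.symm)).trans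
      (relCounit_relUnit π _ x)
  · rintro ⟨y, rfl⟩
    exact relDiff_relDiff π N i y

lemma relUnit_injective (N : LeftComod k C) : Function.Injective (relUnit π N).lin :=
  Function.LeftInverse.injective (relCounit_relUnit π N)

lemma LeftComod.mk_congr {N : Type v} [AddCommGroup N] [Module k N] {c c' : N →ₗ[k] D ⊗[k] N}
    (h : c = c') {h1 h2 h1' h2'} :
    (LeftComod.mk N c h1 h2 : LeftComod k D) = LeftComod.mk N c' h1' h2' := by
  subst h
  rfl

/-- Both coactions restrict `c ⊗ x ↦ π(c₍₁₎) ⊗ c₍₂₎ ⊗ x`. The comodules are equal and not merely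
isomorphic, so the iterated cotensor product over `D` can be rewritten inside the cobar complex. -/
lemma leftCotensor_eq_corestrict_coinduced (X : LeftComod k D) :
    leftCotensor ((Bicomod.regular k C).corestrict π) X = (coinduced π X).corestrict π := by
  refine LeftComod.mk_congr (LinearMap.ext fun x => ?_)
  apply lTensor_incl_injective ((Bicomod.regular k C).corestrict π) X D
  refine (lTensor_incl_cotensorCoact _ X x).trans ?_
  have e1 : ∀ t : C ⊗[k] cotensor ((Bicomod.regular k C).corestrict π).right X,
      (cotensorIncl ((Bicomod.regular k C).corestrict π) X).lTensor D
        ((π : C →ₗ[k] D).rTensor _ t) = (π : C →ₗ[k] D).rTensor _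
      ((cotensorIncl ((Bicomod.regular k C).corestrict π) X).lTensor C t) := by
    intro t
    induction t with
    | zero => simp only [map_zero]
    | add a b ha hb => simp only [map_add, ha, hb]
    | tmul a b => rfl
  refine Eq.trans ?_ (e1 _).symm
  have e2 := lTensor_subCoact (LeftComod.cofree C X)
    (cotensor ((Bicomod.regular k C).corestrict π).right X) (cofree_coact_mem π X) x
  refine Eq.trans ?_ (congrArg ((π : C →ₗ[k] D).rTensor (C ⊗[k] X)) e2).symm
  change leftStep X ((π : C →ₗ[k] D).rTensor C ∘ₗ Coalgebra.comul) x.1 =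
    (π : C →ₗ[k] D).rTensor (C ⊗[k] X) (leftStep X Coalgebra.comul x.1)
  induction x.1 with
  | zero => simp only [map_zero]
  | add a b ha hb => simp only [map_add, ha, hb]
  | tmul a b =>
    rw [leftStep_tmul, leftStep_tmul, LinearMap.comp_apply]
    induction Coalgebra.comul (R := k) a with
    | zero => simp
    | add p q hp hq => simp only [TensorProduct.add_tmul, map_add, hp, hq]
    | tmul p q => rfl

lemma corestrict_relResolution (N : LeftComod k C) : ∀ i, (relResolution π N i).corestrict π =
    cotensorPower ((Bicomod.regular k C).corestrict π) (N.corestrict π) i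
  | 0 => rfl
  | i + 1 => by
    rw [cotensorPower, ← corestrict_relResolution N i, leftCotensor_eq_corestrict_coinduced]
    rfl

variable (V' : LeftComod k C) (V'' : RightComod k C)

/-- The bicomplex with terms `V'' ⊗ C^{⊗ j} ⊗ C^{□_D i + 1} □_D V'`. -/
def relBicomplex : Bicomplex.{u, v} k :=
  Bicomplex.ofComm
    (fun i j => ModuleCat.of k (V'' ⊗[k] iterTensor (k := k) C (relResolution π V' (i + 1)) j))
    (fun i j => cobarMap V'' (relDiff π V' (i + 1)) j)
    (fun i j => cobarDiff V'' (relResolution π V' (i + 1)) j)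
    (fun i j => (Module.Flat.lTensor_exact V''
      (iterMap_exact (relDiff_exact π V' (i + 1)) j)).apply_apply_eq_zero)
    (fun _ j => cobarDiff_cobarDiff V'' _ j)
    (fun i j x => (cobarDiff_cobarMap V'' (relDiff π V' (i + 1)) j x).symm)

lemma hochComplex_d (V : Bicomod k C) (n : ℕ) (x : hochObj V n) :
    ((hochComplex V).d n (n + 1)).hom x = hochDiff V n x :=
  LinearMap.congr_fun (congrArg ModuleCat.Hom.hom (CochainComplex.of_d (hochObj V) _ n)) x

/-- The augmentation of row `j` is the unit `V' → C □_D V'`, tensored with `V'' ⊗ C^{⊗ j}` and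
preceded by the identification with Hochschild cochains. The augmented rows are the relative
resolution tensored with a vector space, hence exact. -/
lemma nonempty_hochschild_equiv_tot (n : ℕ) :
    Nonempty (hochschild (tensorBicomod V' V'') n ≃ₗ[k] (relBicomplex π V' V'').tot.homology n) :=
  (relBicomplex π V' V'').nonempty_homology_equiv_tot (hochComplex (tensorBicomod V' V''))
    (fun j => cobarMap V'' (relUnit π V') j ∘ₗ (hochCobarEquiv V' V'' j).toLinearMap)
    (fun j a => by
      refine Eq.trans ?_ (congrArg (fun z => cobarMap V'' (relUnit π V') (j + 1)
        (hochCobarEquiv V' V'' (j + 1) z)) (hochComplex_d (tensorBicomod V' V'') j a).symm)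
      refine Eq.trans ?_ (congrArg (cobarMap V'' (relUnit π V') (j + 1))
        (cobarDiff_hochCobarEquiv V' V'' j a))
      refine Eq.trans ?_ (cobarDiff_cobarMap V'' (relUnit π V') j _)
      change ((-1 : k) ^ 0 • cobarDiff V'' _ j) _ = _
      rw [pow_zero, one_smul]
      rfl)
    (fun j => (Module.Flat.lTensor_preserves_injective_linearMap (M := V'') _
      (iterMap_injective (relUnit_injective π V') j)).comp (hochCobarEquiv V' V'' j).injective)
    (fun j y => by
      refine (Module.Flat.lTensor_exact V'' (iterMap_exact (relDiff_exact π V' 0) j) y).trans ?_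
      constructor
      · rintro ⟨x, rfl⟩
        exact ⟨(hochCobarEquiv V' V'' j).symm x,
          congrArg (cobarMap V'' (relUnit π V') j) (LinearEquiv.apply_symm_apply _ x)⟩
      · rintro ⟨x, rfl⟩
        exact ⟨_, rfl⟩)
    (fun i j => Module.Flat.lTensor_exact V'' (iterMap_exact (relDiff_exact π V' (i + 1)) j))
    n

lemma relBicomplex_convergesTo :
    ConvergesTo (relBicomplex π V' V'').tot.spectralSequence
      (hochschild (tensorBicomod V' V'')) :=
  FilteredDiffModule.convergesTo _ _
    (fun n => (nonempty_hochschild_equiv_tot π V' V'' n).some.symm)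

/-- Column `i` is the cobar complex over `C` of `C □_D X`, where `X` is the `i`-th term of the
relative resolution, with differential rescaled by `(-1)^i`; change of coalgebras then passes from
`C` to `D`. -/
lemma nonempty_page_one_iso_cobar
    (hC : ((Bicomod.regular k C).corestrict π).right.Coflat) (i j : ℕ) :
    Nonempty (((relBicomplex π V' V'').tot.spectralSequence.page 1 le_rfl).X (i, j) ≅
      (cobarComplex (V''.corestrict π) (cotensorPower ((Bicomod.regular k C).corestrict π)
        (V'.corestrict π) i)).homology j) := by
  obtain ⟨e⟩ := (relBicomplex π V' V'').nonempty_page_one_iso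
    (cobarComplex V'' (relResolution π V' (i + 1))) i (fun j => LinearEquiv.refl k _)
    ((-1) ^ i) (pow_ne_zero _ (neg_ne_zero.2 one_ne_zero))
    (fun j a => congrArg (fun z : V'' ⊗[k] iterTensor (k := k) C (relResolution π V' (i + 1))
      (j + 1) => (-1 : k) ^ i • z) (cobarComplex_d V'' (relResolution π V' (i + 1)) j a).symm) j
  obtain ⟨e'⟩ := nonempty_cobar_coinduced_iso π V'' ((relResolution π V' i).corestrict π) hC j
  rw [← corestrict_relResolution]
  exact ⟨e ≪≫ e'⟩

end RelativeResolution

/-! ### Injective bicomodules -/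

section InjectiveBicomodules

variable {k : Type u} {D : Type v} [Field k] [AddCommGroup D] [Module k D] [Coalgebra k D]

/-- The left coaction of a bicomodule `Y`, as a morphism `Y → D ⊗ Y`. -/
def Bicomod.lcoactHom (Y : Bicomod k D) :
    Y.Hom (tensorBicomod (Bicomod.regular k D).left Y.right) where
  lin := Y.lcoact
  lcomm := Y.lcoassoc
  rcomm := by
    ext1 x
    exact (LinearEquiv.symm_apply_eq (TensorProduct.assoc k D Y D)).2
      (LinearMap.congr_fun Y.coact_comm x).symm

/-- The right coaction of a bicomodule `Y`, as a morphism `Y → Y ⊗ D`. -/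
def Bicomod.rcoactHom (Y : Bicomod k D) :
    Y.Hom (tensorBicomod Y.left (Bicomod.regular k D).right) where
  lin := Y.rcoact
  lcomm := Y.coact_comm
  rcomm := by
    ext1 x
    exact (LinearEquiv.symm_apply_eq (TensorProduct.assoc k Y D D)).2
      (LinearMap.congr_fun Y.rcoassoc x).symm

/-- The left coaction embeds `Y` in the bicomodule `D ⊗ Y`, the counit being a linear left inverse,
and injectivity extends the identity of `Y` along this embedding. -/
lemma Bicomod.Injective.exists_left_retraction {Y : Bicomod k D} (hY : Y.Injective) :
    ∃ r : (tensorBicomod (Bicomod.regular k D).left Y.right).Hom Y,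
      ∀ y, r.lin (Y.lcoact y) = y := by
  obtain ⟨r, hr⟩ := hY _ _ Y.lcoactHom ⟨LinearMap.id, by ext; simp, by ext; simp⟩
    (Function.LeftInverse.injective (g := counitLeft Y) (LinearMap.congr_fun Y.counit_lcoact))
  exact ⟨r, LinearMap.congr_fun hr⟩

/-- A right comodule is relatively injective if its coaction has a colinear retraction. -/
def RightComod.RelInjective (I : RightComod k D) : Prop :=
  ∃ r : I ⊗[k] D →ₗ[k] I, (∀ x, r (I.coact x) = x) ∧
    ∀ t, I.coact (r t) = r.rTensor D (rightStep I (Coalgebra.comul (R := k) (A := D)) t)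

lemma Bicomod.Injective.right_relInjective {Y : Bicomod k D} (hY : Y.Injective) :
    Y.right.RelInjective := by
  obtain ⟨r, hr⟩ := hY _ _ Y.rcoactHom ⟨LinearMap.id, by ext; simp, by ext; simp⟩
    (Function.LeftInverse.injective (g := TensorProduct.rid k Y ∘
      (Coalgebra.counit (R := k) (A := D)).lTensor Y) (LinearMap.congr_fun Y.counit_rcoact))
  exact ⟨r.lin, LinearMap.congr_fun hr, LinearMap.congr_fun r.rcomm⟩

variable (k D) in
-- The coalgebra `D` is not assumed injective as a bicomodule, but `ε ⊗ D` retracts its right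
-- coaction. This starts the contraction of `D → Y` at the augmentation.
lemma regular_right_relInjective : (Bicomod.regular k D).right.RelInjective := by
  refine ⟨counitLeft D, LinearMap.congr_fun (Bicomod.regular k D).counit_lcoact, fun t => ?_⟩
  induction t with
  | zero => simp only [map_zero]
  | add a b ha hb => simp only [map_add, ha, hb]
  | tmul c d =>
    rw [rightStep_tmul, counitLeft_tmul]
    refine (map_smul _ _ _).trans ?_
    change _ • Coalgebra.comul (R := k) d = _
    induction Coalgebra.comul (R := k) d with
    | zero => simp
    | add p q hp hq => simp only [TensorProduct.tmul_add, smul_add, map_add, hp, hq]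
    | tmul p q => rw [TensorProduct.assoc_symm_tmul, LinearMap.rTensor_tmul, counitLeft_tmul,
        TensorProduct.smul_tmul']

/-! ### Cotensor products inherit a left retraction -/

section LeftRetraction

variable {Y : Bicomod k D} (r : (tensorBicomod (Bicomod.regular k D).left Y.right).Hom Y)
  (W : LeftComod k D)

/-- The map `D ⊗ (Y ⊗ W) → Y ⊗ W` induced by `r : D ⊗ Y → Y`. -/
def tensorContr : D ⊗[k] (Y ⊗[k] W) →ₗ[k] Y ⊗[k] W :=
  let s : D ⊗[k] Y →ₗ[k] Y := r.lin
  s.rTensor W ∘ₗ (TensorProduct.assoc k D Y W).symm.toLinearMap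

lemma tensorContr_tmul (d : D) (y : Y) (w : W) :
    tensorContr r W (d ⊗ₜ[k] (y ⊗ₜ[k] w)) = r.lin (d ⊗ₜ[k] y) ⊗ₜ[k] w := rfl

lemma tensorContr_tensorCoact (hr : ∀ y, r.lin (Y.lcoact y) = y) (t : Y ⊗[k] W) :
    tensorContr r W (tensorCoact Y W t) = t := by
  induction t with
  | zero => simp only [map_zero]
  | add a b ha hb => simp only [map_add, ha, hb]
  | tmul y w =>
    have h : tensorContr r W (TensorProduct.assoc k D Y W (Y.lcoact y ⊗ₜ[k] w)) =
        r.lin (Y.lcoact y) ⊗ₜ[k] w :=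
      let s : D ⊗[k] Y →ₗ[k] Y := r.lin
      congrArg (s.rTensor W) (LinearEquiv.symm_apply_apply (TensorProduct.assoc k D Y W) _)
    exact h.trans (by rw [hr])

lemma tensorCoact_tensorContr (t : D ⊗[k] (Y ⊗[k] W)) :
    tensorCoact Y W (tensorContr r W t) = (tensorContr r W).lTensor D
      (leftStep (Y ⊗[k] W) (Coalgebra.comul (R := k) (A := D)) t) := by
  induction t with
  | zero => simp only [map_zero]
  | add a b ha hb => simp only [map_add, ha, hb]
  | tmul d t =>
    induction t with
    | zero => simp only [TensorProduct.tmul_zero, map_zero]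
    | add a b ha hb => simp only [TensorProduct.tmul_add, map_add, ha, hb]
    | tmul y w =>
      let s : D ⊗[k] Y →ₗ[k] Y := r.lin
      have h : Y.lcoact (r.lin (d ⊗ₜ[k] y)) = s.lTensor D
        (TensorProduct.assoc k D D Y (Coalgebra.comul (R := k) d ⊗ₜ[k] y)) :=
        LinearMap.congr_fun r.lcomm (d ⊗ₜ[k] y)
      rw [tensorContr_tmul, tensorCoact, leftStep_tmul, leftStep_tmul, h]
      induction Coalgebra.comul (R := k) d with
      | zero => simp only [TensorProduct.zero_tmul, map_zero]
      | add p q hp hq => simp only [TensorProduct.add_tmul, map_add, hp, hq]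
      | tmul p q => rfl

lemma tensorContr_mem (t : D ⊗[k] cotensor Y.right W) :
    tensorContr r W ((cotensorIncl Y W).lTensor D t) ∈ cotensor Y.right W := by
  induction t with
  | zero => simp only [map_zero, Submodule.zero_mem]
  | add a b ha hb => simp only [map_add]; exact Submodule.add_mem _ ha hb
  | tmul d x =>
    -- `d ⊗ x` lies in `(D ⊗ Y) □_D W`, and `r` is right colinear, so its image stays in `Y □_D W`.
    refine map_mem_cotensor (V := (tensorBicomod (Bicomod.regular k D).left Y.right).right)
      (V' := Y.right) ⟨r.lin, r.rcomm⟩ (LeftComod.Hom.id W)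
      ((TensorProduct.assoc k D Y W).symm (d ⊗ₜ[k] x.1)) ?_
    refine mem_cotensor.2 ?_
    have h := mem_cotensor.1 x.2
    have e1 : ∀ z : Y ⊗[k] W, TensorProduct.assoc k (D ⊗[k] Y) D W
        ((rightStep D Y.rcoact).rTensor W ((TensorProduct.assoc k D Y W).symm (d ⊗ₜ[k] z))) =
        (TensorProduct.assoc k D Y (D ⊗[k] W)).symm
          (d ⊗ₜ[k] TensorProduct.assoc k Y D W (Y.rcoact.rTensor W z)) := by
      intro z
      induction z with
      | zero => simp
      | add a b ha hb => simp only [TensorProduct.tmul_add, map_add, ha, hb]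
      | tmul y w =>
        rw [TensorProduct.assoc_symm_tmul, LinearMap.rTensor_tmul, LinearMap.rTensor_tmul,
          rightStep_tmul]
        induction Y.rcoact y with
        | zero => simp
        | add p q hp hq => simp only [TensorProduct.tmul_add, TensorProduct.add_tmul, map_add, hp, hq]
        | tmul p q => rfl
    have e2 : ∀ z : Y ⊗[k] W, W.coact.lTensor (D ⊗[k] Y)
        ((TensorProduct.assoc k D Y W).symm (d ⊗ₜ[k] z)) =
        (TensorProduct.assoc k D Y (D ⊗[k] W)).symm (d ⊗ₜ[k] W.coact.lTensor Y z) := by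
      intro z
      induction z with
      | zero => simp
      | add a b ha hb => simp only [TensorProduct.tmul_add, map_add, ha, hb]
      | tmul y w => rfl
    exact (e1 x.1).trans ((congrArg (fun z : Y ⊗[k] (D ⊗[k] W) =>
      (TensorProduct.assoc k D Y (D ⊗[k] W)).symm (d ⊗ₜ[k] z)) h).trans (e2 x.1).symm)

/-- `r ⊗ W` retracts the coaction of `Y ⊗ W` colinearly. It preserves the cotensor product because
`r` is a bicomodule map, so the retraction restricts. -/
lemma leftCotensor_relInjective (hr : ∀ y, r.lin (Y.lcoact y) = y) :
    (leftCotensor Y W).RelInjective := by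
  let R : D ⊗[k] cotensor Y.right W →ₗ[k] cotensor Y.right W :=
    (tensorContr r W ∘ₗ (cotensorIncl Y W).lTensor D).codRestrict _ (tensorContr_mem r W)
  have hR : cotensorIncl Y W ∘ₗ R = tensorContr r W ∘ₗ (cotensorIncl Y W).lTensor D := rfl
  refine ⟨R, fun x => Subtype.ext ?_, fun t => ?_⟩
  · refine Eq.trans ?_ (tensorContr_tensorCoact r W hr x.1)
    exact congrArg (tensorContr r W) (lTensor_incl_cotensorCoact Y W x)
  · apply lTensor_incl_injective Y W D
    refine (lTensor_incl_cotensorCoact Y W (R t)).trans ?_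
    refine (tensorCoact_tensorContr r W ((cotensorIncl Y W).lTensor D t)).trans ?_
    refine Eq.trans ?_ (LinearMap.lTensor_comp_apply D (cotensorIncl Y W) R _)
    rw [hR, LinearMap.lTensor_comp_apply]
    exact congrArg _ (coactLeft_lTensor (Bicomod.regular k D).right (cotensorIncl Y W) t)

end LeftRetraction

lemma Bicomod.Injective.leftCotensor_relInjective {Y : Bicomod k D} (hY : Y.Injective)
    (W : LeftComod k D) : (leftCotensor Y W).RelInjective := by
  obtain ⟨r, hr⟩ := hY.exists_left_retraction
  exact CoalgCoh.leftCotensor_relInjective r W hr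

/-! ### Colinear extensions and split exactness -/

/-- Composition of morphisms of right comodules. -/
def RightComod.Hom.comp {M N P : RightComod k D} (g : N.Hom P) (f : M.Hom N) : M.Hom P where
  lin := g.lin ∘ₗ f.lin
  comm := by
    rw [← LinearMap.comp_assoc, g.comm, LinearMap.comp_assoc, f.comm, LinearMap.rTensor_comp,
      LinearMap.comp_assoc]

/-- The difference of two morphisms of right comodules. -/
def RightComod.Hom.sub {M N : RightComod k D} (f g : M.Hom N) : M.Hom N where
  lin := f.lin - g.lin
  comm := by
    rw [LinearMap.comp_sub, f.comm, g.comm, LinearMap.rTensor_sub, LinearMap.sub_comp]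

lemma rightStep_rTensor {A A' : Type v} [AddCommGroup A] [Module k A] [AddCommGroup A']
    [Module k A'] (f : A →ₗ[k] A') (t : A ⊗[k] D) :
    rightStep A' (Coalgebra.comul (R := k) (A := D)) (f.rTensor D t) =
      (f.rTensor D).rTensor D (rightStep A Coalgebra.comul t) := by
  induction t with
  | zero => simp only [map_zero]
  | add a b ha hb => simp only [map_add, ha, hb]
  | tmul a d =>
    rw [LinearMap.rTensor_tmul, rightStep_tmul, rightStep_tmul]
    induction Coalgebra.comul (R := k) d with
    | zero => simp
    | add p q hp hq => simp only [TensorProduct.tmul_add, map_add, hp, hq]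
    | tmul p q => rfl

/-- Over a field `f` extends along `g` to a linear map `φ` on `B`. The map `r ∘ (φ ⊗ D) ∘ ρ`, with
`ρ` the coaction of `B`, is a colinear replacement and still extends `f`, because `f` and `g` are
colinear and `r` splits the coaction of `I`. -/
lemma RightComod.RelInjective.exists_extension {A B I : RightComod k D} (hI : I.RelInjective)
    (f : A.Hom I) (g : A.Hom B) (hfg : ∀ a, g.lin a = 0 → f.lin a = 0) :
    ∃ h : B.Hom I, ∀ a, h.lin (g.lin a) = f.lin a := by
  obtain ⟨r, h1, h2⟩ := hI
  obtain ⟨φ, hφ⟩ : ∃ φ : B →ₗ[k] I, φ ∘ₗ g.lin = f.lin := by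
    obtain ⟨φ, hφ⟩ := LinearMap.exists_extend
      ((LinearMap.ker g.lin).liftQ f.lin hfg ∘ₗ g.lin.quotKerEquivRange.symm.toLinearMap)
    refine ⟨φ, LinearMap.ext fun a => ?_⟩
    refine (LinearMap.congr_fun hφ ⟨g.lin a, a, rfl⟩).trans ?_
    exact congrArg ((LinearMap.ker g.lin).liftQ f.lin hfg)
      (g.lin.quotKerEquivRange.symm_apply_apply (Submodule.Quotient.mk a))
  have hB : ∀ b, rightStep B Coalgebra.comul (B.coact b) = B.coact.rTensor D (B.coact b) :=
    fun b => (LinearEquiv.symm_apply_eq _).2 (LinearMap.congr_fun B.coassoc b).symm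
  refine ⟨⟨r ∘ₗ φ.rTensor D ∘ₗ B.coact, LinearMap.ext fun b => ?_⟩, fun a => ?_⟩
  · simp only [LinearMap.comp_apply, LinearMap.rTensor_comp]
    rw [h2, rightStep_rTensor, hB]
  · have hg := LinearMap.congr_fun g.comm a
    have hf := LinearMap.congr_fun f.comm a
    simp only [LinearMap.comp_apply] at hg hf ⊢
    rw [hg, ← LinearMap.rTensor_comp_apply, hφ, ← hf, h1]

/-- The coaction `W → D □_D W`. -/
def LeftComod.cotensorUnit (W : LeftComod k D) : W.Hom (leftCotensor (Bicomod.regular k D) W) where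
  lin := W.coact.codRestrict (cotensor (Bicomod.regular k D).right W)
    fun w => mem_cotensor.2 (LinearMap.congr_fun W.coassoc w)
  comm := by
    ext1 w
    apply lTensor_incl_injective (Bicomod.regular k D) W D
    refine (lTensor_incl_cotensorCoact (Bicomod.regular k D) W _).trans ?_
    refine Eq.trans ?_ (LinearMap.lTensor_comp_apply D (cotensorIncl (Bicomod.regular k D) W) _ _)
    exact LinearMap.congr_fun W.coassoc w

/-- This is `W ≅ D □_D W`, with inverse given by the counit on `D`. -/
lemma LeftComod.cotensorUnit_bijective (W : LeftComod k D) :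
    Function.Bijective W.cotensorUnit.lin := by
  constructor
  · have h : Function.Injective W.coact :=
      Function.LeftInverse.injective (g := counitLeft W) (LinearMap.congr_fun W.counit_coact)
    exact fun a b hab => h (congrArg Subtype.val hab)
  · intro x
    refine ⟨counitLeft W x.1, Subtype.ext ?_⟩
    have e : ∀ t : D ⊗[k] W, counitLeft (D ⊗[k] W) (W.coact.lTensor D t) =
        W.coact (counitLeft W t) := by
      intro t
      induction t with
      | zero => simp only [map_zero]
      | add a b ha hb => simp only [map_add, ha, hb]
      | tmul d w => rw [LinearMap.lTensor_tmul, counitLeft_tmul, counitLeft_tmul, map_smul]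
    refine (e x.1).symm.trans ?_
    refine (congrArg (counitLeft (D ⊗[k] W)) (mem_cotensor.1 x.2).symm).trans ?_
    exact counitLeft_comul W x.1

/-- A contraction by right comodule maps survives `- □_D W`, so no coflatness of `W` is required. -/
lemma cotensorMap_exact_of_homotopy {A B C : RightComod k D} (f : A.Hom B) (g : B.Hom C)
    (s : B.Hom A) (t : C.Hom B) (hfg : ∀ a, g.lin (f.lin a) = 0)
    (h : ∀ b, t.lin (g.lin b) + f.lin (s.lin b) = b) (W : LeftComod k D) :
    Function.Exact (cotensorMap f (LeftComod.Hom.id W)) (cotensorMap g (LeftComod.Hom.id W)) := by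
  intro x
  constructor
  · intro hx
    refine ⟨cotensorMap s (LeftComod.Hom.id W) x, Subtype.ext ?_⟩
    have e : ∀ y : B ⊗[k] W, TensorProduct.map t.lin LinearMap.id
        (TensorProduct.map g.lin LinearMap.id y) + TensorProduct.map f.lin LinearMap.id
          (TensorProduct.map s.lin LinearMap.id y) = y := by
      intro y
      induction y with
      | zero => simp only [map_zero, add_zero]
      | add a b ha hb => simp only [map_add]; rw [add_add_add_comm, ha, hb]
      | tmul b w =>
        simp only [TensorProduct.map_tmul, LinearMap.id_apply, ← TensorProduct.add_tmul, h]
    have hx' : TensorProduct.map g.lin LinearMap.id x.1 = 0 := congrArg Subtype.val hx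
    have := e x.1
    rwa [hx', map_zero, zero_add] at this
  · rintro ⟨y, rfl⟩
    apply Subtype.ext
    have e : ∀ y : A ⊗[k] W, TensorProduct.map g.lin LinearMap.id
        (TensorProduct.map f.lin (LinearMap.id (R := k) (M := W)) y) = 0 := by
      intro y
      induction y with
      | zero => simp only [map_zero]
      | add a b ha hb => simp only [map_add, ha, hb, add_zero]
      | tmul a w => simp only [TensorProduct.map_tmul, hfg, TensorProduct.zero_tmul]
    exact e y.1

/-! ### Injective bicomodule resolutions and the cobar complex -/

namespace InjBicomodResolution

variable (Y : InjBicomodResolution k D)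

/-- The differential of a resolution, as a morphism of right comodules. -/
def dRight (n : ℕ) : (Y.obj n).right.Hom (Y.obj (n + 1)).right := ⟨(Y.d n).lin, (Y.d n).rcomm⟩

/-- The augmentation of a resolution, as a morphism of right comodules. -/
def augRight : (Bicomod.regular k D).right.Hom (Y.obj 0).right := ⟨Y.aug.lin, Y.aug.rcomm⟩

/-- First `s` extends the identity of `D` along the augmentation. Then `id - aug ∘ s` vanishes on
the image of the augmentation, which is the kernel of `d 0`, so it extends along `d 0` to `t`. -/
lemma exists_homotopy_aug : ∃ (s : (Y.obj 0).right.Hom (Bicomod.regular k D).right)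
    (t : (Y.obj 1).right.Hom (Y.obj 0).right), (∀ x, s.lin (Y.aug.lin x) = x) ∧
      ∀ x, t.lin ((Y.d 0).lin x) + Y.aug.lin (s.lin x) = x := by
  obtain ⟨s, hs⟩ := (regular_right_relInjective k D).exists_extension
    (RightComod.Hom.id _) Y.augRight fun a ha => Y.aug_injective (ha.trans (map_zero _).symm)
  obtain ⟨t, ht⟩ := (Y.injective 0).right_relInjective.exists_extension
    ((RightComod.Hom.id _).sub (Y.augRight.comp s)) (Y.dRight 0) fun a ha => by
      obtain ⟨b, rfl⟩ := (Y.exact_zero a).1 ha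
      exact sub_eq_zero.2 (congrArg Y.aug.lin (hs b)).symm
  exact ⟨s, t, hs, fun x => eq_sub_iff_add_eq.1 (ht x)⟩

/-- The condition on `s` says that `id - d ∘ s` vanishes on the image of `d n`, the kernel of `d (n
+ 1)`; hence it factors colinearly through `d (n + 1)`. -/
lemma exists_homotopy_succ (n : ℕ) (s : (Y.obj (n + 1)).right.Hom (Y.obj n).right)
    (hs : ∀ x, (Y.d n).lin (s.lin ((Y.d n).lin x)) = (Y.d n).lin x) :
    ∃ t : (Y.obj (n + 2)).right.Hom (Y.obj (n + 1)).right,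
      ∀ x, t.lin ((Y.d (n + 1)).lin x) + (Y.d n).lin (s.lin x) = x := by
  obtain ⟨t, ht⟩ := (Y.injective (n + 1)).right_relInjective.exists_extension
    ((RightComod.Hom.id _).sub ((Y.dRight n).comp s)) (Y.dRight (n + 1)) fun a ha => by
      obtain ⟨b, rfl⟩ := (Y.exact_succ n a).1 ha
      exact sub_eq_zero.2 (hs b).symm
  exact ⟨t, fun x => eq_sub_iff_add_eq.1 (ht x)⟩

/-- Applying the differential to a homotopy identity gives `d t d = d`, which is exactly the input
for the next homotopy. -/
lemma exists_section (n : ℕ) : ∃ s : (Y.obj (n + 1)).right.Hom (Y.obj n).right,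
    ∀ x, (Y.d n).lin (s.lin ((Y.d n).lin x)) = (Y.d n).lin x := by
  induction n with
  | zero =>
    obtain ⟨s, t, -, ht⟩ := Y.exists_homotopy_aug
    refine ⟨t, fun x => ?_⟩
    conv_rhs => rw [← ht x, map_add, Y.exact_zero.apply_apply_eq_zero, add_zero]
  | succ n ih =>
    obtain ⟨s, hs⟩ := ih
    obtain ⟨t, ht⟩ := Y.exists_homotopy_succ n s hs
    refine ⟨t, fun x => ?_⟩
    conv_rhs => rw [← ht x, map_add, (Y.exact_succ n).apply_apply_eq_zero, add_zero]

variable (W : LeftComod k D)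

lemma leftCotensorMap_exact (n : ℕ) : Function.Exact (leftCotensorMap (Y.d n) W).lin
    (leftCotensorMap (Y.d (n + 1)) W).lin := by
  obtain ⟨s, hs⟩ := Y.exists_section n
  obtain ⟨t, ht⟩ := Y.exists_homotopy_succ n s hs
  exact cotensorMap_exact_of_homotopy (Y.dRight n) (Y.dRight (n + 1)) s t
    (Y.exact_succ n).apply_apply_eq_zero ht W

/-- The augmentation `W ≅ D □_D W → Y⁰ □_D W`. -/
def cotensorAug : W.Hom (leftCotensor (Y.obj 0) W) :=
  (leftCotensorMap Y.aug W).comp W.cotensorUnit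

lemma cotensorAug_injective : Function.Injective (Y.cotensorAug W).lin := by
  refine Function.Injective.comp (g := (leftCotensorMap Y.aug W).lin) ?_
    W.cotensorUnit_bijective.1
  have h : Function.Injective (Y.aug.lin.rTensor W) :=
    Module.Flat.rTensor_preserves_injective_linearMap _ Y.aug_injective
  exact fun a b hab => Subtype.ext (h (congrArg Subtype.val hab))

lemma cotensorAug_exact :
    Function.Exact (Y.cotensorAug W).lin (leftCotensorMap (Y.d 0) W).lin := by
  obtain ⟨s, t, -, ht⟩ := Y.exists_homotopy_aug
  have h := cotensorMap_exact_of_homotopy Y.augRight (Y.dRight 0) s t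
    Y.exact_zero.apply_apply_eq_zero ht W
  intro x
  refine (h x).trans ?_
  constructor
  · rintro ⟨y, rfl⟩
    obtain ⟨w, rfl⟩ := W.cotensorUnit_bijective.2 y
    exact ⟨w, rfl⟩
  · rintro ⟨w, rfl⟩
    exact ⟨_, rfl⟩

lemma complex_d (V : RightComod k D) (n : ℕ) (x : cotensor V (leftCotensor (Y.obj n) W)) :
    ((Y.complex V W).d n (n + 1)).hom x =
      cotensorMap (RightComod.Hom.id V) (leftCotensorMap (Y.d n) W) x :=
  LinearMap.congr_fun (congrArg ModuleCat.Hom.hom (CochainComplex.of_d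
    (fun n => ModuleCat.of k (cotensor V (leftCotensor (Y.obj n) W))) _ n)) x

/-- In the bicomplex `V ⊗ D^{⊗ j} ⊗ (Y^i □_D W)` the rows resolve `W ≅ D □_D W`, as `D → Y` splits
on the right. The columns are exact with augmentation `V □_D (Y^i □_D W)`, as `Y^i □_D W` is
relatively injective. -/
theorem nonempty_cobar_iso_cotor (V : RightComod k D) (n : ℕ) :
    Nonempty ((cobarComplex V W).homology n ≅ cotor Y V W n) :=
  Bicomplex.nonempty_homology_iso
    (fun i j => ModuleCat.of k (V ⊗[k] iterTensor (k := k) D (leftCotensor (Y.obj i) W) j))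
    (fun i j => cobarMap V (leftCotensorMap (Y.d i) W) j)
    (fun i j => cobarDiff V (leftCotensor (Y.obj i) W) j)
    (fun i j x => (cobarDiff_cobarMap V (leftCotensorMap (Y.d i) W) j x).symm)
    (cobarComplex V W) (Y.complex V W)
    (fun j => cobarMap V (Y.cotensorAug W) j)
    (fun i => (cotensor V (leftCotensor (Y.obj i) W)).subtype)
    (fun j a => (cobarDiff_cobarMap V (Y.cotensorAug W) j a).trans
      (congrArg (cobarMap V (Y.cotensorAug W) (j + 1)) (cobarComplex_d V W j a).symm))
    (fun i b => congrArg (cotensor V (leftCotensor (Y.obj (i + 1)) W)).subtype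
      (Y.complex_d W V i b).symm)
    (fun j => Module.Flat.lTensor_preserves_injective_linearMap (M := V) _
      (iterMap_injective (Y.cotensorAug_injective W) j))
    (fun _ => Submodule.subtype_injective _)
    (fun j => Module.Flat.lTensor_exact V (iterMap_exact (Y.cotensorAug_exact W) j))
    (fun i j => Module.Flat.lTensor_exact V (iterMap_exact (Y.leftCotensorMap_exact W i) j))
    (fun i => cotensor_exact V (leftCotensor (Y.obj i) W))
    (fun i j => cobarDiff_exact V ((Y.injective i).leftCotensor_relInjective W) j) n

end InjBicomodResolution

end InjectiveBicomodules

end CoalgCoh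

end

/-! ### The main theorem -/

theorem mainTheorem4 {k : Type u} {C D : Type v} [Field k]
    [AddCommGroup C] [Module k C] [Coalgebra k C]
    [AddCommGroup D] [Module k D] [Coalgebra k D]
    (π : C →ₗc[k] D) (hπ : Function.Surjective π)
    (V' : LeftComod k C) (V'' : RightComod k C)
    (hleft : ((Bicomod.regular k C).corestrict π).left.Coflat)
    (hright : ((Bicomod.regular k C).corestrict π).right.Coflat) :
    ∃ E : CohomologicalSpectralSequenceNat (ModuleCat.{v} k) 1,
      (∀ (Y : InjBicomodResolution k D) (i j : ℕ),
        Nonempty ((E.page 1 le_rfl).X (i, j) ≅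
          cotor Y (V''.corestrict π)
            (cotensorPower ((Bicomod.regular k C).corestrict π) (V'.corestrict π) i) j)) ∧
      (∀ i j : ℕ,
        Nonempty ((E.page 1 le_rfl).X (i, j) ≅
          (cobarComplex (V''.corestrict π)
            (cotensorPower ((Bicomod.regular k C).corestrict π)
              (V'.corestrict π) i)).homology j)) ∧
      ConvergesTo E (hochschild (tensorBicomod V' V'')) := by
  refine ⟨(relBicomplex π V' V'').tot.spectralSequence, fun Y i j => ?_,
    fun i j => nonempty_page_one_iso_cobar π V' V'' hright i j,
    relBicomplex_convergesTo π V' V''⟩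
  obtain ⟨e⟩ := nonempty_page_one_iso_cobar π V' V'' hright i j
  obtain ⟨e'⟩ := Y.nonempty_cobar_iso_cotor (cotensorPower ((Bicomod.regular k C).corestrict π)
    (V'.corestrict π) i) (V''.corestrict π) j
  exact ⟨e ≪≫ e'⟩
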